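/- Setting. Let $P$ be a simple polygon (the closed region) with boundary $\partial P$ and vertices $u=v_1,v_2,\dots,v_n=v$ in order ($n\ge 3$), so that $\overline{uv}$ is an edge of $P$. Assume that $\overline{uv}$ lies on the $x$-axis with $u$ to the left of $v$, that $P$ lies in the closed halfplane above the $x$-axis (in particular, the angles of $P$ at $u$ and $v$ are not reflex), and that $P$ is weakly visible from $\overline{uv}$ (a WV-polygon). Here two points see each other if the segment joining them is contained in $P$, and weak visibility means that every point of $P$ is seen by some point of $\overline{uv}$. For $p\in P$ let $\mathrm{Vis}(p)=\{q:\overline{pq}\subseteq P\}$. A set $G$ guards a set $S$ if every point of $S$ is seen by some point of $G$. A hole in $P$ w.r.t. $G$ is a (nonempty) connected set $H\subseteq P$ no point of which is seen by a point of $G$ and which is maximal: every connected subset of $P$ strictly containing $H$ has a point seen by a point of $G$. For $g\in P$, a pocket of $g$ is a connected component $C$ of $P\setminus \mathrm{Vis}(g)$, and its constructed edge is the segment $\overline{xy}=\overline{C}\cap \mathrm{Vis}(g)$ along which $C$ is adjacent to $\mathrm{Vis}(g)$; we write $C_{xy}$ for $C$ and name the endpoints so that $x$ is not above $y$. The constructed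 edge is an upper edge if $C_{xy}$ lies below the line $\ell_{xy}$, in the sense that, for every $w$ in the interior of $\overline{xy}$, all points of $\mathrm{Vis}(w)$ that lie strictly below $\ell_{xy}$ belong to $C_{xy}$ (a vertical edge is not an upper edge). Let $E$ be the set of the constructed edges of all $\mathrm{Vis}(g)$, $g\in G$. Algorithm 1. For each upper edge $e=\overline{xy}$ in $E$ with $x\in\overline{uv}$: (1) find the topmost intersection point $p$ of $e$ with an edge $e'=\overline{x'y'}$ in $E$ such that $x'\in\overline{uv}$ and $x'$ is strictly on the same side of $\ell_{xy}$ as the pocket $C_{xy}$, i.e. below $\ell_{xy}$; (2) if such a point exists, find a vertex of $P$ that guards the triangle $\triangle xpx'$ (if several edges $e'$ pass through $p$, any one of them may be used), and add this vertex to $G'$. Claim. Let $G\subseteq P$ be a finite set of points that guards $\partial P$. Then: (a) Every triangle $\triangle xpx'$ that Algorithm 1 may consider is contained in $P$, and some single vertex of $P$ sees all of it; hence Algorithm 1 can be carried out. (b) In every run of Algorithm 1, i.e. for all the choices it may make, every hole $H$ in $P$ w.r.t. $G$ is contained in one of the triangles considered in that run, and the output $G'$ satisfies $|G'|\le|G|$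 and $G\cup G'$ guards $P$. In particular, there is a set $G'$ of vertices of $P$ with $|G'|\le |G|$ such that $G\cup G'$ guards $P$ (boundary and interior). -/

import Mathlib

open Set

namespace WVPolygon

/-- Points of the plane, as pairs of coordinates. -/
abbrev Pt : Type := ℝ × ℝ

/-- A closed polygonal chain with at least three vertices is simple if its vertices are distinct,
two consecutive edges meet only in their common vertex, and any two other edges are disjoint. -/
structure IsSimple {m : ℕ} (poly : Polygon Pt (m + 3)) : Prop where
  injective : Function.Injective poly.vertices
  consecutive : ∀ i, poly.edgeSet ℝ i ∩ poly.edgeSet ℝ (i + 1) = {poly (i + 1)}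
  disjoint : ∀ i j, i ≠ j → j ≠ i + 1 → i ≠ j + 1 →
    Disjoint (poly.edgeSet ℝ i) (poly.edgeSet ℝ j)

section Visibility

variable {m : ℕ} (poly : Polygon Pt (m + 3))

/-- The closed region `P` bounded by the polygon: the boundary `∂P` together with the bounded
connected components of its complement. -/
def region : Set Pt :=
  poly.boundary ℝ ∪
    {z | z ∉ poly.boundary ℝ ∧
      Bornology.IsBounded (connectedComponentIn (poly.boundary ℝ)ᶜ z)}

/-- The vertex `u`, i.e. the first vertex. -/
def u : Pt := poly 0

/-- The vertex `v`, i.e. the last vertex. -/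
def v : Pt := poly (Fin.last (m + 2))

/-- The distinguished edge `uv`, which joins the last vertex to the first one. -/
def baseEdge : Set Pt := segment ℝ (u poly) (v poly)

/-- The visibility polygon `Vis(p)`. -/
def vis (p : Pt) : Set Pt := {q | segment ℝ p q ⊆ region poly}

/-- Every point of `S` is visible from some point of `G`. -/
def Guards (G S : Set Pt) : Prop := ∀ z ∈ S, ∃ g ∈ G, z ∈ vis poly g

/-- A WV-polygon, weakly visible from its edge `uv`, in standard position: the edge `uv` lies on the
`x`-axis with `u` to the left of `v`, and `P` lies in the closed upper halfplane. -/
structure IsWV : Prop where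
  simple : IsSimple poly
  u_axis : (u poly).2 = 0
  v_axis : (v poly).2 = 0
  u_left : (u poly).1 < (v poly).1
  upper_halfplane : ∀ z ∈ region poly, 0 ≤ z.2
  weakly_visible : ∀ z ∈ region poly, ∃ c ∈ baseEdge poly, z ∈ vis poly c

/-- A hole in `P` w.r.t. `G`: a connected subset of `P` with no point visible from `G`, such that
every connected subset of `P` strictly containing it has a point visible from `G`. -/
structure IsHole (G H : Set Pt) : Prop where
  connected : IsConnected H
  subset : H ⊆ region poly
  unseen : ∀ z ∈ H, ∀ g ∈ G, z ∉ vis poly g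
  maximal : ∀ K, K ⊆ region poly → IsConnected K → H ⊂ K → ∃ z ∈ K, ∃ g ∈ G, z ∈ vis poly g

/-- A pocket of `g`: a connected component of `P \ Vis(g)`. -/
def IsPocket (g : Pt) (C : Set Pt) : Prop :=
  ∃ z ∈ region poly \ vis poly g, C = connectedComponentIn (region poly \ vis poly g) z

/-- `xy` is the constructed edge of `Vis(g)` adjacent to the pocket `C` of `g`, with `x` its lower
endpoint: the edge of `Vis(g)` along which `Vis(g)` and `C` are adjacent, i.e. `Vis(g) ∩ closure C`.
(The two orderings of a horizontal edge are both allowed.) -/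
structure IsConstructedEdge (g : Pt) (C : Set Pt) (x y : Pt) : Prop where
  pocket : IsPocket poly g C
  ne : x ≠ y
  le : x.2 ≤ y.2
  eq_segment : closure C ∩ vis poly g = segment ℝ x y

/-- The point `z` is (strictly) below the line `ℓ_{xy}`. -/
def IsBelow (x y z : Pt) : Prop := ∃ t : ℝ, 0 < t ∧ (z.1, z.2 + t) ∈ line[ℝ, x, y]

/-- `C` lies below `ℓ_{xy}`, so that the constructed edge `xy` with pocket `C` is an upper edge: for
every `w` in the interior of `xy`, all the points seen by `w` that are below `ℓ_{xy}` are in `C`.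
(This never holds for a constructed edge that is vertical.) -/
def LiesBelow (C : Set Pt) (x y : Pt) : Prop :=
  ∀ w ∈ openSegment ℝ x y, ∀ q ∈ vis poly w, IsBelow x y q → q ∈ C

/-- The constructed edges `xy` (as pairs `(x, y)`, with `x` below `y`) of the visibility polygons of
the points of `G` that satisfy `x ∈ uv`. -/
def baseConstructedEdges (G : Set Pt) : Set (Pt × Pt) :=
  {e | e.1 ∈ baseEdge poly ∧ ∃ g ∈ G, ∃ C, IsConstructedEdge poly g C e.1 e.2}

/-- The edges over which the algorithm loops: the upper edges `xy` in `E` with `x ∈ uv`. -/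
def upperBaseEdges (G : Set Pt) : Set (Pt × Pt) :=
  {e | e.1 ∈ baseEdge poly ∧
    ∃ g ∈ G, ∃ C, IsConstructedEdge poly g C e.1 e.2 ∧ LiesBelow poly C e.1 e.2}

/-- `p` is an intersection point of the upper edge `e = xy` with an edge `e' = x'y'` in `E` with
`x' ∈ uv` such that `x'` is on the same side of `ℓ_{xy}` as the pocket adjacent to `e`; as `e` is an
upper edge, this is the side below `ℓ_{xy}`. -/
def IsCrossing (G : Set Pt) (e : Pt × Pt) (p x' : Pt) : Prop :=
  p ∈ segment ℝ e.1 e.2 ∧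
    ∃ y', (x', y') ∈ baseConstructedEdges poly G ∧ p ∈ segment ℝ x' y' ∧ IsBelow e.1 e.2 x'

/-- `p` is the topmost such intersection point on `e`, and it is attained by an edge with lower
endpoint `x'` (several edges may pass through the topmost point). -/
def IsTopmostCrossing (G : Set Pt) (e : Pt × Pt) (p x' : Pt) : Prop :=
  IsCrossing poly G e p x' ∧ ∀ q x'', IsCrossing poly G e q x'' → q.2 ≤ p.2

/-- The closed triangle with the given corners. -/
def triangle (a b c : Pt) : Set Pt := convexHull ℝ {a, b, c}

/-- The edges for which the algorithm finds an intersection point. -/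
def activeEdges (G : Set Pt) : Set (Pt × Pt) :=
  {e ∈ upperBaseEdges poly G | ∃ p x', IsCrossing poly G e p x'}

/-- A run of the algorithm on `P` and `G`. For each upper edge `e = xy` in `E` with `x ∈ uv` for
which an intersection point exists, the run picks the topmost intersection point `p = apex e`, an
edge through it with lower endpoint `x' = foot e`, and a vertex (with index `guard e`) that guards
the triangle `x p x'`. The values at all other arguments play no role. -/
structure Run (G : Set Pt) where
  apex : Pt × Pt → Pt
  foot : Pt × Pt → Pt
  guard : Pt × Pt → Fin (m + 3)
  topmost : ∀ e ∈ activeEdges poly G, IsTopmostCrossing poly G e (apex e) (foot e)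
  guarded : ∀ e ∈ activeEdges poly G,
    triangle e.1 (apex e) (foot e) ⊆ vis poly (poly (guard e))

variable {poly}

/-- The triangles considered by a run of the algorithm. -/
def Run.triangles {G : Set Pt} (R : Run poly G) : Set (Set Pt) :=
  {T | ∃ e ∈ activeEdges poly G, T = triangle e.1 (R.apex e) (R.foot e)}

/-- The output `G'` of a run of the algorithm: the set of all the vertices it picked. -/
def Run.output {G : Set Pt} (R : Run poly G) : Set Pt :=
  {w | ∃ e ∈ activeEdges poly G, w = poly (R.guard e)}

end Visibility

end WVPolygon

/-! The proof uses only the properties of P collected in `Dom`; `IsWV.dom` derives them from the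
polygon.

Winding. A point k outside P lies in an unbounded connected set disjoint from P, so w - k has a
continuous argument for w in P. Along a segment contained in P this argument changes by less than π,
and the sign of the change is an orientation. Hence no circuit of segments of P winds around a
missing point. In particular a triangle whose sides lie in P lies in P (`Dom.triangle_subset`), and
the base points visible from a given point form an interval.

Guarding one triangle. A constructed edge x y of g with x on the base and y above it lies on the
segment from x to g, ends strictly below g, and y is a vertex; otherwise g would see into its own
pocket. If an edge from x' crosses x y in p, move p up along x y to the last point s that x' sees.
Either s = y, or the view from x' is blocked just beyond s; in both cases a vertex lies on the
segment x' s. It belongs to the convex set x s x', which is contained in P and contains x p x', so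
it sees all of x p x' (`Dom.exists_vertex_guard`).

Locating unseen points. Let z be unseen. For each base point c visible from z, prolong the sight
line c z until it leaves P. The exit point is seen by some g of G. As g does not see z, it does not
see c, so its visible base points are all to the right or all to the left of c. At the right end of
the interval of such c the first case is impossible, at the left end the second. Both cases are
closed conditions, so some c has both, for points g₁ and g₂. Then the leftmost sight line of g₁ and
the rightmost one of g₂ cross and form, with the base, a triangle around z (`Dom.exists_isPair`).
Both contain constructed edges through the crossing, and at least one leans so as to be an upper
edge. Choose such a pair with shortest base. The topmost crossing on its upper edge gives a triangle
that still contains z, since otherwise the crossing edge would yield a pair with a shorter base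
(`IsPair.mem_triangle_of_isTop`). The sides of this triangle are seen from G, so a connected unseen
set that contains z stays inside.

Counting. If one g had two upper edges rising from different base points, one foot would lie below
the other edge, which `Dom.not_isBelow` forbids; from the same foot there is only one such edge. So
the active edges inject into G. -/

namespace WVPolygon

/-! ### Points, cross products and segments in the plane -/

/-- The point `a + t (b - a)` of the line through `a` and `b`. -/
def pt (a b : Pt) (t : ℝ) : Pt := (a.1 + t * (b.1 - a.1), a.2 + t * (b.2 - a.2))

@[simp] theorem pt_fst (a b : Pt) (t : ℝ) : (pt a b t).1 = a.1 + t * (b.1 - a.1) := rfl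
@[simp] theorem pt_snd (a b : Pt) (t : ℝ) : (pt a b t).2 = a.2 + t * (b.2 - a.2) := rfl
theorem pt_zero (a b : Pt) : pt a b 0 = a := by ext <;> simp
theorem pt_one (a b : Pt) : pt a b 1 = b := by ext <;> simp

theorem continuous_pt (a b : Pt) : Continuous (pt a b) := by
  unfold pt; fun_prop

/-- The cross product of `b - a` and `c - a`; it is positive iff `a`, `b`, `c` are in
counterclockwise order. -/
def cr (a b c : Pt) : ℝ := (b.1 - a.1) * (c.2 - a.2) - (b.2 - a.2) * (c.1 - a.1)

theorem lineMap_eq_pt (a b : Pt) (t : ℝ) : AffineMap.lineMap a b t = pt a b t := by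
  ext <;> simp [AffineMap.lineMap_apply, pt] <;> ring

theorem mem_segment_iff {a b p : Pt} : p ∈ segment ℝ a b ↔ ∃ t, 0 ≤ t ∧ t ≤ 1 ∧ p = pt a b t := by
  rw [segment_eq_image_lineMap]
  constructor
  · rintro ⟨t, ht, rfl⟩
    exact ⟨t, ht.1, ht.2, lineMap_eq_pt _ _ _⟩
  · rintro ⟨t, h0, h1, rfl⟩
    exact ⟨t, ⟨h0, h1⟩, lineMap_eq_pt _ _ _⟩

theorem mem_openSegment_iff {a b p : Pt} :
    p ∈ openSegment ℝ a b ↔ ∃ t, 0 < t ∧ t < 1 ∧ p = pt a b t := by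
  rw [openSegment_eq_image_lineMap]
  constructor
  · rintro ⟨t, ht, rfl⟩
    exact ⟨t, ht.1, ht.2, lineMap_eq_pt _ _ _⟩
  · rintro ⟨t, h0, h1, rfl⟩
    exact ⟨t, ⟨h0, h1⟩, lineMap_eq_pt _ _ _⟩

theorem pt_mem_segment {a b : Pt} {t : ℝ} (h0 : 0 ≤ t) (h1 : t ≤ 1) : pt a b t ∈ segment ℝ a b :=
  mem_segment_iff.2 ⟨t, h0, h1, rfl⟩

theorem segment_subset_left {a b p : Pt} (hp : p ∈ segment ℝ a b) :
    segment ℝ a p ⊆ segment ℝ a b :=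
  (convex_segment a b).segment_subset (left_mem_segment ℝ a b) hp

theorem segment_subset_right {a b p : Pt} (hp : p ∈ segment ℝ a b) :
    segment ℝ p b ⊆ segment ℝ a b :=
  (convex_segment a b).segment_subset hp (right_mem_segment ℝ a b)

theorem isCompact_segment (a b : Pt) : IsCompact (segment ℝ a b) := by
  rw [segment_eq_image_lineMap]
  exact isCompact_Icc.image AffineMap.lineMap_continuous

theorem mem_triangle_iff {a b c p : Pt} : p ∈ triangle a b c ↔
    ∃ α β γ : ℝ, 0 ≤ α ∧ 0 ≤ β ∧ 0 ≤ γ ∧ α + β + γ = 1 ∧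
      p = (α * a.1 + β * b.1 + γ * c.1, α * a.2 + β * b.2 + γ * c.2) := by
  unfold triangle
  rw [convexHull_insert ⟨b, by simp⟩, convexHull_pair]
  simp only [mem_convexJoin, mem_singleton_iff, exists_eq_left]
  constructor
  · rintro ⟨q, hq, hp⟩
    obtain ⟨s, s0, s1, rfl⟩ := mem_segment_iff.1 hq
    obtain ⟨t, t0, t1, rfl⟩ := mem_segment_iff.1 hp
    refine ⟨1 - t, t * (1 - s), t * s, by linarith, by nlinarith, by positivity, by ring, ?_⟩
    ext <;> simp <;> ring
  · rintro ⟨α, β, γ, hα, hβ, hγ, h1, rfl⟩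
    rcases eq_or_lt_of_le (add_nonneg hβ hγ) with h | h
    · have hb : β = 0 := by linarith
      have hc : γ = 0 := by linarith
      have ha : α = 1 := by linarith
      refine ⟨b, left_mem_segment ℝ b c, ?_⟩
      subst hb hc ha
      convert left_mem_segment ℝ a b using 1
      ext <;> simp
    · refine ⟨pt b c (γ / (β + γ)), pt_mem_segment (by positivity) ?_, ?_⟩
      · rw [div_le_one h]; linarith
      · refine mem_segment_iff.2 ⟨β + γ, h.le, by linarith, ?_⟩
        have ha : α = 1 - β - γ := by linarith
        subst ha
        ext <;> simp <;> field_simp <;> ring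

/-- Membership in a counterclockwise triangle, by the signs of cross products. -/
theorem mem_triangle_of_cr {a b c p : Pt} (h : 0 < cr a b c) (h1 : 0 ≤ cr a b p)
    (h2 : 0 ≤ cr b c p) (h3 : 0 ≤ cr c a p) : p ∈ triangle a b c := by
  rw [mem_triangle_iff]
  refine ⟨cr b c p / cr a b c, cr c a p / cr a b c, cr a b p / cr a b c, by positivity,
    by positivity, by positivity, ?_, ?_⟩
  · field_simp; unfold cr; ring
  · have h' := h.ne'
    ext <;> simp <;> field_simp <;> unfold cr <;> ring

theorem cr_nonneg_of_mem_triangle {a b c p : Pt} (h : 0 ≤ cr a b c) (hp : p ∈ triangle a b c) :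
    0 ≤ cr a b p ∧ 0 ≤ cr b c p ∧ 0 ≤ cr c a p := by
  obtain ⟨α, β, γ, hα, hβ, hγ, h1, rfl⟩ := mem_triangle_iff.1 hp
  have ha : α = 1 - β - γ := by linarith
  subst ha
  refine ⟨?_, ?_, ?_⟩
  · have : cr a b ((1 - β - γ) * a.1 + β * b.1 + γ * c.1, (1 - β - γ) * a.2 + β * b.2 + γ * c.2)
      = γ * cr a b c := by unfold cr; ring
    rw [this]; positivity
  · have : cr b c ((1 - β - γ) * a.1 + β * b.1 + γ * c.1, (1 - β - γ) * a.2 + β * b.2 + γ * c.2)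
      = (1 - β - γ) * cr a b c := by unfold cr; ring
    rw [this]; positivity
  · have : cr c a ((1 - β - γ) * a.1 + β * b.1 + γ * c.1, (1 - β - γ) * a.2 + β * b.2 + γ * c.2)
      = β * cr a b c := by unfold cr; ring
    rw [this]; positivity

theorem convex_triangle (a b c : Pt) : Convex ℝ (triangle a b c) := convex_convexHull ℝ _

theorem left_mem_triangle (a b c : Pt) : a ∈ triangle a b c :=
  subset_convexHull ℝ _ (by simp)
theorem mid_mem_triangle (a b c : Pt) : b ∈ triangle a b c :=
  subset_convexHull ℝ _ (by simp)
theorem right_mem_triangle (a b c : Pt) : c ∈ triangle a b c :=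
  subset_convexHull ℝ _ (by simp)

theorem triangle_subset_of_convex {a b c : Pt} {K : Set Pt} (hK : Convex ℝ K) (ha : a ∈ K) (hb : b ∈ K)
    (hc : c ∈ K) : triangle a b c ⊆ K :=
  convexHull_min (by rintro x (rfl | rfl | rfl) <;> assumption) hK

theorem triangle_reverse (a b c : Pt) : triangle a b c = triangle c b a := by
  unfold triangle
  congr 1
  ext x; simp; tauto

theorem triangle_rotate (a b c : Pt) : triangle a b c = triangle b c a := by
  unfold triangle
  congr 1
  ext x; simp; tauto

/-! ### The setting -/

/-- The visibility region of `p` in `P`. -/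
def svis (P : Set Pt) (p : Pt) : Set Pt := {q | segment ℝ p q ⊆ P}

/-- What the proof uses of a weakly visible polygon `P` with vertex set `V` and base
`[a, b] × {0}`. -/
structure Dom (P V : Set Pt) (a b : ℝ) : Prop where
  compact : IsCompact P
  finite : V.Finite
  -- This plays the role of simple connectivity: it provides continuous arguments about the points
  -- outside P.
  filled : ∀ k, k ∉ P → ∃ T : Set Pt, k ∈ T ∧ IsPreconnected T ∧ ¬ Bornology.IsBounded T ∧
    Disjoint T P
  upper : ∀ z ∈ P, 0 ≤ z.2
  lt : a < b
  base : ∀ c, a ≤ c → c ≤ b → ((c, 0) : Pt) ∈ P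
  left_mem : ((a, 0) : Pt) ∈ V
  right_mem : ((b, 0) : Pt) ∈ V
  weak : ∀ z ∈ P, ∃ c, a ≤ c ∧ c ≤ b ∧ ((c, 0) : Pt) ∈ svis P z
  -- `cone` and `line` carry the local polygonal structure: P is conical at every point, and at a
  -- point that is not a vertex it can change only across one line.
  cone : ∀ q : Pt, ∃ ε > 0, ∀ w, dist w q < ε → ∀ t, 0 < t → t ≤ 1 → (w ∈ P ↔ pt q w t ∈ P)
  line : ∀ q, q ∉ V → ∃ ε > 0, ∃ n : Pt, n ≠ 0 ∧ ∀ w w', dist w q < ε → dist w' q < ε →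
    0 < (n.1 * (w.1 - q.1) + n.2 * (w.2 - q.2)) * (n.1 * (w'.1 - q.1) + n.2 * (w'.2 - q.2)) →
    (w ∈ P ↔ w' ∈ P)

theorem svis_comm {P : Set Pt} {p q : Pt} : q ∈ svis P p ↔ p ∈ svis P q := by
  simp only [svis, mem_ofPred_eq, segment_symm]

theorem svis_subset {P : Set Pt} {p : Pt} : svis P p ⊆ P :=
  fun q hq => hq (right_mem_segment ℝ p q)

theorem mem_svis_of_mem_segment {P : Set Pt} {p q r : Pt} (h : q ∈ svis P p)
    (hr : r ∈ segment ℝ p q) : r ∈ svis P p :=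
  (segment_subset_left hr).trans h

theorem svis_self {P : Set Pt} {p : Pt} (h : p ∈ P) : p ∈ svis P p := by
  simpa [svis] using h

/-! ### Continuous arguments -/

/-- The point `p` as a complex number. -/
def toC (p : Pt) : ℂ := ⟨p.1, p.2⟩

theorem continuous_toC : Continuous toC := by
  have : toC = fun p : Pt => (p.1 : ℂ) + p.2 * Complex.I := by
    funext p; apply Complex.ext <;> simp [toC]
  rw [this]; fun_prop

theorem toC_inj {p q : Pt} (h : toC p = toC q) : p = q := by
  have h1 := congrArg Complex.re h
  have h2 := congrArg Complex.im h
  exact Prod.ext h1 h2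

/-- There is a continuous argument of `w - k` for `w ∈ P`. -/
def HasArg (P : Set Pt) (k : Pt) : Prop :=
  ∃ θ : Pt → ℝ, ContinuousOn θ P ∧ ∀ w ∈ P, ∃ r : ℝ, 0 < r ∧
    toC w - toC k = r * Complex.exp (θ w * Complex.I)

theorem one_sub_mem_slitPlane {ξ : ℂ} (h : ‖ξ‖ < 1) : 1 - ξ ∈ Complex.slitPlane := by
  left
  have := Complex.re_le_norm ξ
  simp; linarith

/-- A continuous argument survives multiplication by a continuous factor with values in the slit
plane, where `Complex.arg` is continuous. Both the far case and the continuation step below have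
this form. -/
theorem hasArg_of_ratio {P : Set Pt} {k : Pt} (θ : Pt → ℝ) (hθ : ContinuousOn θ P)
    (f : Pt → ℂ) (hf : ContinuousOn f P) (hs : ∀ w ∈ P, f w ∈ Complex.slitPlane)
    (h : ∀ w ∈ P, ∃ r : ℝ, 0 < r ∧
      toC w - toC k = f w * (r * Complex.exp (θ w * Complex.I))) : HasArg P k := by
  refine ⟨fun w => θ w + (f w).arg, ?_, ?_⟩
  · refine hθ.add fun w hw => ?_
    exact (Complex.continuousAt_arg (hs w hw)).comp_continuousWithinAt (hf w hw)
  · intro w hw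
    obtain ⟨r, hr, e⟩ := h w hw
    have h0 : f w ≠ 0 := Complex.slitPlane_ne_zero (hs w hw)
    refine ⟨‖f w‖ * r, by positivity, ?_⟩
    rw [e]
    conv_lhs => rw [← Complex.norm_mul_exp_arg_mul_I (f w)]
    push_cast
    rw [add_mul, Complex.exp_add]
    ring

/-- The quotient (w - k') / (w - k) = 1 - (k' - k) / (w - k) is within distance 1 of 1, hence in the
slit plane. -/
theorem HasArg.of_near {P : Set Pt} {k k' : Pt} (h : HasArg P k)
    (hk : ∀ w ∈ P, ‖toC k' - toC k‖ < ‖toC w - toC k‖) : HasArg P k' := by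
  obtain ⟨θ, hθ, e⟩ := h
  have h0 : ∀ w ∈ P, toC w - toC k ≠ 0 := fun w hw =>
    norm_pos_iff.1 ((norm_nonneg _).trans_lt (hk w hw))
  refine hasArg_of_ratio θ hθ (fun w => 1 - (toC k' - toC k) / (toC w - toC k)) ?_ ?_ ?_
  · refine continuousOn_const.sub (continuousOn_const.div ?_ h0)
    exact (continuous_toC.sub continuous_const).continuousOn
  · intro w hw
    apply one_sub_mem_slitPlane
    rw [norm_div, div_lt_one (norm_pos_iff.2 (h0 w hw))]
    exact hk w hw
  · intro w hw
    obtain ⟨r, hr, e⟩ := e w hw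
    refine ⟨r, hr, ?_⟩
    rw [← e]
    have := h0 w hw
    field_simp
    ring

/-- Here w - k = -k (1 - w / k), and the second factor is in the slit plane. -/
theorem hasArg_of_far {P : Set Pt} {k : Pt} (hk : ∀ w ∈ P, ‖toC w‖ < ‖toC k‖) : HasArg P k := by
  refine hasArg_of_ratio (fun _ => (-toC k).arg) continuousOn_const
    (fun w => 1 - toC w / toC k) ?_ ?_ ?_
  · exact (continuous_const.sub (continuous_toC.div_const _)).continuousOn
  · intro w hw
    apply one_sub_mem_slitPlane
    have := hk w hw
    rw [norm_div, div_lt_one ((norm_nonneg _).trans_lt this)]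
    exact this
  · intro w hw
    have := (norm_nonneg _).trans_lt (hk w hw)
    refine ⟨‖-toC k‖, by rwa [norm_neg], ?_⟩
    rw [Complex.norm_mul_exp_arg_mul_I]
    have : toC k ≠ 0 := norm_pos_iff.1 this
    field_simp
    ring

theorem norm_toC_le (p : Pt) : ‖toC p‖ ≤ 2 * ‖p‖ := by
  have h := Complex.norm_le_abs_re_add_abs_im (toC p)
  have h1 : |p.1| ≤ ‖p‖ := norm_fst_le p
  have h2 : |p.2| ≤ ‖p‖ := norm_snd_le p
  simp only [toC] at h ⊢
  linarith

theorem norm_le_norm_toC (p : Pt) : ‖p‖ ≤ ‖toC p‖ := by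
  rw [Prod.norm_def]
  exact max_le (Complex.abs_re_le_norm (toC p)) (Complex.abs_im_le_norm (toC p))

theorem toC_sub (p q : Pt) : toC (p - q) = toC p - toC q := by
  apply Complex.ext <;> simp [toC]

/-- Off P, having a continuous argument is a locally constant property of k. It is carried along the
unbounded connected set of `Dom.filled` from a far point, where it is clear, to k. -/
theorem Dom.hasArg {P V : Set Pt} {a b : ℝ} (D : Dom P V a b) {k : Pt} (hk : k ∉ P) :
    HasArg P k := by
  obtain ⟨T, hkT, hT, hunb, hdis⟩ := D.filled k hk
  obtain ⟨R, hR⟩ := D.compact.isBounded.exists_norm_le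
  have hfar : ∃ k' ∈ T, HasArg P k' := by
    by_contra! hcon
    -- The factor 2 compares the sup norm of the plane with the complex norm, as in `norm_toC_le`.
    refine hunb ((Metric.isBounded_closedBall (x := (0 : Pt)) (r := 2 * R)).subset fun w hw => ?_)
    rw [mem_closedBall_zero_iff]
    by_contra! hlt
    refine hcon w hw (hasArg_of_far fun z hz => ?_)
    have := hR z hz
    have := norm_toC_le z
    have := norm_le_norm_toC w
    linarith
  obtain ⟨k', hk', h'⟩ := hfar
  have hind : HasArg P k' ↔ HasArg P k := by
    refine hT.induction₂ (fun x y => (HasArg P x ↔ HasArg P y)) ?_ ?_ ?_ hk' hkT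
    · intro x hx
      have hxP : x ∈ Pᶜ := fun h => hdis.le_bot ⟨hx, h⟩
      obtain ⟨ε, hε, hball⟩ := Metric.isOpen_iff.1 D.compact.isClosed.isOpen_compl x hxP
      refine mem_nhdsWithin_of_mem_nhds ?_
      -- With ε / 4 in the sup norm, x and y are less than ε / 2 apart in the complex norm, while
      -- every point of P is more than 3 ε / 4 away from both.
      filter_upwards [Metric.ball_mem_nhds x (show (0 : ℝ) < ε / 4 by positivity)] with y hy
      rw [Metric.mem_ball, dist_eq_norm] at hy
      have key : ∀ w ∈ P, ε ≤ ‖w - x‖ := by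
        intro w hw
        by_contra! hlt
        exact hball (by rwa [Metric.mem_ball, dist_eq_norm]) hw
      have h1 : ∀ w ∈ P, ‖toC y - toC x‖ < ‖toC w - toC x‖ := by
        intro w hw
        have := key w hw
        rw [← toC_sub, ← toC_sub]
        have := norm_toC_le (y - x)
        have := norm_le_norm_toC (w - x)
        linarith
      have h2 : ∀ w ∈ P, ‖toC x - toC y‖ < ‖toC w - toC y‖ := by
        intro w hw
        have := key w hw
        rw [← toC_sub, ← toC_sub]
        have h3 := norm_toC_le (x - y)
        have := norm_le_norm_toC (w - y)
        have h4 : ‖w - x‖ ≤ ‖w - y‖ + ‖y - x‖ := norm_sub_le_norm_sub_add_norm_sub w y x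
        rw [norm_sub_rev] at h3
        rw [norm_sub_rev y x] at *
        linarith
      exact ⟨fun h => h.of_near h1, fun h => h.of_near h2⟩
    · intro x y z _ _ _ h1 h2; exact h1.trans h2
    · intro x y _ _ h; exact h.symm
  exact hind.1 h'

end WVPolygon

/-! ### Winding around missing points and the triangle lemma -/

namespace WVPolygon

/-- `θ` is a continuous argument of `w - k` for `w ∈ P`. -/
structure IsArg (P : Set Pt) (k : Pt) (θ : Pt → ℝ) : Prop where
  cont : ContinuousOn θ P
  polar : ∀ w ∈ P, ∃ r : ℝ, 0 < r ∧ w.1 - k.1 = r * Real.cos (θ w) ∧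
    w.2 - k.2 = r * Real.sin (θ w)

theorem Dom.exists_isArg {P V : Set Pt} {a b : ℝ} (D : Dom P V a b) {k : Pt} (hk : k ∉ P) :
    ∃ θ, IsArg P k θ := by
  obtain ⟨θ, hθ, h⟩ := D.hasArg hk
  refine ⟨θ, hθ, fun w hw => ?_⟩
  obtain ⟨r, hr, e⟩ := h w hw
  have h1 := congrArg Complex.re e
  have h2 := congrArg Complex.im e
  simp [toC, Complex.exp_ofReal_mul_I_re, Complex.exp_ofReal_mul_I_im] at h1 h2
  exact ⟨r, hr, h1, h2⟩

theorem IsArg.sin_sub {P : Set Pt} {k : Pt} {θ : Pt → ℝ} (h : IsArg P k θ) {p q : Pt}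
    (hp : p ∈ P) (hq : q ∈ P) : ∃ r : ℝ, 0 < r ∧ cr k p q = r * Real.sin (θ q - θ p) := by
  obtain ⟨r, hr, h1, h2⟩ := h.polar p hp
  obtain ⟨s, hs, h3, h4⟩ := h.polar q hq
  refine ⟨r * s, by positivity, ?_⟩
  unfold cr
  rw [h1, h2, h3, h4, Real.sin_sub]
  ring

/-- The intermediate value theorem in the form needed for angles: a quantity that starts at 0 cannot
jump over v. -/
theorem no_value_of_ne {f : ℝ → ℝ} (hf : ContinuousOn f (Icc 0 1)) (h0 : f 0 = 0) {v : ℝ}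
    (hv : v ≠ 0) (hne : ∀ t, 0 < t → t ≤ 1 → f t ≠ v) :
    (0 < v → f 1 < v) ∧ (v < 0 → v < f 1) := by
  have key : ∀ t ∈ Icc (0 : ℝ) 1, f t ≠ v := by
    intro t ht e
    rcases eq_or_lt_of_le ht.1 with h | h
    · subst h; exact hv (by rw [← e, h0])
    · exact hne t h ht.2 e
  constructor
  · intro hpos
    by_contra! hcon
    obtain ⟨t, ht, e⟩ := intermediate_value_Icc zero_le_one hf (show v ∈ Icc (f 0) (f 1) from
      ⟨by rw [h0]; exact hpos.le, hcon⟩)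
    exact key t ht e
  · intro hneg
    by_contra! hcon
    obtain ⟨t, ht, e⟩ := intermediate_value_Icc' zero_le_one hf (show v ∈ Icc (f 1) (f 0) from
      ⟨hcon, by rw [h0]; exact hneg.le⟩)
    exact key t ht e

/-- The sine of the angle turned up to the parameter t has the sign of t times the constant `cr k p
q`. If this is nonzero, the angle never reaches π or -π, so its sign can be read off its sine. If it
is zero, the sine vanishes throughout, and the angle cannot leave 0 without passing through π / 2 or
-π / 2. -/
theorem IsArg.segment {P : Set Pt} {k : Pt} {θ : Pt → ℝ} (h : IsArg P k θ) {p q : Pt}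
    (hpq : q ∈ svis P p) :
    (0 < cr k p q → 0 < θ q - θ p ∧ θ q - θ p < Real.pi) ∧
    (cr k p q < 0 → -Real.pi < θ q - θ p ∧ θ q - θ p < 0) ∧
    (cr k p q = 0 → θ q = θ p) := by
  have hmem : ∀ t ∈ Icc (0 : ℝ) 1, pt p q t ∈ P := fun t ht => hpq (pt_mem_segment ht.1 ht.2)
  have hp : p ∈ P := hpq (left_mem_segment ℝ p q)
  have hq : q ∈ P := hpq (right_mem_segment ℝ p q)
  set f : ℝ → ℝ := fun t => θ (pt p q t) - θ p with hf
  have hfc : ContinuousOn f (Icc 0 1) :=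
    (h.cont.comp (continuous_pt p q).continuousOn hmem).sub continuousOn_const
  have h0 : f 0 = 0 := by simp [hf, pt_zero]
  have h1 : f 1 = θ q - θ p := by simp [hf, pt_one]
  have hsin : ∀ t ∈ Icc (0 : ℝ) 1, ∃ r : ℝ, 0 < r ∧ t * cr k p q = r * Real.sin (f t) := by
    intro t ht
    obtain ⟨r, hr, e⟩ := h.sin_sub hp (hmem t ht)
    refine ⟨r, hr, ?_⟩
    rw [← e]
    simp [cr]; ring
  have hpi := Real.pi_pos
  have hbd : cr k p q ≠ 0 → -Real.pi < f 1 ∧ f 1 < Real.pi := by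
    intro hcr
    have hne : ∀ t, 0 < t → t ≤ 1 → Real.sin (f t) ≠ 0 := by
      intro t ht0 ht1 e
      obtain ⟨r, hr, e'⟩ := hsin t ⟨ht0.le, ht1⟩
      rw [e, mul_zero] at e'
      exact (mul_ne_zero ht0.ne' hcr) e'
    exact ⟨(no_value_of_ne hfc h0 (v := -Real.pi) (by linarith)
        (fun t h0 h1 e => hne t h0 h1 (by simp [e]))).2 (by linarith),
      (no_value_of_ne hfc h0 (v := Real.pi) (by linarith)
        (fun t h0 h1 e => hne t h0 h1 (by simp [e]))).1 hpi⟩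
  obtain ⟨r, hr, e⟩ := hsin 1 ⟨zero_le_one, le_rfl⟩
  rw [one_mul] at e
  refine ⟨fun hcr => ?_, fun hcr => ?_, fun hcr => ?_⟩
  · obtain ⟨l, u⟩ := hbd hcr.ne'
    rw [← h1]
    refine ⟨?_, u⟩
    by_contra! hle
    have : Real.sin (f 1) ≤ 0 := Real.sin_nonpos_of_nonpos_of_neg_pi_le hle l.le
    nlinarith
  · obtain ⟨l, u⟩ := hbd hcr.ne
    rw [← h1]
    refine ⟨l, ?_⟩
    by_contra! hle
    have : 0 ≤ Real.sin (f 1) := Real.sin_nonneg_of_nonneg_of_le_pi hle u.le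
    nlinarith
  · have hz : ∀ t, 0 < t → t ≤ 1 → Real.sin (f t) = 0 := by
      intro t ht0 ht1
      obtain ⟨r, hr, e'⟩ := hsin t ⟨ht0.le, ht1⟩
      rw [hcr, mul_zero] at e'
      exact (mul_eq_zero.1 e'.symm).resolve_left hr.ne'
    have u := (no_value_of_ne hfc h0 (v := Real.pi / 2) (by positivity)
        (fun t h0 h1 e => by have := hz t h0 h1; rw [e, Real.sin_pi_div_two] at this
                             exact one_ne_zero this)).1 (by positivity)
    have l := (no_value_of_ne hfc h0 (v := -(Real.pi / 2)) (by linarith)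
        (fun t h0 h1 e => by have := hz t h0 h1
                             rw [e, Real.sin_neg, Real.sin_pi_div_two] at this
                             norm_num at this)).2 (by linarith)
    have hs := hz 1 one_pos le_rfl
    have : f 1 = 0 := (Real.sin_eq_zero_iff_of_lt_of_lt (by linarith) (by linarith)).1 hs
    linarith

theorem cr_rotate (a b c : Pt) : cr a b c = cr b c a := by unfold cr; ring
theorem cr_swap (a b c : Pt) : cr a b c = - cr b a c := by unfold cr; ring
theorem cr_swap' (a b c : Pt) : cr a b c = - cr a c b := by unfold cr; ring

variable {P V : Set Pt} {a b : ℝ}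

/-- A missing point k of the triangle is on the left of, or on, each side, so the argument about k
does not decrease on the way round. As it returns to its initial value, it agrees at p, q and r.
Then all three corners are in the same direction from k, which is impossible for a convex
combination k of them. -/
theorem Dom.triangle_subset_aux (D : Dom P V a b) {p q r : Pt} (h0 : 0 ≤ cr p q r)
    (h1 : q ∈ svis P p) (h2 : r ∈ svis P q) (h3 : p ∈ svis P r) : triangle p q r ⊆ P := by
  intro k hk
  by_contra hkP
  obtain ⟨θ, hθ⟩ := D.exists_isArg hkP
  obtain ⟨c1, c2, c3⟩ := cr_nonneg_of_mem_triangle h0 hk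
  have e1 : cr k p q = cr p q k := cr_rotate _ _ _
  have e2 : cr k q r = cr q r k := cr_rotate _ _ _
  have e3 : cr k r p = cr r p k := cr_rotate _ _ _
  have pos : ∀ x y : Pt, 0 ≤ cr k x y → y ∈ svis P x → 0 ≤ θ y - θ x ∧
      (0 < cr k x y → 0 < θ y - θ x) := by
    intro x y hc hs
    have s := hθ.segment hs
    rcases eq_or_lt_of_le hc with h | h
    · exact ⟨by linarith [s.2.2 h.symm], fun h' => (s.1 h').1⟩
    · exact ⟨(s.1 h).1.le, fun h' => (s.1 h').1⟩
  have p1 := pos p q (by rw [e1]; exact c1) h1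
  have p2 := pos q r (by rw [e2]; exact c2) h2
  have p3 := pos r p (by rw [e3]; exact c3) h3
  have z1 : θ q = θ p := by linarith
  have z2 : θ r = θ p := by linarith
  obtain ⟨α, β, γ, hα, hβ, hγ, hs, ek⟩ := mem_triangle_iff.1 hk
  obtain ⟨rp, hrp, p1, p2⟩ := hθ.polar p (h1 (left_mem_segment ℝ p q))
  obtain ⟨rq, hrq, q1, q2⟩ := hθ.polar q (h1 (right_mem_segment ℝ p q))
  obtain ⟨rr, hrr, r1, r2⟩ := hθ.polar r (h3 (left_mem_segment ℝ r p))
  rw [z1] at q1 q2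
  rw [z2] at r1 r2
  have k1 := congrArg Prod.fst ek
  have k2 := congrArg Prod.snd ek
  simp only at k1 k2
  -- α (p - k) + β (q - k) + γ (r - k) vanishes, but with a common angle it is this number times a
  -- unit vector.
  have hm : 0 < α * rp + β * rq + γ * rr := by
    by_contra! hle
    have a1 : 0 ≤ α * rp := by positivity
    have a2 : 0 ≤ β * rq := by positivity
    have a3 : 0 ≤ γ * rr := by positivity
    have b1 : α = 0 := by
      have : α * rp = 0 := by linarith
      exact (mul_eq_zero.1 this).resolve_right hrp.ne'
    have b2 : β = 0 := by
      have : β * rq = 0 := by linarith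
      exact (mul_eq_zero.1 this).resolve_right hrq.ne'
    have b3 : γ = 0 := by
      have : γ * rr = 0 := by linarith
      exact (mul_eq_zero.1 this).resolve_right hrr.ne'
    linarith
  have hα' : α = 1 - β - γ := by linarith
  have m1 : (α * rp + β * rq + γ * rr) * Real.cos (θ p) = 0 := by
    have : (α * rp + β * rq + γ * rr) * Real.cos (θ p)
      = α * (p.1 - k.1) + β * (q.1 - k.1) + γ * (r.1 - k.1) := by rw [p1, q1, r1]; ring
    rw [this, hα']; rw [hα'] at k1; linarith
  have m2 : (α * rp + β * rq + γ * rr) * Real.sin (θ p) = 0 := by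
    have : (α * rp + β * rq + γ * rr) * Real.sin (θ p)
      = α * (p.2 - k.2) + β * (q.2 - k.2) + γ * (r.2 - k.2) := by rw [p2, q2, r2]; ring
    rw [this, hα']; rw [hα'] at k2; linarith
  have := (mul_eq_zero.1 m1).resolve_left hm.ne'
  have h' := (mul_eq_zero.1 m2).resolve_left hm.ne'
  have := Real.sin_sq_add_cos_sq (θ p)
  simp_all

/-- A triangle whose sides lie in `P` lies in `P`. -/
theorem Dom.triangle_subset (D : Dom P V a b) {p q r : Pt}
    (h1 : q ∈ svis P p) (h2 : r ∈ svis P q) (h3 : r ∈ svis P p) : triangle p q r ⊆ P := by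
  rcases le_total 0 (cr p q r) with h | h
  · exact D.triangle_subset_aux h h1 h2 (svis_comm.1 h3)
  · rw [triangle_reverse]
    refine D.triangle_subset_aux ?_ (svis_comm.1 h2) (svis_comm.1 h1) h3
    have : cr r q p = - cr p q r := by unfold cr; ring
    linarith

/-- A triangle whose sides lie in `P` is seen by its corner. -/
theorem Dom.triangle_subset_svis (D : Dom P V a b) {p q r : Pt}
    (h1 : q ∈ svis P p) (h2 : r ∈ svis P q) (h3 : r ∈ svis P p) : triangle p q r ⊆ svis P p :=
  fun _ hw => ((convex_triangle p q r).segment_subset (left_mem_triangle p q r) hw).trans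
    (D.triangle_subset h1 h2 h3)

theorem Dom.svis_of_mem_segment (D : Dom P V a b) {p q r s : Pt} (h1 : q ∈ svis P p)
    (h2 : r ∈ svis P q) (h3 : r ∈ svis P p) (hs : s ∈ segment ℝ q r) : s ∈ svis P p :=
  D.triangle_subset_svis h1 h2 h3
    ((convex_triangle p q r).segment_subset (mid_mem_triangle p q r) (right_mem_triangle p q r) hs)

theorem Dom.base_segment (D : Dom P V a b) {c d : ℝ} (h1 : a ≤ c) (h2 : c ≤ b) (h3 : a ≤ d)
    (h4 : d ≤ b) : ((d, 0) : Pt) ∈ svis P (c, 0) := by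
  intro w hw
  obtain ⟨t, t0, t1, rfl⟩ := mem_segment_iff.1 hw
  have := D.base (c + t * (d - c)) (by nlinarith) (by nlinarith)
  convert this using 1
  ext <;> simp

/-- Visibility is a closed relation. -/
theorem isClosed_svis_pair (hP : IsClosed P) : IsClosed {z : Pt × Pt | z.2 ∈ svis P z.1} := by
  have : {z : Pt × Pt | z.2 ∈ svis P z.1} = ⋂ t ∈ Icc (0 : ℝ) 1, {z | pt z.1 z.2 t ∈ P} := by
    ext z
    simp only [mem_ofPred_eq, mem_iInter, svis]
    constructor
    · intro h t ht
      exact h (pt_mem_segment ht.1 ht.2)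
    · intro h w hw
      obtain ⟨t, t0, t1, rfl⟩ := mem_segment_iff.1 hw
      exact h t ⟨t0, t1⟩
  rw [this]
  refine isClosed_biInter fun t _ => hP.preimage ?_
  unfold pt; fun_prop

theorem isClosed_svis (hP : IsClosed P) (g : Pt) : IsClosed (svis P g) := by
  have h := (isClosed_svis_pair hP).preimage (show Continuous fun q : Pt => (g, q) by fun_prop)
  exact h

/-! ### Visible base points -/

/-- The base point with abscissa `c` is visible from `g`. -/
def SeesBase (P : Set Pt) (a b : ℝ) (g : Pt) (c : ℝ) : Prop :=
  a ≤ c ∧ c ≤ b ∧ ((c, 0) : Pt) ∈ svis P g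

/-- The base lies in P, so g and two visible base points span a triangle with sides in P. -/
theorem Dom.seesBase_of_between (D : Dom P V a b) {g : Pt} {c d e : ℝ} (h1 : SeesBase P a b g c)
    (h2 : SeesBase P a b g d) (hc : c ≤ e) (hd : e ≤ d) : SeesBase P a b g e := by
  refine ⟨h1.1.trans hc, hd.trans h2.2.1, ?_⟩
  refine D.svis_of_mem_segment h1.2.2 (D.base_segment h1.1 h1.2.1 h2.1 h2.2.1) h2.2.2 ?_
  rcases eq_or_lt_of_le (hc.trans hd) with h | h
  · have : c = e := le_antisymm hc (by rw [h]; exact hd)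
    subst this; exact left_mem_segment _ _ _
  · have h' : 0 < d - c := by linarith
    refine mem_segment_iff.2 ⟨(e - c) / (d - c), div_nonneg (by linarith) h'.le, ?_, ?_⟩
    · rw [div_le_one h']; linarith
    · ext <;> simp; field_simp; ring

/-- `x` is the leftmost base point visible from `g`. -/
def IsLeftEnd (P : Set Pt) (a b : ℝ) (g : Pt) (x : ℝ) : Prop :=
  SeesBase P a b g x ∧ ∀ c, SeesBase P a b g c → x ≤ c

/-- `x` is the rightmost base point visible from `g`. -/
def IsRightEnd (P : Set Pt) (a b : ℝ) (g : Pt) (x : ℝ) : Prop :=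
  SeesBase P a b g x ∧ ∀ c, SeesBase P a b g c → c ≤ x

theorem isCompact_seesBase (hP : IsClosed P) (g : Pt) : IsCompact {c | SeesBase P a b g c} := by
  have : {c | SeesBase P a b g c} = Icc a b ∩ (fun c : ℝ => ((c, 0) : Pt)) ⁻¹' svis P g := by
    ext c; simp [SeesBase, and_assoc]
  rw [this]
  exact isCompact_Icc.inter_right ((isClosed_svis hP g).preimage (by fun_prop))

theorem Dom.exists_isLeftEnd (D : Dom P V a b) {g : Pt} (hg : g ∈ P) :
    ∃ x, IsLeftEnd P a b g x := by
  obtain ⟨c, h1, h2, h3⟩ := D.weak g hg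
  obtain ⟨x, hx, hm⟩ := (isCompact_seesBase (a := a) (b := b) D.compact.isClosed g).exists_isLeast
    ⟨c, h1, h2, h3⟩
  exact ⟨x, hx, fun c hc => hm hc⟩

theorem Dom.exists_isRightEnd (D : Dom P V a b) {g : Pt} (hg : g ∈ P) :
    ∃ x, IsRightEnd P a b g x := by
  obtain ⟨c, h1, h2, h3⟩ := D.weak g hg
  obtain ⟨x, hx, hm⟩ := (isCompact_seesBase (a := a) (b := b) D.compact.isClosed
    g).exists_isGreatest ⟨c, h1, h2, h3⟩
  exact ⟨x, hx, fun c hc => hm hc⟩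

end WVPolygon

/-! ### Local shape of P, and visibility across a segment -/

namespace WVPolygon

open Filter Topology

variable {P V : Set Pt} {a b : ℝ}

/-- The point `w + s d`. -/
def shift (w d : Pt) (s : ℝ) : Pt := (w.1 + s * d.1, w.2 + s * d.2)

theorem continuous_shift (w d : Pt) : Continuous (shift w d) := by unfold shift; fun_prop

theorem shift_zero (w d : Pt) : shift w d 0 = w := by ext <;> simp [shift]

theorem tendsto_shift (w d : Pt) : Tendsto (shift w d) (𝓝[>] 0) (𝓝 w) := by
  have := (continuous_shift w d).tendsto 0
  rw [shift_zero] at this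
  exact this.mono_left nhdsWithin_le_nhds

theorem mem_closure_of_shift {S : Set Pt} {w d : Pt}
    (h : ∀ᶠ s in 𝓝[>] (0 : ℝ), shift w d s ∈ S) : w ∈ closure S :=
  mem_closure_of_tendsto (tendsto_shift w d) h

theorem eventually_shift_dist {w d q : Pt} {ε : ℝ} (h : dist w q < ε) :
    ∀ᶠ s in 𝓝[>] (0 : ℝ), dist (shift w d s) q < ε :=
  (tendsto_shift w d).eventually (IsOpen.mem_nhds Metric.isOpen_ball h)

theorem continuous_cr (p q : Pt) : Continuous (cr p q) := by unfold cr; fun_prop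

theorem cr_shift (p q w d : Pt) (s : ℝ) :
    cr p q (shift w d s) = cr p q w + s * ((q.1 - p.1) * d.2 - (q.2 - p.2) * d.1) := by
  simp [cr, shift]; ring

theorem cr_pt (p q w z : Pt) (t : ℝ) :
    cr p q (pt w z t) = (1 - t) * cr p q w + t * cr p q z := by
  simp [cr]; ring

theorem cr_pt_self (p q : Pt) (t : ℝ) : cr p q (pt p q t) = 0 := by simp [cr]; ring

/-- Near q, membership in P is constant along the half-open segment from a point to q. -/
theorem Dom.exists_cone (D : Dom P V a b) {q : Pt} (hq : q ∈ P) :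
    ∃ ε > 0, ∀ w ∈ P, dist w q < ε → w ∈ svis P q := by
  obtain ⟨ε, hε, h⟩ := D.cone q
  refine ⟨ε, hε, fun w hw hd z hz => ?_⟩
  obtain ⟨t, t0, t1, rfl⟩ := mem_segment_iff.1 hz
  rcases eq_or_lt_of_le t0 with e | e
  · rw [← e, pt_zero]; exact hq
  · exact (h w hd t e t1).1 hw

/-- Near a point that is not a vertex and lies inside a segment of `P`, the whole side of that
segment on which `P` extends transversally belongs to `P`. -/
theorem Dom.half_ball (D : Dom P V a b) {q α β γ : Pt} (hq : q ∉ V)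
    (hqs : q ∈ openSegment ℝ α β) (hαβ : segment ℝ α β ⊆ P) (hγ : cr α β γ ≠ 0)
    (hqγ : γ ∈ svis P q) :
    ∃ ε > 0, ∀ w, dist w q < ε → 0 ≤ cr α β w * cr α β γ → w ∈ P := by
  obtain ⟨ε, hε, n, hn, hline⟩ := D.line q hq
  obtain ⟨t, t0, t1, eq⟩ := mem_openSegment_iff.1 hqs
  have q1 := congrArg Prod.fst eq
  have q2 := congrArg Prod.snd eq
  simp only [pt_fst, pt_snd] at q1 q2
  have hcl := D.compact.isClosed.closure_eq
  refine ⟨ε, hε, ?_⟩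
  have hn2 : 0 < n.1 ^ 2 + n.2 ^ 2 := by
    by_contra! hle
    apply hn
    have h1 : n.1 = 0 := by nlinarith [sq_nonneg n.1, sq_nonneg n.2]
    have h2 : n.2 = 0 := by nlinarith [sq_nonneg n.1, sq_nonneg n.2]
    exact Prod.ext h1 h2
  have hqq : dist q q < ε := by simpa using hε
  -- `hd` says that the line through q with normal n is parallel to α β; then γ shows which side is
  -- in P. Otherwise α β crosses this line, P has points near q on both sides of it, and the whole
  -- ball is in P because P is closed.
  by_cases hd : n.1 * (β.1 - α.1) + n.2 * (β.2 - α.2) = 0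
  · have strict : ∀ w, dist w q < ε → 0 < cr α β w * cr α β γ → w ∈ P := by
      intro w hw hpos
      have ev1 := eventually_shift_dist (d := (γ.1 - q.1, γ.2 - q.2)) hqq
      have ev2 : ∀ᶠ s in 𝓝[>] (0 : ℝ), 0 < s ∧ s < 1 := by
        filter_upwards [Ioo_mem_nhdsGT (show (0 : ℝ) < 1 by norm_num)] with s hs using hs
      obtain ⟨s, hs1, hs0, hs2⟩ := (ev1.and ev2).exists
      have hmem : shift q (γ.1 - q.1, γ.2 - q.2) s ∈ P :=
        hqγ (mem_segment_iff.2 ⟨s, hs0.le, hs2.le, rfl⟩)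
      refine (hline _ _ hs1 hw ?_).1 hmem
      have hdd : 0 < (β.1 - α.1) ^ 2 + (β.2 - α.2) ^ 2 := by
        by_contra! hle
        apply hγ
        have h1 : β.1 - α.1 = 0 := by
          nlinarith [sq_nonneg (β.1 - α.1), sq_nonneg (β.2 - α.2)]
        have h2 : β.2 - α.2 = 0 := by
          nlinarith [sq_nonneg (β.1 - α.1), sq_nonneg (β.2 - α.2)]
        simp [cr, h1, h2]
      set μ := n.2 * (β.1 - α.1) - n.1 * (β.2 - α.2) with hμ
      -- Lagrange's identity: the cross product `μ` and the scalar product in `hd` cannot both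
      -- vanish.
      have hμ0 : μ ≠ 0 := by
        intro h0
        have : (n.1 ^ 2 + n.2 ^ 2) * ((β.1 - α.1) ^ 2 + (β.2 - α.2) ^ 2) = 0 := by
          have : (n.1 ^ 2 + n.2 ^ 2) * ((β.1 - α.1) ^ 2 + (β.2 - α.2) ^ 2)
            = μ ^ 2 + (n.1 * (β.1 - α.1) + n.2 * (β.2 - α.2)) ^ 2 := by rw [hμ]; ring
          rw [this, h0, hd]; ring
        exact (mul_pos hn2 hdd).ne' this
      have key : ∀ z : Pt, ((β.1 - α.1) ^ 2 + (β.2 - α.2) ^ 2) *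
          (n.1 * (z.1 - q.1) + n.2 * (z.2 - q.2)) = μ * cr α β z := by
        intro z
        rw [q1, q2, hμ]; unfold cr
        linear_combination ((β.1 - α.1) * (z.1 - α.1 - t * (β.1 - α.1)) +
          (β.2 - α.2) * (z.2 - α.2 - t * (β.2 - α.2))) * hd
      have c0 : cr α β q = 0 := by rw [eq]; exact cr_pt_self _ _ _
      have e1 : cr α β (shift q (γ.1 - q.1, γ.2 - q.2) s) = s * cr α β γ := by
        rw [show shift q (γ.1 - q.1, γ.2 - q.2) s = pt q γ s from rfl, cr_pt, c0]; ring
      have k1 := key (shift q (γ.1 - q.1, γ.2 - q.2) s)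
      have k2 := key w
      rw [e1] at k1
      set A := n.1 * ((shift q (γ.1 - q.1, γ.2 - q.2) s).1 - q.1) +
        n.2 * ((shift q (γ.1 - q.1, γ.2 - q.2) s).2 - q.2) with hA
      set B := n.1 * (w.1 - q.1) + n.2 * (w.2 - q.2)
      have e3 : ((β.1 - α.1) ^ 2 + (β.2 - α.2) ^ 2) ^ 2 * (A * B)
          = μ ^ 2 * (s * (cr α β w * cr α β γ)) := by
        linear_combination ((β.1 - α.1) ^ 2 + (β.2 - α.2) ^ 2) * B * k1 + μ * s * cr α β γ * k2
      have : 0 < μ ^ 2 * (s * (cr α β w * cr α β γ)) := by positivity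
      rw [← e3] at this
      exact (pos_iff_pos_of_mul_pos this).1 (by positivity)
    intro w hw hnn
    rw [← hcl]
    refine mem_closure_of_shift (d := (γ.1 - q.1, γ.2 - q.2)) ?_
    filter_upwards [eventually_shift_dist (d := (γ.1 - q.1, γ.2 - q.2)) hw,
      self_mem_nhdsWithin] with s hs hs0
    refine strict _ hs ?_
    have hs0' : 0 < s := hs0
    have c0 : cr α β q = 0 := by rw [eq]; exact cr_pt_self _ _ _
    have e1 : cr α β (shift w (γ.1 - q.1, γ.2 - q.2) s) = cr α β w + s * cr α β γ := by
      rw [cr_shift]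
      have : (β.1 - α.1) * (γ.2 - q.2) - (β.2 - α.2) * (γ.1 - q.1) = cr α β γ - cr α β q := by
        unfold cr; ring
      simp only; rw [this, c0]; ring
    rw [e1]
    have : 0 < cr α β γ * cr α β γ := mul_self_pos.2 hγ
    nlinarith
  · have strict : ∀ w, dist w q < ε → n.1 * (w.1 - q.1) + n.2 * (w.2 - q.2) ≠ 0 → w ∈ P := by
      intro w hw hpos
      -- The sign of `κ` is such that a small move of q by a positive multiple of κ (β - α), still
      -- on the segment, reaches the side of w.
      set κ := (n.1 * (w.1 - q.1) + n.2 * (w.2 - q.2)) *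
        (n.1 * (β.1 - α.1) + n.2 * (β.2 - α.2)) with hκ
      have hκ0 : κ ≠ 0 := mul_ne_zero hpos hd
      have ev1 := eventually_shift_dist (d := (κ * (β.1 - α.1), κ * (β.2 - α.2))) hqq
      have ev2 : ∀ᶠ s in 𝓝[>] (0 : ℝ), t + s * κ ∈ Ioo (0 : ℝ) 1 := by
        have : Tendsto (fun s : ℝ => t + s * κ) (𝓝[>] 0) (𝓝 t) := by
          have : Continuous (fun s : ℝ => t + s * κ) := by fun_prop
          have := this.tendsto 0
          simp only [zero_mul, add_zero] at this
          exact this.mono_left nhdsWithin_le_nhds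
        exact this.eventually (Ioo_mem_nhds t0 t1)
      obtain ⟨s, ⟨hs1, hs2⟩, hs0⟩ := ((ev1.and ev2).and self_mem_nhdsWithin).exists
      have hs0' : 0 < s := hs0
      have hmem : shift q (κ * (β.1 - α.1), κ * (β.2 - α.2)) s ∈ P := by
        refine hαβ (mem_segment_iff.2 ⟨t + s * κ, hs2.1.le, hs2.2.le, ?_⟩)
        rw [eq]; ext <;> simp [shift] <;> ring
      refine (hline _ _ hs1 hw ?_).1 hmem
      have : (n.1 * ((shift q (κ * (β.1 - α.1), κ * (β.2 - α.2)) s).1 - q.1) +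
        n.2 * ((shift q (κ * (β.1 - α.1), κ * (β.2 - α.2)) s).2 - q.2)) *
        (n.1 * (w.1 - q.1) + n.2 * (w.2 - q.2)) = s * κ ^ 2 := by
        rw [hκ]; simp only [shift]; ring
      rw [this]; positivity
    intro w hw _
    by_cases hN : n.1 * (w.1 - q.1) + n.2 * (w.2 - q.2) = 0
    · rw [← hcl]
      refine mem_closure_of_shift (d := n) ?_
      filter_upwards [eventually_shift_dist (d := n) hw, self_mem_nhdsWithin] with s hs hs0
      have hs0' : 0 < s := hs0
      refine strict _ hs ?_
      have : n.1 * ((shift w n s).1 - q.1) + n.2 * ((shift w n s).2 - q.2)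
        = s * (n.1 ^ 2 + n.2 ^ 2) := by simp only [shift]; linear_combination hN
      rw [this]; positivity
    · exact strict w hw hN

/-- If `g` sees the triangle `g α β` and `c` lies in its angle at `g`, then `g` sees `c`, provided
that the part of the segment beyond the side `α β` stays in a convex subset of `P`. -/
theorem mem_svis_of_beyond {g α β c : Pt} {K : Set Pt} (hT : triangle g α β ⊆ svis P g)
    (h0 : 0 < cr α β g) (hK : Convex ℝ K) (hKP : K ⊆ P) (h1 : 0 ≤ cr β g c) (h2 : 0 ≤ cr g α c)
    (hc : c ∈ K) (hq : cr α β c < 0 → pt g c (cr α β g / (cr α β g - cr α β c)) ∈ K) :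
    c ∈ svis P g := by
  rcases le_or_gt 0 (cr α β c) with h | h
  · apply hT
    rw [triangle_rotate]
    exact mem_triangle_of_cr h0 h h1 h2
  -- `t` is the parameter at which the segment from g to c crosses the line α β.
  · set t := cr α β g / (cr α β g - cr α β c) with ht
    have hden : 0 < cr α β g - cr α β c := by linarith
    have t0 : 0 < t := by positivity
    have t1 : t ≤ 1 := by rw [ht, div_le_one hden]; linarith
    have hmem : pt g c t ∈ svis P g := by
      apply hT
      rw [triangle_rotate]
      refine mem_triangle_of_cr h0 ?_ ?_ ?_
      · rw [cr_pt, ht]; field_simp; ring_nf; exact le_rfl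
      · rw [cr_pt]; have : cr β g g = 0 := by unfold cr; ring
        rw [this]; nlinarith
      · rw [cr_pt]; have : cr g α g = 0 := by unfold cr; ring
        rw [this]; nlinarith
    intro w hw
    obtain ⟨s, s0, s1, rfl⟩ := mem_segment_iff.1 hw
    rcases le_total s t with hst | hst
    · refine hmem (mem_segment_iff.2 ⟨s / t, by positivity, (div_le_one t0).2 hst, ?_⟩)
      ext <;> simp <;> field_simp
    · refine hKP (hK.segment_subset (hq h) hc ?_)
      rcases eq_or_lt_of_le t1 with e | e
      · have : s = 1 := le_antisymm s1 (by linarith)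
        subst this; rw [pt_one]; exact right_mem_segment _ _ _
      · have e' : 0 < 1 - t := by linarith
        refine mem_segment_iff.2 ⟨(s - t) / (1 - t), div_nonneg (by linarith) e'.le, ?_, ?_⟩
        · rw [div_le_one e']; linarith
        · ext <;> simp <;> field_simp <;> ring

/-- The point where the line g c meets the line α β depends continuously on c near q, and for c = q
it is q itself. -/
theorem tendsto_crossing {g α β q : Pt} (h0 : cr α β g ≠ 0) (hq : cr α β q = 0) :
    Tendsto (fun c => pt g c (cr α β g / (cr α β g - cr α β c))) (𝓝 q) (𝓝 q) := by
  have hc : ContinuousAt (fun c => pt g c (cr α β g / (cr α β g - cr α β c))) q := by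
    have h1 : ContinuousAt (fun c : Pt => cr α β g / (cr α β g - cr α β c)) q := by
      refine continuousAt_const.div (continuousAt_const.sub (continuous_cr α β).continuousAt) ?_
      rw [hq]; simpa using h0
    unfold pt
    exact (continuousAt_const.add (h1.mul (continuousAt_fst.sub continuousAt_const))).prodMk
      (continuousAt_const.add (h1.mul (continuousAt_snd.sub continuousAt_const)))
  have := hc.tendsto
  rwa [hq, sub_zero, div_self h0, pt_one] at this

/-! ### Constructed edges -/

/-- A pocket of `g`. -/
def SPocket (P : Set Pt) (g : Pt) (C : Set Pt) : Prop :=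
  ∃ z ∈ P \ svis P g, C = connectedComponentIn (P \ svis P g) z

/-- `x y` is the constructed edge between the visibility region of `g` and its pocket `C`. -/
structure SConstructed (P : Set Pt) (g : Pt) (C : Set Pt) (x y : Pt) : Prop where
  pocket : SPocket P g C
  ne : x ≠ y
  le : x.2 ≤ y.2
  eq_segment : closure C ∩ svis P g = segment ℝ x y

theorem SPocket.subset {g : Pt} {C : Set Pt} (h : SPocket P g C) : C ⊆ P \ svis P g := by
  obtain ⟨z, _, rfl⟩ := h
  exact connectedComponentIn_subset _ _

theorem SPocket.subset_of_preconnected {g : Pt} {C K : Set Pt} (h : SPocket P g C)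
    (hK : IsPreconnected K) (hKP : K ⊆ P \ svis P g) {w : Pt} (hw : w ∈ K) (hwC : w ∈ C) :
    K ⊆ C := by
  obtain ⟨z, _, rfl⟩ := h
  rw [connectedComponentIn_eq hwC]
  exact hK.subset_connectedComponentIn hw hKP

theorem SPocket.eq_of_mem {g : Pt} {C C' : Set Pt} (h : SPocket P g C) (h' : SPocket P g C')
    {w : Pt} (hw : w ∈ C) (hw' : w ∈ C') : C = C' := by
  obtain ⟨z, _, rfl⟩ := h
  obtain ⟨z', _, rfl⟩ := h'
  rw [connectedComponentIn_eq hw, connectedComponentIn_eq hw']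

theorem SPocket.isPreconnected {g : Pt} {C : Set Pt} (h : SPocket P g C) : IsPreconnected C := by
  obtain ⟨z, _, rfl⟩ := h
  exact isPreconnected_connectedComponentIn

theorem SConstructed.mem_svis {g x y w : Pt} {C : Set Pt} (h : SConstructed P g C x y)
    (hw : w ∈ segment ℝ x y) : w ∈ svis P g := by
  rw [← h.eq_segment] at hw; exact hw.2

theorem SConstructed.mem_closure {g x y w : Pt} {C : Set Pt} (h : SConstructed P g C x y)
    (hw : w ∈ segment ℝ x y) : w ∈ closure C := by
  rw [← h.eq_segment] at hw; exact hw.1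

theorem SConstructed.segment_subset {g x y : Pt} {C : Set Pt} (h : SConstructed P g C x y) :
    segment ℝ x y ⊆ P := fun _ hw => svis_subset (h.mem_svis hw)

/-- Points of P close to g are visible from g. -/
theorem Dom.notMem_closure_pocket (D : Dom P V a b) {g : Pt} {C : Set Pt} (hg : g ∈ P)
    (h : SPocket P g C) : g ∉ closure C := by
  intro hcl
  obtain ⟨ε, hε, hc⟩ := D.exists_cone hg
  obtain ⟨c, hcC, hd⟩ := Metric.mem_closure_iff.1 hcl ε hε
  have := h.subset hcC
  exact this.2 (hc c this.1 (by rwa [dist_comm]))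

theorem exists_openSegment_notMem {x y : Pt} (hxy : x ≠ y) {S : Set Pt} (hS : S.Finite) :
    ∃ q ∈ openSegment ℝ x y, q ∉ S := by
  have hinf : (openSegment ℝ x y).Infinite := by
    rw [openSegment_eq_image_lineMap]
    exact (Ioo_infinite one_pos).image ((AffineMap.lineMap_injective ℝ hxy).injOn)
  obtain ⟨q, hq, hq'⟩ := hinf.exists_notMem_finite hS
  exact ⟨q, hq, hq'⟩

/-- If g is off the line x y, it sees the triangle g x y, so the pocket can approach a non-vertex q
inside the edge only from the far side. Then `Dom.half_ball` puts the far half of a small ball at q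
into P, and g sees the nearby points of the pocket across the edge. The opposite orientation is
covered by exchanging x and y. -/
theorem Dom.constructed_aux (D : Dom P V a b) {g x y : Pt} {C : Set Pt} (hC : SPocket P g C)
    (hxy : x ≠ y) (hseg : segment ℝ x y ⊆ closure C ∩ svis P g) : ¬ 0 < cr x y g := by
  intro hpos
  obtain ⟨q, hq, hqV⟩ := exists_openSegment_notMem hxy D.finite
  have hqs := openSegment_subset_segment ℝ x y hq
  have hxyP : segment ℝ x y ⊆ P := fun w hw => svis_subset (hseg hw).2
  have hqP : q ∈ P := hxyP hqs
  have hT : triangle g x y ⊆ svis P g := D.triangle_subset_svis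
    (hseg (left_mem_segment ℝ x y)).2 hxyP (hseg (right_mem_segment ℝ x y)).2
  obtain ⟨t, t0, t1, eq⟩ := mem_openSegment_iff.1 hq
  have c0 : cr x y q = 0 := by rw [eq]; exact cr_pt_self _ _ _
  have c1 : 0 < cr y g q := by
    have : cr y g q = (1 - t) * cr x y g := by
      rw [eq, cr_pt]; unfold cr; ring
    rw [this]; exact mul_pos (by linarith) hpos
  have c2 : 0 < cr g x q := by
    have : cr g x q = t * cr x y g := by
      rw [eq, cr_pt]; unfold cr; ring
    rw [this]; exact mul_pos t0 hpos
  have e1 : ∀ᶠ c in 𝓝 q, 0 < cr y g c := (continuous_cr y g).continuousAt.eventually_const_lt c1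
  have e2 : ∀ᶠ c in 𝓝 q, 0 < cr g x c := (continuous_cr g x).continuousAt.eventually_const_lt c2
  have hqcl : q ∈ closure C := (hseg hqs).1
  have hfreq := mem_closure_iff_frequently.1 hqcl
  have neg : ∀ c, c ∈ C → 0 < cr y g c → 0 < cr g x c → cr x y c < 0 := by
    intro c hc h1 h2
    by_contra! h
    apply (hC.subset hc).2
    apply hT
    rw [triangle_rotate]
    exact mem_triangle_of_cr hpos h h1.le h2.le
  obtain ⟨ε, hε, hcone⟩ := D.exists_cone hqP
  obtain ⟨c0', hc0, h1, h2, h3⟩ := (hfreq.and_eventually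
    (e1.and (e2.and (Metric.ball_mem_nhds q hε : ∀ᶠ c in 𝓝 q, c ∈ Metric.ball q ε)))).exists
  have hneg0 := neg c0' hc0 h1 h2
  obtain ⟨δ, hδ, hhalf⟩ := D.half_ball hqV hq hxyP hneg0.ne
    (hcone c0' (hC.subset hc0).1 h3)
  have e3 := (tendsto_crossing hpos.ne' c0).eventually (Metric.ball_mem_nhds q hδ)
  have e4 : ∀ᶠ c in 𝓝 q, c ∈ Metric.ball q δ := Metric.ball_mem_nhds q hδ
  obtain ⟨c, hcC, h1, h2, h3, h4⟩ := (hfreq.and_eventually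
    (e1.and (e2.and (e4.and e3)))).exists
  have hneg := neg c hcC h1 h2
  refine (hC.subset hcC).2 (mem_svis_of_beyond (K := Metric.ball q δ ∩ {w | cr x y w ≤ 0})
    hT hpos ?_ ?_ h1.le h2.le ⟨h3, hneg.le⟩ ?_)
  · refine (convex_ball q δ).inter ?_
    intro w hw z hz s t hs ht hst
    have hw' : cr x y w ≤ 0 := hw
    have hz' : cr x y z ≤ 0 := hz
    have : cr x y (s • w + t • z) = s * cr x y w + t * cr x y z := by
      have : s = 1 - t := by linarith
      subst this
      simp [cr]; ring
    show cr x y (s • w + t • z) ≤ 0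
    rw [this]; nlinarith
  · rintro w ⟨hw1, hw2⟩
    refine hhalf w hw1 ?_
    have hw2' : cr x y w ≤ 0 := hw2
    nlinarith
  · intro _
    refine ⟨h4, ?_⟩
    show cr x y _ ≤ 0
    have : 0 < cr x y g - cr x y c := by linarith
    rw [cr_pt]; field_simp; ring_nf; exact le_rfl

/-- A constructed edge is collinear with the point whose visibility region it bounds. -/
theorem Dom.constructed_collinear (D : Dom P V a b) {g x y : Pt} {C : Set Pt}
    (h : SConstructed P g C x y) : cr x y g = 0 := by
  have h1 := D.constructed_aux h.pocket h.ne h.eq_segment.ge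
  have h2 := D.constructed_aux h.pocket h.ne.symm (by rw [segment_symm]; exact h.eq_segment.ge)
  have : cr y x g = - cr x y g := by unfold cr; ring
  linarith

/-- A nonhorizontal constructed edge that starts on the axis lies strictly below its point. -/
theorem Dom.constructed_openSegment (D : Dom P V a b) {g x y : Pt} {C : Set Pt} (hg : g ∈ P)
    (h : SConstructed P g C x y) (hx : x.2 = 0) (hy : 0 < y.2) : y ∈ openSegment ℝ x g := by
  have h1 := D.constructed_collinear h
  have h2 : g ∉ segment ℝ x y := by
    intro hgs
    exact D.notMem_closure_pocket hg h.pocket (h.mem_closure hgs)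
  have hg0 := D.upper g hg
  have e : g = pt x y (g.2 / y.2) := by
    unfold cr at h1
    ext
    · simp; field_simp; rw [hx] at h1; linarith
    · simp [hx]; field_simp
  -- If g were not higher than y, it would lie on the edge, hence in the closure of its own pocket.
  have h3 : 1 < g.2 / y.2 := by
    by_contra! hle
    exact h2 (mem_segment_iff.2 ⟨_, by positivity, hle, e⟩)
  have hg2 : y.2 < g.2 := by rwa [lt_div_iff₀ hy, one_mul] at h3
  refine mem_openSegment_iff.2 ⟨y.2 / g.2, div_pos hy (by linarith), ?_, ?_⟩
  · rw [div_lt_one (by linarith)]; exact hg2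
  · have : 0 < g.2 := by linarith
    ext
    · simp; unfold cr at h1; field_simp; rw [hx] at h1; linarith
    · simp [hx]; field_simp

end WVPolygon

/-! ### How a pocket approaches its constructed edge -/

namespace WVPolygon

open Filter Topology

variable {P V : Set Pt} {a b : ℝ}

theorem convex_side (σ : ℝ) (p q : Pt) : Convex ℝ {w | 0 < σ * cr p q w} := by
  intro w hw z hz s t hs ht hst
  have hw' : 0 < σ * cr p q w := hw
  have hz' : 0 < σ * cr p q z := hz
  have e : cr p q (s • w + t • z) = s * cr p q w + t * cr p q z := by
    have : s = 1 - t := by linarith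
    subst this
    simp [cr]; ring
  show 0 < σ * cr p q (s • w + t • z)
  rw [e]
  rcases eq_or_lt_of_le hs with h | h
  · have : t = 1 := by linarith
    subst this; rw [← h]; linarith
  · have : 0 < s * (σ * cr p q w) := mul_pos h hw'
    have : 0 ≤ t * (σ * cr p q z) := mul_nonneg ht hz'.le
    linarith

theorem mem_closure_side {σ : ℝ} {p q z w : Pt} {δ : ℝ} (hδ : dist w z < δ)
    (hw : 0 ≤ σ * cr p q w) {c : Pt} (hc : 0 < σ * cr p q c) :
    w ∈ closure (Metric.ball z δ ∩ {w | 0 < σ * cr p q w}) := by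
  refine mem_closure_of_shift (d := (c.1 - w.1, c.2 - w.2)) ?_
  filter_upwards [eventually_shift_dist (d := (c.1 - w.1, c.2 - w.2)) hδ,
    Ioo_mem_nhdsGT (show (0 : ℝ) < 1 by norm_num)] with s hs hs1
  refine ⟨hs, ?_⟩
  show 0 < σ * cr p q (shift w (c.1 - w.1, c.2 - w.2) s)
  rw [show shift w (c.1 - w.1, c.2 - w.2) s = pt w c s from rfl, cr_pt]
  have h1 : 0 < s * (σ * cr p q c) := mul_pos hs1.1 hc
  have h2 : 0 ≤ (1 - s) * (σ * cr p q w) := mul_nonneg (by linarith [hs1.2]) hw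
  nlinarith

/-- If a point `h` close to `y`, on one side of the line through `y` and `g`, is visible from `g`,
then all the points on that side near `y` are. -/
theorem Dom.eventually_visible (D : Dom P V a b) {g x y h : Pt} {σ δ : ℝ} (hσ : σ = 1 ∨ σ = -1)
    (hδ : 0 < δ) (hy : y ∈ openSegment ℝ x g) (hyg : y ∈ svis P g)
    (hb : Metric.ball y δ ∩ {w | 0 < σ * cr x g w} ⊆ P) (hyP : y ∈ P)
    (hh : h ∈ Metric.ball y δ) (hhσ : 0 < σ * cr x g h) (hhv : h ∈ svis P g) :
    ∀ᶠ c in 𝓝 y, 0 < σ * cr x g c → c ∈ svis P g := by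
  obtain ⟨t, t0, t1, ey⟩ := mem_openSegment_iff.1 hy
  have cy : ∀ w, cr y g w = (1 - t) * cr x g w := by intro w; rw [ey]; simp [cr]; ring
  have t1' : 0 < 1 - t := by linarith
  set K := Metric.ball y δ ∩ {w | 0 < σ * cr x g w} with hK
  have hKc : Convex ℝ K := (convex_ball y δ).inter (convex_side σ x g)
  have hyh : h ∈ svis P y := by
    intro w hw
    by_cases e : w = y
    · rw [e]; exact hyP
    · obtain ⟨s, s0, s1, rfl⟩ := mem_segment_iff.1 hw
      have s0' : 0 < s := by
        rcases eq_or_lt_of_le s0 with e' | e'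
        · exact absurd (by rw [← e', pt_zero]) e
        · exact e'
      refine hb ⟨(convex_ball y δ).segment_subset (Metric.mem_ball_self hδ) hh hw, ?_⟩
      show 0 < σ * cr x g (pt y h s)
      rw [cr_pt, ey, cr_pt_self]
      have := mul_pos s0' hhσ
      linarith
  have eb : ∀ᶠ c in 𝓝 y, c ∈ Metric.ball y δ := Metric.ball_mem_nhds y hδ
  have crg : ∀ c s, cr x g (pt g c s) = s * cr x g c := by
    intro c s; rw [cr_pt]; have : cr x g g = 0 := by unfold cr; ring
    rw [this]; ring
  -- g sees the triangle g h y. A point c of the half ball close to y is in its angle at g, so it is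
  -- in the triangle or is seen across the side h y, with the rest of the segment inside `K`. The
  -- two signs differ only in orientation.
  rcases hσ with rfl | rfl
  · have h0 : 0 < cr h y g := by
      have : cr h y g = cr y g h := cr_rotate _ _ _
      rw [this, cy]; nlinarith
    have hT : triangle g h y ⊆ svis P g := D.triangle_subset_svis hhv (svis_comm.1 hyh) hyg
    have c0 : cr h y y = 0 := by unfold cr; ring
    have e1 : ∀ᶠ c in 𝓝 y, 0 < cr g h c :=
      (continuous_cr g h).continuousAt.eventually_const_lt
        (by have : cr g h y = cr h y g := cr_rotate _ _ _
            rwa [this])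
    filter_upwards [eb, e1, (tendsto_crossing h0.ne' c0).eventually eb] with c h1 h2 h3 h4
    refine mem_svis_of_beyond hT h0 hKc hb ?_ h2.le ⟨h1, h4⟩ ?_
    · rw [cy]; nlinarith
    · intro hneg
      refine ⟨h3, ?_⟩
      show 0 < 1 * cr x g _
      rw [crg]
      have : 0 < cr h y g / (cr h y g - cr h y c) := div_pos h0 (by linarith)
      nlinarith [mul_pos this (by linarith : 0 < cr x g c)]
  · have h0 : 0 < cr y h g := by
      have : cr y h g = - cr y g h := cr_swap' _ _ _
      rw [this, cy]; nlinarith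
    have hT : triangle g y h ⊆ svis P g := D.triangle_subset_svis hyg hyh hhv
    have c0 : cr y h y = 0 := by unfold cr; ring
    have e1 : ∀ᶠ c in 𝓝 y, 0 < cr h g c :=
      (continuous_cr h g).continuousAt.eventually_const_lt
        (by have : cr h g y = cr y h g := by unfold cr; ring
            rwa [this])
    filter_upwards [eb, e1, (tendsto_crossing h0.ne' c0).eventually eb] with c h1 h2 h3 h4
    refine mem_svis_of_beyond hT h0 hKc hb h2.le ?_ ⟨h1, h4⟩ ?_
    · have : cr g y c = - cr y g c := by unfold cr; ring
      rw [this, cy]; nlinarith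
    · intro hneg
      refine ⟨h3, ?_⟩
      show 0 < -1 * cr x g _
      rw [crg]
      have : 0 < cr y h g / (cr y h g - cr y h c) := div_pos h0 (by linarith)
      nlinarith [mul_pos this (by linarith : 0 < -1 * cr x g c)]

/-- Near a point of a constructed edge, or its endpoint, that is not a vertex, the side from which
the pocket approaches is a half ball contained in the pocket. -/
theorem Dom.half_ball_subset_pocket (D : Dom P V a b) {g x y : Pt} {C : Set Pt} {σ : ℝ}
    (hC : SPocket P g C) (hσ : σ = 1 ∨ σ = -1) (hy : y ∈ openSegment ℝ x g)
    (hx : x ∈ svis P g) (hyV : y ∉ V) (hcl : y ∈ closure (C ∩ {w | 0 < σ * cr x g w})) :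
    ∃ δ > 0, Metric.ball y δ ∩ {w | 0 < σ * cr x g w} ⊆ C := by
  have hys := openSegment_subset_segment ℝ x g hy
  have hxg : segment ℝ x g ⊆ P := by rw [segment_symm]; exact hx
  have hyP : y ∈ P := hxg hys
  have hyg : y ∈ svis P g := mem_svis_of_mem_segment hx (by rwa [segment_symm])
  have hfreq := mem_closure_iff_frequently.1 hcl
  obtain ⟨ε, hε, hcone⟩ := D.exists_cone hyP
  have eε : ∀ᶠ c in 𝓝 y, c ∈ Metric.ball y ε := Metric.ball_mem_nhds y hε
  obtain ⟨c0, ⟨hc0, hc0σ⟩, hd0⟩ := (hfreq.and_eventually eε).exists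
  have hc0σ' : 0 < σ * cr x g c0 := hc0σ
  have hσσ : 0 < σ * σ := by rcases hσ with rfl | rfl <;> norm_num
  have hne : cr x g c0 ≠ 0 := by
    intro h; rw [h, mul_zero] at hc0σ'; exact lt_irrefl _ hc0σ'
  obtain ⟨δ, hδ, hhalf⟩ := D.half_ball hyV hy hxg hne (hcone c0 (hC.subset hc0).1 hd0)
  have hb : Metric.ball y δ ∩ {w | 0 < σ * cr x g w} ⊆ P := by
    rintro w ⟨hw1, hw2⟩
    refine hhalf w hw1 ?_
    have hw2' : 0 < σ * cr x g w := hw2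
    have : 0 < (σ * σ) * (cr x g w * cr x g c0) := by nlinarith [mul_pos hw2' hc0σ']
    exact ((pos_iff_pos_of_mul_pos this).1 hσσ).le
  refine ⟨δ, hδ, ?_⟩
  -- If g saw one point of the half ball, it would see all points of this side near y, and some of
  -- them are in the pocket.
  have hinv : ∀ h ∈ Metric.ball y δ ∩ {w | 0 < σ * cr x g w}, h ∉ svis P g := by
    rintro h ⟨h1, h2⟩ hv
    have hev := D.eventually_visible hσ hδ hy hyg hb hyP h1 h2 hv
    obtain ⟨c, ⟨hc, hcσ⟩, hh⟩ := (hfreq.and_eventually hev).exists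
    exact (hC.subset hc).2 (hh hcσ)
  have eδ : ∀ᶠ c in 𝓝 y, c ∈ Metric.ball y δ := Metric.ball_mem_nhds y hδ
  obtain ⟨c1, ⟨hc1, hc1σ⟩, hd1⟩ := (hfreq.and_eventually eδ).exists
  exact hC.subset_of_preconnected
    ((convex_ball y δ).inter (convex_side σ x g)).isPreconnected
    (fun w hw => ⟨hb hw, hinv w hw⟩) ⟨hd1, hc1σ⟩ hc1

/-- A pocket approaches an interior point of the segment from `g` to `x` from one of the sides. -/
theorem exists_side {g x y : Pt} {C : Set Pt} (hC : SPocket P g C)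
    (hy : y ∈ openSegment ℝ x g) (hx : x ∈ svis P g) (hcl : y ∈ closure C) (hxg : x ≠ g) :
    ∃ σ : ℝ, (σ = 1 ∨ σ = -1) ∧ y ∈ closure (C ∩ {w | 0 < σ * cr x g w}) := by
  have hcov : C ⊆ (C ∩ {w | 0 < (1 : ℝ) * cr x g w}) ∪ (C ∩ {w | 0 < (-1 : ℝ) * cr x g w}) ∪
      (C ∩ {w | cr x g w = 0}) := by
    intro w hw
    rcases lt_trichotomy (cr x g w) 0 with h | h | h
    · exact Or.inl (Or.inr ⟨hw, show 0 < (-1 : ℝ) * cr x g w by linarith⟩)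
    · exact Or.inr ⟨hw, h⟩
    · exact Or.inl (Or.inl ⟨hw, show 0 < (1 : ℝ) * cr x g w by linarith⟩)
  have := closure_mono hcov hcl
  rw [closure_union, closure_union] at this
  rcases this with (h | h) | h
  · exact ⟨1, Or.inl rfl, h⟩
  · exact ⟨-1, Or.inr rfl, h⟩
  · exfalso
    obtain ⟨t, t0, t1, ey⟩ := mem_openSegment_iff.1 hy
    -- points of the line near `y` belong to the segment
    set n : ℝ := (g.1 - x.1) ^ 2 + (g.2 - x.2) ^ 2 with hn
    have hn0 : 0 < n := by
      by_contra! hle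
      apply hxg
      ext
      · nlinarith [sq_nonneg (g.1 - x.1), sq_nonneg (g.2 - x.2)]
      · nlinarith [sq_nonneg (g.1 - x.1), sq_nonneg (g.2 - x.2)]
    set f : Pt → ℝ := fun w => ((w.1 - x.1) * (g.1 - x.1) + (w.2 - x.2) * (g.2 - x.2)) / n with hf
    have hfc : Continuous f := by rw [hf]; fun_prop
    have hfy : f y = t := by
      rw [hf, ey]; simp only [pt_fst, pt_snd]
      rw [div_eq_iff hn0.ne', hn]; ring
    have hev : ∀ᶠ w in 𝓝 y, f w ∈ Ioo (0 : ℝ) 1 :=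
      hfc.continuousAt.eventually (by rw [hfy]; exact Ioo_mem_nhds t0 t1)
    obtain ⟨c, ⟨hc, hc0⟩, hfc1⟩ := ((mem_closure_iff_frequently.1 h).and_eventually hev).exists
    apply (hC.subset hc).2
    refine mem_svis_of_mem_segment hx ?_
    rw [segment_symm]
    refine mem_segment_iff.2 ⟨f c, hfc1.1.le, hfc1.2.le, ?_⟩
    have hc0' : cr x g c = 0 := hc0
    unfold cr at hc0'
    ext
    · simp only [pt_fst, hf]
      field_simp
      rw [hn]
      linear_combination (-(g.2 - x.2)) * hc0'
    · simp only [pt_snd, hf]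
      field_simp
      rw [hn]
      linear_combination (g.1 - x.1) * hc0'

theorem ne_of_mem_openSegment {x y g : Pt} (hy : y ∈ openSegment ℝ x g) (h : x ≠ y) : x ≠ g := by
  rintro rfl
  rw [openSegment_same] at hy
  exact h hy.symm

/-- The upper endpoint of a constructed edge that starts on the base is a vertex. -/
theorem Dom.constructed_vertex (D : Dom P V a b) {g x y : Pt} {C : Set Pt}
    (h : SConstructed P g C x y) (hy : y ∈ openSegment ℝ x g) : y ∈ V := by
  by_contra hyV
  have hx : x ∈ svis P g := h.mem_svis (left_mem_segment ℝ x y)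
  have hxg : x ≠ g := ne_of_mem_openSegment hy h.ne
  obtain ⟨σ, hσ, hcl⟩ := exists_side h.pocket hy hx (h.mem_closure (right_mem_segment ℝ x y)) hxg
  -- At a non-vertex y the pocket would contain a half ball, and its closure would contain points of
  -- the segment x g beyond y. These are visible from g, so the edge would not end at y.
  obtain ⟨δ, hδ, hsub⟩ := D.half_ball_subset_pocket h.pocket hσ hy hx hyV hcl
  obtain ⟨c, hc, hcσ⟩ := (closure_nonempty_iff.1 ⟨y, hcl⟩)
  obtain ⟨t, t0, t1, ey⟩ := mem_openSegment_iff.1 hy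
  have hyg : y ≠ g := by
    intro e
    have h0 : (1 - t) * (g.1 - x.1) = 0 := by
      have := congrArg Prod.fst ey; rw [e] at this; simp at this; linarith
    have h1 : (1 - t) * (g.2 - x.2) = 0 := by
      have := congrArg Prod.snd ey; rw [e] at this; simp at this; linarith
    apply hxg
    ext
    · have := (mul_eq_zero.1 h0).resolve_left (by linarith); linarith
    · have := (mul_eq_zero.1 h1).resolve_left (by linarith); linarith
  -- a point of the segment just beyond `y`
  have hyy : dist y y < δ := by simpa using hδ
  have e01 : ∀ᶠ s in 𝓝[>] (0 : ℝ), s ∈ Ioo (0 : ℝ) 1 :=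
    Ioo_mem_nhdsGT (show (0 : ℝ) < 1 by norm_num)
  obtain ⟨s, hs, hs0, hs1⟩ :=
    ((eventually_shift_dist (d := (g.1 - y.1, g.2 - y.2)) hyy).and e01).exists
  have hz : pt y g s ∈ closure C := by
    refine closure_mono hsub (mem_closure_side hs ?_ hcσ)
    rw [cr_pt, ey, cr_pt_self]
    have : cr x g g = 0 := by unfold cr; ring
    rw [this]; simp
  have hzs : pt y g s ∈ segment ℝ y g := pt_mem_segment hs0.le hs1.le
  have hzv : pt y g s ∈ svis P g := by
    refine mem_svis_of_mem_segment hx ?_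
    rw [segment_symm]
    exact segment_subset_right (openSegment_subset_segment ℝ x g hy) hzs
  have : pt y g s ∈ segment ℝ x y := by rw [← h.eq_segment]; exact ⟨hz, hzv⟩
  obtain ⟨r, r0, r1, er⟩ := mem_segment_iff.1 this
  have e1 := congrArg Prod.fst er
  have e2 := congrArg Prod.snd er
  have y1 := congrArg Prod.fst ey
  have y2 := congrArg Prod.snd ey
  simp only [pt_fst, pt_snd] at e1 e2 y1 y2
  have hk : 0 < (1 - r) * t + s * (1 - t) := by
    have : 0 < s * (1 - t) := mul_pos hs0 (by linarith)
    have : 0 ≤ (1 - r) * t := mul_nonneg (by linarith) t0.le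
    linarith
  apply hxg
  ext
  · have : ((1 - r) * t + s * (1 - t)) * (g.1 - x.1) = 0 := by
      rw [y1] at e1; linear_combination e1
    have := (mul_eq_zero.1 this).resolve_left hk.ne'; linarith
  · have : ((1 - r) * t + s * (1 - t)) * (g.2 - x.2) = 0 := by
      rw [y2] at e2; linear_combination e2
    have := (mul_eq_zero.1 this).resolve_left hk.ne'; linarith

end WVPolygon

/-! ### A vertex that guards the triangle of a crossing -/

namespace WVPolygon

open Filter Topology

variable {P V : Set Pt} {a b : ℝ}

/-- Height and cross product are affine in the point, so the same weights evaluate all of them. -/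
theorem exists_weights {x y z p : Pt} (hp : p ∈ triangle x y z) :
    ∃ α β γ : ℝ, 0 ≤ α ∧ 0 ≤ β ∧ 0 ≤ γ ∧ α + β + γ = 1 ∧
      p.2 = α * x.2 + β * y.2 + γ * z.2 ∧
      ∀ u v, cr u v p = α * cr u v x + β * cr u v y + γ * cr u v z := by
  obtain ⟨α, β, γ, hα, hβ, hγ, h1, rfl⟩ := mem_triangle_iff.1 hp
  refine ⟨α, β, γ, hα, hβ, hγ, h1, rfl, fun u v => ?_⟩
  have : α = 1 - β - γ := by linarith
  subst this
  simp [cr]; ring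

theorem dist_pt_le {x y z : Pt} {t : ℝ} (h0 : 0 ≤ t) (h1 : t ≤ 1) :
    dist (pt x y t) (pt x z t) ≤ dist y z := by
  rw [← lineMap_eq_pt, ← lineMap_eq_pt]
  have : AffineMap.lineMap x y t - AffineMap.lineMap x z t = t • (y - z) := by
    simp [AffineMap.lineMap_apply]; rw [← smul_sub]; congr 1; abel
  rw [dist_eq_norm, dist_eq_norm, this, norm_smul, Real.norm_of_nonneg h0]
  exact mul_le_of_le_one_left (norm_nonneg _) h1

/-- The set of base points. -/
theorem Dom.mem_openSegment_base (D : Dom P V a b) {c : ℝ} (h1 : a ≤ c) (h2 : c ≤ b)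
    (h : ((c, 0) : Pt) ∉ V) : ((c, 0) : Pt) ∈ openSegment ℝ ((a, 0) : Pt) (b, 0) := by
  have hab := D.lt
  have h1' : a < c := lt_of_le_of_ne h1 (by rintro rfl; exact h D.left_mem)
  have h2' : c < b := lt_of_le_of_ne h2 (by rintro rfl; exact h D.right_mem)
  have h' : 0 < b - a := by linarith
  refine mem_openSegment_iff.2 ⟨(c - a) / (b - a), div_pos (by linarith) h', ?_, ?_⟩
  · rw [div_lt_one h']; linarith
  · ext <;> simp; field_simp; ring

/-- If `x'` sees the point `s` of the chord `x y` but no point just beyond it, then a vertex lies on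
the segment from `x'` to `s`. -/
theorem Dom.exists_vertex_on_segment (D : Dom P V a b) {x' s x y : Pt} (hx' : x'.2 = 0)
    (hax : a ≤ x'.1) (hxb : x'.1 ≤ b) (hxy : segment ℝ x y ⊆ P) (hs : s ∈ openSegment ℝ x y)
    (hs0 : 0 < s.2) (hcr : cr x y x' ≠ 0) (hvis : s ∈ svis P x') (hy0 : 0 ≤ y.2)
    (hmax : ∀ᶠ τ in 𝓝[>] (0 : ℝ), pt s y τ ∉ svis P x') :
    ∃ w ∈ V, w ∈ segment ℝ x' s := by
  by_contra! hV
  have hV' : ∀ w ∈ segment ℝ x' s, w ∉ V := fun w hw hwV => hV w hwV hw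
  -- Sight lines from x' to points just beyond s run inside `T`, so only the complement of P inside
  -- `T` can block them. `B` marks the points of the segment x' s where this part of the complement
  -- accumulates. At the last of them, if it is not a vertex, `Dom.half_ball` puts the nearby part
  -- of `T` into P, a contradiction.
  set T := triangle x' s y with hT
  have hTc : Convex ℝ T := convex_triangle _ _ _
  have ex' : x' = (x'.1, 0) := Prod.ext rfl hx'
  obtain ⟨t, t0, t1, es⟩ := mem_openSegment_iff.1 hs
  have crs : cr x y s = 0 := by rw [es]; exact cr_pt_self _ _ _
  have cry : cr x y y = 0 := by unfold cr; ring
  have crsy : cr x' s y ≠ 0 := by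
    have : cr x' s y = (1 - t) * cr x y x' := by rw [es]; simp [cr]; ring
    rw [this]; exact mul_ne_zero (by linarith) hcr
  set B : Set ℝ := Icc 0 1 ∩ (fun r => pt x' s r) ⁻¹' closure (Pᶜ ∩ T) with hB
  have hBc : IsCompact B := isCompact_Icc.inter_right
    (isClosed_closure.preimage (continuous_pt x' s))
  rcases B.eq_empty_or_nonempty with hBe | hBne
  · -- nothing blocks the view beyond `s`
    have hopen : segment ℝ x' s ⊆ (closure (Pᶜ ∩ T))ᶜ := by
      intro w hw hwc
      obtain ⟨r, r0, r1, rfl⟩ := mem_segment_iff.1 hw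
      have : r ∈ B := ⟨⟨r0, r1⟩, hwc⟩
      rw [hBe] at this; exact this
    obtain ⟨δ, hδ, hth⟩ := (isCompact_segment x' s).exists_thickening_subset_open
      isClosed_closure.isOpen_compl hopen
    have hss : dist s s < δ := by simpa using hδ
    have e01 : ∀ᶠ τ in 𝓝[>] (0 : ℝ), τ ∈ Ioo (0 : ℝ) 1 :=
      Ioo_mem_nhdsGT (show (0 : ℝ) < 1 by norm_num)
    obtain ⟨τ, hτ, hτd, hτ0, hτ1⟩ := (hmax.and
      ((eventually_shift_dist (d := (y.1 - s.1, y.2 - s.2)) hss).and e01)).exists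
    apply hτ
    intro w hw
    by_contra hwP
    obtain ⟨r, r0, r1, ew⟩ := mem_segment_iff.1 hw
    have hwT : w ∈ T := hTc.segment_subset (left_mem_triangle _ _ _)
      (hTc.segment_subset (mid_mem_triangle _ _ _) (right_mem_triangle _ _ _)
        (pt_mem_segment hτ0.le hτ1.le)) hw
    refine hth ?_ (subset_closure ⟨hwP, hwT⟩)
    rw [Metric.mem_thickening_iff]
    refine ⟨pt x' s r, pt_mem_segment r0 r1, ?_⟩
    rw [ew]
    exact (dist_pt_le r0 r1).trans_lt hτd
  · obtain ⟨r, ⟨⟨r0, r1⟩, hrc⟩, hrmax⟩ := hBc.exists_isGreatest hBne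
    have hrc' : pt x' s r ∈ closure (Pᶜ ∩ T) := hrc
    have hfreq := mem_closure_iff_frequently.1 hrc'
    rcases eq_or_lt_of_le r1 with e1 | l1
    -- At s the segment through the point is the chord x y, and `T` is on the side of x', which s
    -- sees.
    · rw [e1, pt_one] at hfreq
      obtain ⟨ε, hε, hh⟩ := D.half_ball (hV' s (right_mem_segment ℝ x' s)) hs hxy hcr
        (svis_comm.1 hvis)
      have eb : ∀ᶠ c in 𝓝 s, c ∈ Metric.ball s ε := Metric.ball_mem_nhds s hε
      obtain ⟨k, ⟨hkP, hkT⟩, hkb⟩ := (hfreq.and_eventually eb).exists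
      refine hkP (hh k hkb ?_)
      obtain ⟨α, β, γ, hα, hβ, hγ, h1, _, hk⟩ := exists_weights hkT
      rw [hk x y, crs, cry]
      have : 0 ≤ α * (cr x y x' * cr x y x') := mul_nonneg hα (mul_self_nonneg _)
      nlinarith
    rcases eq_or_lt_of_le r0 with e0 | l0
    -- At x' the segment through the point is the base, and `T` is above it, on the side of s.
    · rw [← e0, pt_zero] at hfreq
      have hxV := hV' x' (left_mem_segment ℝ x' s)
      have hbase : x' ∈ openSegment ℝ ((a, 0) : Pt) (b, 0) := by
        rw [ex'] at hxV ⊢; exact D.mem_openSegment_base hax hxb hxV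
      have hcb : ∀ k : Pt, cr (a, 0) (b, 0) k = (b - a) * k.2 := by intro k; simp [cr]
      have hab : 0 < b - a := by linarith [D.lt]
      obtain ⟨ε, hε, hh⟩ := D.half_ball hxV hbase
        (D.base_segment le_rfl D.lt.le D.lt.le le_rfl)
        (by rw [hcb]; exact (mul_pos hab hs0).ne') hvis
      have eb : ∀ᶠ c in 𝓝 x', c ∈ Metric.ball x' ε := Metric.ball_mem_nhds x' hε
      obtain ⟨k, ⟨hkP, hkT⟩, hkb⟩ := (hfreq.and_eventually eb).exists
      refine hkP (hh k hkb ?_)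
      obtain ⟨α, β, γ, hα, hβ, hγ, h1, hk, _⟩ := exists_weights hkT
      rw [hcb, hcb]
      have : 0 ≤ k.2 := by rw [hk, hx']; positivity
      positivity
    -- At an interior point f, maximality leaves a point `f'` just beyond f free of obstacles in
    -- `T`. Moving `f'` slightly towards y gives a point of P on the side of `T`, which f sees by
    -- the cone structure.
    · set f := pt x' s r with hf
      have hfP : f ∈ P := hvis (pt_mem_segment r0 r1)
      obtain ⟨ε, hε, hcone⟩ := D.exists_cone hfP
      have hff : dist f f < ε := by simpa using hε
      have e01 : ∀ᶠ τ in 𝓝[>] (0 : ℝ), τ ∈ Ioo (0 : ℝ) 1 :=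
        Ioo_mem_nhdsGT (show (0 : ℝ) < 1 by norm_num)
      obtain ⟨τ, hτd, hτ0, hτ1⟩ :=
        ((eventually_shift_dist (d := (s.1 - f.1, s.2 - f.2)) hff).and e01).exists
      set f' := pt f s τ with hf'
      have ef' : f' = pt x' s (r + τ * (1 - r)) := by
        rw [hf', hf]; ext <;> simp <;> ring
      have hτr : 0 < τ * (1 - r) := mul_pos hτ0 (by linarith)
      have hf'n : f' ∉ closure (Pᶜ ∩ T) := by
        intro hcl
        have : r + τ * (1 - r) ∈ B := by
          refine ⟨⟨by linarith, by nlinarith⟩, ?_⟩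
          show pt x' s (r + τ * (1 - r)) ∈ closure (Pᶜ ∩ T)
          rwa [← ef']
        have := hrmax this
        linarith
      have hf'T : f' ∈ T := by
        rw [ef']
        exact hTc.segment_subset (left_mem_triangle _ _ _) (mid_mem_triangle _ _ _)
          (pt_mem_segment (by linarith) (by nlinarith))
      have e3 := (tendsto_shift f' (y.1 - f'.1, y.2 - f'.2)).eventually
        (isClosed_closure.isOpen_compl.mem_nhds hf'n)
      obtain ⟨κ, hκd, hκn, hκ0, hκ1⟩ :=
        ((eventually_shift_dist (d := (y.1 - f'.1, y.2 - f'.2))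
          (show dist f' f < ε from hτd)).and (e3.and e01)).exists
      have hγP : pt f' y κ ∈ P := by
        by_contra hcon
        exact hκn (subset_closure ⟨hcon,
          hTc.segment_subset hf'T (right_mem_triangle _ _ _) (pt_mem_segment hκ0.le hκ1.le)⟩)
      have hcγ : cr x' s (pt f' y κ) = κ * cr x' s y := by
        rw [cr_pt, ef', cr_pt_self]; ring
      obtain ⟨η, hη, hh⟩ := D.half_ball
        (hV' f (pt_mem_segment r0 r1)) (mem_openSegment_iff.2 ⟨r, l0, l1, rfl⟩) hvis
        (by rw [hcγ]; exact mul_ne_zero hκ0.ne' crsy) (hcone _ hγP hκd)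
      have eb : ∀ᶠ c in 𝓝 f, c ∈ Metric.ball f η := Metric.ball_mem_nhds f hη
      obtain ⟨k, ⟨hkP, hkT⟩, hkb⟩ := (hfreq.and_eventually eb).exists
      refine hkP (hh k hkb ?_)
      obtain ⟨α, β, γ, hα, hβ, hγ, h1, _, hk⟩ := exists_weights hkT
      have z1 : cr x' s x' = 0 := by unfold cr; ring
      have z2 : cr x' s s = 0 := by unfold cr; ring
      rw [hcγ, hk x' s, z1, z2]
      have : 0 ≤ γ * κ * (cr x' s y * cr x' s y) :=
        mul_nonneg (mul_nonneg hγ hκ0.le) (mul_self_nonneg _)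
      nlinarith

theorem Dom.convex_base_subset (D : Dom P V a b) :
    segment ℝ ((a, 0) : Pt) (b, 0) ⊆ P :=
  D.base_segment le_rfl D.lt.le D.lt.le le_rfl

/-- A triangle formed by two chords that start on the base, one of which ends at a vertex, is guarded
by a vertex. -/
theorem Dom.exists_vertex_guard (D : Dom P V a b) {x y x' p : Pt}
    (hx : x ∈ segment ℝ ((a, 0) : Pt) (b, 0)) (hx' : x' ∈ segment ℝ ((a, 0) : Pt) (b, 0))
    (hxy : segment ℝ x y ⊆ P) (hp : p ∈ segment ℝ x y) (hpx' : segment ℝ x' p ⊆ P)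
    (hyV : y ∈ V) (hy0 : 0 < y.2) (hne : x ≠ x') : ∃ w ∈ V, triangle x p x' ⊆ svis P w := by
  have base0 : ∀ z ∈ segment ℝ ((a, 0) : Pt) (b, 0), z.2 = 0 ∧ a ≤ z.1 ∧ z.1 ≤ b := by
    intro z hz
    obtain ⟨t, t0, t1, rfl⟩ := mem_segment_iff.1 hz
    have := D.lt
    simp only [pt_fst, pt_snd]
    exact ⟨by ring, by nlinarith, by nlinarith⟩
  obtain ⟨hx0, hxa, hxb⟩ := base0 x hx
  obtain ⟨hx0', hxa', hxb'⟩ := base0 x' hx'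
  obtain ⟨t, t0, t1, ep⟩ := mem_segment_iff.1 hp
  rcases eq_or_lt_of_le t0 with e | tpos
  · have : p = x := by rw [ep, ← e, pt_zero]
    subst this
    -- For p = x the triangle is part of the base, and an end of the base sees all of it.
    refine ⟨(a, 0), D.left_mem, fun w hw => ?_⟩
    have hw' := triangle_subset_of_convex (convex_segment ((a, 0) : Pt) (b, 0)) hx hx hx' hw
    exact ((convex_segment ((a, 0) : Pt) (b, 0)).segment_subset (left_mem_segment _ _ _)
      hw').trans D.convex_base_subset
  have hp0 : 0 < p.2 := by rw [ep]; simp [hx0]; positivity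
  have hcr : cr x y x' ≠ 0 := by
    have : cr x y x' = y.2 * (x.1 - x'.1) := by unfold cr; rw [hx0, hx0']; ring
    rw [this]
    refine mul_ne_zero hy0.ne' ?_
    intro h
    exact hne (Prod.ext (by linarith) (by rw [hx0, hx0']))
  -- the farthest point of the chord beyond `p` that is visible from `x'`
  set S : Set ℝ := Icc 0 1 ∩ (fun r => pt p y r) ⁻¹' svis P x' with hS
  have hSc : IsCompact S := isCompact_Icc.inter_right
    ((isClosed_svis D.compact.isClosed x').preimage (continuous_pt p y))
  have h0S : (0 : ℝ) ∈ S := ⟨⟨le_rfl, zero_le_one⟩, by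
    show pt p y 0 ∈ svis P x'
    rw [pt_zero]; exact hpx'⟩
  obtain ⟨r, ⟨⟨r0, r1⟩, hrv⟩, hrmax⟩ := hSc.exists_isGreatest ⟨0, h0S⟩
  set s := pt p y r with hs
  have hsv : s ∈ svis P x' := hrv
  have hsp : s ∈ segment ℝ p y := pt_mem_segment r0 r1
  have hsxy : s ∈ segment ℝ x y := segment_subset_right hp hsp
  -- If s is the end y of the chord, then y is the vertex; otherwise the view from x' is lost just
  -- beyond s.
  have hw : ∃ w ∈ V, w ∈ segment ℝ x' s := by
    rcases eq_or_lt_of_le r1 with e | l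
    · exact ⟨y, hyV, by rw [hs, e, pt_one]; exact right_mem_segment _ _ _⟩
    · have es : s = pt x y (t + r * (1 - t)) := by
        rw [hs, ep]; ext <;> simp <;> ring
      have ht1 : t + r * (1 - t) ≤ 1 := by nlinarith
      by_cases ht : t = 1
      · -- then `p = y`
        refine ⟨y, hyV, ?_⟩
        have : s = y := by rw [es, ht]; ext <;> simp
        rw [this]; exact right_mem_segment _ _ _
      have ht' : t < 1 := lt_of_le_of_ne t1 ht
      refine D.exists_vertex_on_segment (x := x) (y := y) hx0' hxa' hxb' hxy ?_ ?_ hcr hsv hy0.le ?_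
      · refine mem_openSegment_iff.2 ⟨_, ?_, ?_, es⟩
        · have : 0 ≤ r * (1 - t) := mul_nonneg r0 (by linarith)
          linarith
        · nlinarith
      · rw [hs]; simp only [pt_snd]
        have : p.2 + r * (y.2 - p.2) = (1 - r) * p.2 + r * y.2 := by ring
        rw [this]
        have := mul_pos (show 0 < 1 - r by linarith) hp0
        have := mul_nonneg r0 hy0.le
        linarith
      · filter_upwards [Ioo_mem_nhdsGT (show (0 : ℝ) < 1 by norm_num)] with τ hτ hcon
        have e : pt s y τ = pt p y (r + τ * (1 - r)) := by
          rw [hs]; ext <;> simp <;> ring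
        rw [e] at hcon
        have hpos : 0 < τ * (1 - r) := mul_pos hτ.1 (by linarith)
        have : r + τ * (1 - r) ∈ S := ⟨⟨by linarith, by nlinarith [hτ.2]⟩, hcon⟩
        have := hrmax this
        linarith
  obtain ⟨w, hwV, hwS⟩ := hw
  refine ⟨w, hwV, ?_⟩
  -- This triangle is convex and contains both w and the triangle x p x'.
  have hT : triangle x s x' ⊆ P := D.triangle_subset
    ((segment_subset_left hsxy).trans hxy) (svis_comm.1 hsv)
    (((convex_segment ((a, 0) : Pt) (b, 0)).segment_subset hx hx').trans D.convex_base_subset)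
  have hTc := convex_triangle x s x'
  have hpT : p ∈ triangle x s x' := by
    refine hTc.segment_subset (left_mem_triangle _ _ _) (mid_mem_triangle _ _ _) ?_
    have hp2 : 0 < t + r * (1 - t) := by
      have : 0 ≤ r * (1 - t) := mul_nonneg r0 (by linarith)
      linarith
    refine mem_segment_iff.2 ⟨t / (t + r * (1 - t)), by positivity, ?_, ?_⟩
    · rw [div_le_one hp2]
      have : 0 ≤ r * (1 - t) := mul_nonneg r0 (by linarith)
      linarith
    · rw [hs, ep]; ext <;> simp <;> field_simp <;> ring
  intro z hz
  exact (hTc.segment_subset (hTc.segment_subset (right_mem_triangle _ _ _)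
    (mid_mem_triangle _ _ _) hwS) (triangle_subset_of_convex hTc (left_mem_triangle _ _ _) hpT
      (right_mem_triangle _ _ _) hz)).trans hT

end WVPolygon

/-! ### Upper edges and their uniqueness -/

namespace WVPolygon

open Filter Topology

variable {P V : Set Pt} {a b : ℝ}

theorem mem_line_iff {x y z : Pt} (h : x ≠ y) : z ∈ line[ℝ, x, y] ↔ cr x y z = 0 := by
  rw [mem_affineSpan_pair_iff_exists_lineMap_eq]
  constructor
  · rintro ⟨t, rfl⟩
    rw [lineMap_eq_pt, cr_pt_self]
  · intro hc
    set n : ℝ := (y.1 - x.1) ^ 2 + (y.2 - x.2) ^ 2 with hn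
    have hn0 : 0 < n := by
      by_contra! hle
      apply h
      ext
      · nlinarith [sq_nonneg (y.1 - x.1), sq_nonneg (y.2 - x.2)]
      · nlinarith [sq_nonneg (y.1 - x.1), sq_nonneg (y.2 - x.2)]
    refine ⟨((z.1 - x.1) * (y.1 - x.1) + (z.2 - x.2) * (y.2 - x.2)) / n, ?_⟩
    rw [lineMap_eq_pt]
    unfold cr at hc
    ext
    · simp only [pt_fst]
      field_simp
      rw [hn]
      linear_combination (y.2 - x.2) * hc
    · simp only [pt_snd]
      field_simp
      rw [hn]
      linear_combination (-(y.1 - x.1)) * hc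

/-- The factor x.1 - y.1 makes the sign independent of the direction in which the line is traversed.
-/
theorem isBelow_iff {x y z : Pt} (h : x.1 ≠ y.1) :
    IsBelow x y z ↔ 0 < (x.1 - y.1) * cr x y z := by
  have hxy : x ≠ y := fun e => h (by rw [e])
  have h' : x.1 - y.1 ≠ 0 := sub_ne_zero.2 h
  have hsq : 0 < (x.1 - y.1) ^ 2 := by positivity
  have key : ∀ t : ℝ, cr x y (z.1, z.2 + t) = cr x y z - (x.1 - y.1) * t := by
    intro t; unfold cr; ring
  unfold IsBelow
  constructor
  · rintro ⟨t, ht, hm⟩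
    rw [mem_line_iff hxy, key] at hm
    have : cr x y z = (x.1 - y.1) * t := by linarith
    rw [this]
    have : (x.1 - y.1) * ((x.1 - y.1) * t) = (x.1 - y.1) ^ 2 * t := by ring
    rw [this]; positivity
  · intro hp
    refine ⟨cr x y z / (x.1 - y.1), ?_, ?_⟩
    · rcases lt_or_gt_of_ne h' with hl | hl
      · exact div_pos_of_neg_of_neg (by nlinarith) hl
      · exact div_pos (by nlinarith) hl
    · rw [mem_line_iff hxy, key]; field_simp; ring

/-- `C` lies below the line through `x` and `y`. -/
def SLiesBelow (P C : Set Pt) (x y : Pt) : Prop :=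
  ∀ w ∈ openSegment ℝ x y, ∀ q ∈ svis P w, IsBelow x y q → q ∈ C

theorem openSegment_nonempty (x y : Pt) : pt x y (1 / 2) ∈ openSegment ℝ x y :=
  mem_openSegment_iff.2 ⟨1 / 2, by norm_num, by norm_num, rfl⟩

/-- Each point of a vertical line counts as below it, so a point inside the edge would belong to the
pocket although g sees it. -/
theorem SConstructed.not_vertical {g x y : Pt} {C : Set Pt} (h : SConstructed P g C x y)
    (hb : SLiesBelow P C x y) : x.1 ≠ y.1 := by
  intro e
  have hw := openSegment_nonempty x y
  have hs := openSegment_subset_segment ℝ x y hw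
  have := hb _ hw _ (svis_self (h.segment_subset hs)) ⟨1, one_pos, by
    rw [mem_line_iff h.ne]; simp [cr, e]⟩
  exact (h.pocket.subset this).2 (h.mem_svis hs)

/-- A point visible from `g` together with `x` is not below an upper edge of `g`. -/
theorem Dom.not_isBelow (D : Dom P V a b) {g x y z : Pt} {C : Set Pt}
    (h : SConstructed P g C x y) (hb : SLiesBelow P C x y) (hz : z ∈ svis P g)
    (hzx : z ∈ svis P x) (hy : y ∈ segment ℝ x g) : ¬ IsBelow x y z := by
  intro hbel
  have hv := h.not_vertical hb
  rw [isBelow_iff hv] at hbel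
  have hx : x ∈ svis P g := h.mem_svis (left_mem_segment ℝ x y)
  have hT := D.triangle_subset_svis hx hzx hz
  have hTc := convex_triangle g x z
  -- g sees the triangle g x z. It contains the midpoint w of the edge and the midpoint of w z; the
  -- latter is below the edge and seen by w, so it would be in the pocket.
  set w := pt x y (1 / 2) with hw
  have hwo := openSegment_nonempty x y
  have hwT : w ∈ triangle g x z := by
    refine hTc.segment_subset (mid_mem_triangle _ _ _) ?_ (openSegment_subset_segment ℝ x y hwo)
    exact hTc.segment_subset (mid_mem_triangle _ _ _) (left_mem_triangle _ _ _) hy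
  have hqT : pt w z (1 / 2) ∈ triangle g x z := hTc.segment_subset hwT (right_mem_triangle _ _ _)
    (pt_mem_segment (by norm_num) (by norm_num))
  have hq := hb w hwo (pt w z (1 / 2)) ((hTc.segment_subset hwT hqT).trans
    (hT.trans svis_subset)) ?_
  · exact (h.pocket.subset hq).2 (hT hqT)
  · rw [isBelow_iff hv, cr_pt, hw, cr_pt_self]
    nlinarith

/-- An upper edge that starts on the base is determined by the point it belongs to. -/
theorem Dom.upper_edge_unique_right (D : Dom P V a b) {g x y y' : Pt} {C C' : Set Pt}
    (h : SConstructed P g C x y) (hb : SLiesBelow P C x y)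
    (h' : SConstructed P g C' x y') (hb' : SLiesBelow P C' x y')
    (hy : y ∈ openSegment ℝ x g) (hy' : y' ∈ openSegment ℝ x g) : y = y' := by
  wlog hyy : y ∈ segment ℝ x y' generalizing y y' C C'
  · refine (this h' hb' h hb hy' hy ?_).symm
    obtain ⟨t, t0, t1, ey⟩ := mem_openSegment_iff.1 hy
    obtain ⟨s, s0, s1, ey'⟩ := mem_openSegment_iff.1 hy'
    rcases le_total s t with hst | hst
    · refine mem_segment_iff.2 ⟨s / t, by positivity, (div_le_one t0).2 hst, ?_⟩
      rw [ey', ey]; ext <;> simp <;> field_simp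
    · exfalso; apply hyy
      refine mem_segment_iff.2 ⟨t / s, by positivity, (div_le_one s0).2 hst, ?_⟩
      rw [ey', ey]; ext <;> simp <;> field_simp
  have hx : x ∈ svis P g := h.mem_svis (left_mem_segment ℝ x y)
  have hxg : x ≠ g := ne_of_mem_openSegment hy h.ne
  obtain ⟨w, hw, hwV⟩ := exists_openSegment_notMem h.ne D.finite
  obtain ⟨t, t0, t1, ey⟩ := mem_openSegment_iff.1 hy
  obtain ⟨t', t0', t1', ey'⟩ := mem_openSegment_iff.1 hy'
  obtain ⟨s, s0, s1, ew⟩ := mem_openSegment_iff.1 hw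
  obtain ⟨r, r0, r1, eyy⟩ := mem_segment_iff.1 hyy
  have hr0 : 0 < r := by
    rcases eq_or_lt_of_le r0 with e | e
    · exact absurd (by rw [eyy, ← e, pt_zero]) h.ne
    · exact e
  have hwg : w ∈ openSegment ℝ x g := by
    refine mem_openSegment_iff.2 ⟨s * t, by positivity, by nlinarith, ?_⟩
    rw [ew, ey]; ext <;> simp <;> ring
  have hw' : w ∈ openSegment ℝ x y' := by
    refine mem_openSegment_iff.2 ⟨s * r, by positivity, by nlinarith, ?_⟩
    rw [ew, eyy]; ext <;> simp <;> ring
  have hwP : w ∈ P := h.segment_subset (openSegment_subset_segment ℝ x y hw)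
  obtain ⟨ε, hε, hcone⟩ := D.exists_cone hwP
  obtain ⟨σ, hσ, hcl⟩ := exists_side h.pocket hwg hx
    (h.mem_closure (openSegment_subset_segment ℝ x y hw)) hxg
  obtain ⟨σ', hσ', hcl'⟩ := exists_side h'.pocket hwg hx
    (h'.mem_closure (openSegment_subset_segment ℝ x y' hw')) hxg
  have hvx : x.1 ≠ y.1 := h.not_vertical hb
  have hvx' : x.1 ≠ y'.1 := h'.not_vertical hb'
  have cry : ∀ z, (x.1 - y.1) * cr x y z = t ^ 2 * ((x.1 - g.1) * cr x g z) := by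
    intro z; rw [ey]; simp [cr]; ring
  have cry' : ∀ z, (x.1 - y'.1) * cr x y' z = t' ^ 2 * ((x.1 - g.1) * cr x g z) := by
    intro z; rw [ey']; simp [cr]; ring
  have eε : ∀ᶠ c in 𝓝 w, c ∈ Metric.ball w ε := Metric.ball_mem_nhds w hε
  -- If both pockets approach w from the same side, a half ball contained in one meets the other. If
  -- not, one of them approaches from below the line, and since the other one lies below its edge,
  -- it contains those points.
  have hCC : C = C' := by
    by_cases hs : σ = σ'
    · subst hs
      obtain ⟨δ, hδ, hsub⟩ := D.half_ball_subset_pocket h.pocket hσ hwg hx hwV hcl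
      have eδ : ∀ᶠ c in 𝓝 w, c ∈ Metric.ball w δ := Metric.ball_mem_nhds w hδ
      obtain ⟨c, ⟨hc, hcσ⟩, hcd⟩ := ((mem_closure_iff_frequently.1 hcl').and_eventually eδ).exists
      exact h.pocket.eq_of_mem h'.pocket (hsub ⟨hcd, hcσ⟩) hc
    · obtain ⟨c, ⟨hc, hcσ⟩, hcd⟩ := ((mem_closure_iff_frequently.1 hcl).and_eventually eε).exists
      obtain ⟨c', ⟨hc', hcσ'⟩, hcd'⟩ :=
        ((mem_closure_iff_frequently.1 hcl').and_eventually eε).exists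
      have hcσ1 : 0 < σ * cr x g c := hcσ
      have hcσ1' : 0 < σ' * cr x g c' := hcσ'
      have hv := hcone c (h.pocket.subset hc).1 hcd
      have hv' := hcone c' (h'.pocket.subset hc').1 hcd'
      have hxg1 : x.1 - g.1 ≠ 0 := by
        intro h0
        apply hvx
        rw [ey]; simp only [pt_fst]
        have : g.1 - x.1 = 0 := by linarith
        rw [this]; ring
      have hside : 0 < (x.1 - g.1) * cr x g c ∨ 0 < (x.1 - g.1) * cr x g c' := by
        rcases hσ with rfl | rfl <;> rcases hσ' with rfl | rfl
        · exact absurd rfl hs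
        · rcases lt_or_gt_of_ne hxg1 with hl | hl
          · right; nlinarith
          · left; nlinarith
        · rcases lt_or_gt_of_ne hxg1 with hl | hl
          · left; nlinarith
          · right; nlinarith
        · exact absurd rfl hs
      rcases hside with hh | hh
      · refine h.pocket.eq_of_mem h'.pocket hc (hb' w hw' c hv ?_)
        rw [isBelow_iff hvx', cry']; positivity
      · refine h.pocket.eq_of_mem h'.pocket (hb w hw c' hv' ?_) hc'
        rw [isBelow_iff hvx, cry]; positivity
  have hseg : segment ℝ x y = segment ℝ x y' := by
    rw [← h.eq_segment, ← h'.eq_segment, hCC]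
  have hy'' : y' ∈ segment ℝ x y := by rw [hseg]; exact right_mem_segment ℝ x y'
  obtain ⟨r', r0', r1', eyy'⟩ := mem_segment_iff.1 hy''
  have hrr : r * r' = 1 := by
    by_contra hne
    apply h.ne
    have e1 := congrArg Prod.fst eyy
    have e2 := congrArg Prod.snd eyy
    rw [eyy'] at e1 e2
    simp only [pt_fst, pt_snd] at e1 e2
    have hne' : 1 - r * r' ≠ 0 := fun h0 => hne (by linarith)
    ext
    · have : (1 - r * r') * (y.1 - x.1) = 0 := by linear_combination e1
      have := (mul_eq_zero.1 this).resolve_left hne'; linarith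
    · have : (1 - r * r') * (y.2 - x.2) = 0 := by linear_combination e2
      have := (mul_eq_zero.1 this).resolve_left hne'; linarith
  have : r = 1 := by nlinarith
  rw [eyy, this, pt_one]

/-- By `Dom.not_isBelow` neither foot is below the edge of the other. For the abscissas this means
(x - g)(x - x') ≤ 0 and (x' - g)(x' - x) ≤ 0, and the left sides add up to (x - x')². For a common
foot `Dom.upper_edge_unique_right` applies. -/
theorem Dom.upper_edge_unique (D : Dom P V a b) {g x y x' y' : Pt} {C C' : Set Pt} (hg : g ∈ P)
    (h : SConstructed P g C x y) (hb : SLiesBelow P C x y)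
    (h' : SConstructed P g C' x' y') (hb' : SLiesBelow P C' x' y')
    (hx : x ∈ segment ℝ ((a, 0) : Pt) (b, 0)) (hx' : x' ∈ segment ℝ ((a, 0) : Pt) (b, 0))
    (hx0 : x.2 = 0) (hx0' : x'.2 = 0) (hy : 0 < y.2) (hy' : 0 < y'.2) : x = x' ∧ y = y' := by
  have ho := D.constructed_openSegment hg h hx0 hy
  have ho' := D.constructed_openSegment hg h' hx0' hy'
  have hv := h.not_vertical hb
  have hv' := h'.not_vertical hb'
  have hxx : x' ∈ svis P x := ((convex_segment _ _).segment_subset hx hx').trans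
    D.convex_base_subset
  have n1 := D.not_isBelow h hb (h'.mem_svis (left_mem_segment ℝ x' y')) hxx
    (openSegment_subset_segment ℝ _ _ ho)
  have n2 := D.not_isBelow h' hb' (h.mem_svis (left_mem_segment ℝ x y)) (svis_comm.1 hxx)
    (openSegment_subset_segment ℝ _ _ ho')
  rw [isBelow_iff hv] at n1
  rw [isBelow_iff hv'] at n2
  have e1 : (x.1 - y.1) * cr x y x' = y.2 * ((x.1 - y.1) * (x.1 - x'.1)) := by
    unfold cr; rw [hx0, hx0']; ring
  have e2 : (x'.1 - y'.1) * cr x' y' x = y'.2 * ((x'.1 - y'.1) * (x'.1 - x.1)) := by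
    unfold cr; rw [hx0, hx0']; ring
  rw [e1] at n1
  rw [e2] at n2
  have m1 : (x.1 - y.1) * (x.1 - x'.1) ≤ 0 := by
    by_contra! hc; exact n1 (mul_pos hy hc)
  have m2 : (x'.1 - y'.1) * (x'.1 - x.1) ≤ 0 := by
    by_contra! hc; exact n2 (mul_pos hy' hc)
  obtain ⟨t, t0, t1, ey⟩ := mem_openSegment_iff.1 ho
  obtain ⟨t', t0', t1', ey'⟩ := mem_openSegment_iff.1 ho'
  have f1 : x.1 - y.1 = t * (x.1 - g.1) := by rw [ey]; simp only [pt_fst]; ring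
  have f2 : x'.1 - y'.1 = t' * (x'.1 - g.1) := by rw [ey']; simp only [pt_fst]; ring
  have g1 : x.1 - g.1 ≠ 0 := by
    intro h0; rw [h0, mul_zero] at f1; exact hv (by linarith)
  have g2 : x'.1 - g.1 ≠ 0 := by
    intro h0; rw [h0, mul_zero] at f2; exact hv' (by linarith)
  rw [f1, mul_assoc] at m1
  rw [f2, mul_assoc] at m2
  have m1' : (x.1 - g.1) * (x.1 - x'.1) ≤ 0 := by
    by_contra! hc; exact absurd (mul_pos t0 hc) (by linarith)
  have m2' : (x'.1 - g.1) * (x'.1 - x.1) ≤ 0 := by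
    by_contra! hc; exact absurd (mul_pos t0' hc) (by linarith)
  have hxe : x.1 = x'.1 := by
    have : (x.1 - x'.1) ^ 2 ≤ 0 := by nlinarith
    nlinarith [sq_nonneg (x.1 - x'.1)]
  have hxe' : x = x' := Prod.ext hxe (by rw [hx0, hx0'])
  subst hxe'
  exact ⟨rfl, D.upper_edge_unique_right h hb h' hb' ho ho'⟩

end WVPolygon

namespace WVPolygon

open Filter Topology

variable {P V : Set Pt} {a b : ℝ}

/-! ### Reflection in the vertical axis -/

/-- The reflection in the vertical axis. -/
def mir (p : Pt) : Pt := (-p.1, p.2)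

/-- The mirror image of a set. -/
def mirS (S : Set Pt) : Set Pt := mir ⁻¹' S

@[simp] theorem mir_mir (p : Pt) : mir (mir p) = p := by simp [mir]
@[simp] theorem mirS_mirS (S : Set Pt) : mirS (mirS S) = S := by ext; simp [mirS]
@[simp] theorem mem_mirS {S : Set Pt} {p : Pt} : p ∈ mirS S ↔ mir p ∈ S := Iff.rfl
@[simp] theorem mir_fst (p : Pt) : (mir p).1 = -p.1 := rfl
@[simp] theorem mir_snd (p : Pt) : (mir p).2 = p.2 := rfl
theorem mir_mk (x y : ℝ) : mir (x, y) = (-x, y) := rfl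

theorem continuous_mir : Continuous mir := by unfold mir; fun_prop

theorem mir_injective : Function.Injective mir := Function.LeftInverse.injective mir_mir

/-- The reflection as a homeomorphism. -/
def mirH : Pt ≃ₜ Pt where
  toFun := mir
  invFun := mir
  left_inv := mir_mir
  right_inv := mir_mir
  continuous_toFun := continuous_mir
  continuous_invFun := continuous_mir

theorem image_mir (S : Set Pt) : mir '' S = mirS S := by
  ext p; constructor
  · rintro ⟨q, hq, rfl⟩; simpa
  · intro h; exact ⟨mir p, h, mir_mir p⟩

theorem mir_pt (p q : Pt) (t : ℝ) : mir (pt p q t) = pt (mir p) (mir q) t := by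
  ext <;> simp; ring

theorem dist_mir (p q : Pt) : dist (mir p) (mir q) = dist p q := by
  simp [Prod.dist_eq]

theorem cr_mir (p q r : Pt) : cr (mir p) (mir q) (mir r) = - cr p q r := by simp [cr]; ring

theorem mir_mem_segment {p q r : Pt} : mir r ∈ segment ℝ (mir p) (mir q) ↔ r ∈ segment ℝ p q := by
  simp only [mem_segment_iff, ← mir_pt, mir_injective.eq_iff]

theorem mir_mem_openSegment {p q r : Pt} :
    mir r ∈ openSegment ℝ (mir p) (mir q) ↔ r ∈ openSegment ℝ p q := by
  simp only [mem_openSegment_iff, ← mir_pt, mir_injective.eq_iff]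

theorem mirS_segment (p q : Pt) : mirS (segment ℝ p q) = segment ℝ (mir p) (mir q) := by
  ext r
  rw [mem_mirS, ← mir_mem_segment, mir_mir]

theorem mir_mem_triangle_of {p q r w : Pt} (h : w ∈ triangle p q r) :
    mir w ∈ triangle (mir p) (mir q) (mir r) := by
  obtain ⟨α, β, γ, hα, hβ, hγ, h1, rfl⟩ := mem_triangle_iff.1 h
  refine mem_triangle_iff.2 ⟨α, β, γ, hα, hβ, hγ, h1, ?_⟩
  ext <;> simp; ring

theorem mir_mem_triangle {p q r w : Pt} :
    mir w ∈ triangle (mir p) (mir q) (mir r) ↔ w ∈ triangle p q r :=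
  ⟨fun h => by simpa using mir_mem_triangle_of h, mir_mem_triangle_of⟩

theorem mir_mem_svis {p q : Pt} : mir q ∈ svis (mirS P) (mir p) ↔ q ∈ svis P p := by
  unfold svis
  simp only [mem_ofPred_eq, ← mirS_segment]
  constructor
  · intro h w hw
    have := h (show mir w ∈ mirS (segment ℝ p q) by simpa using hw)
    simpa using this
  · intro h w hw
    exact h hw

theorem svis_mir (p : Pt) : svis (mirS P) (mir p) = mirS (svis P p) := by
  ext q
  rw [mem_mirS, ← mir_mem_svis (P := P), mir_mir]

theorem seesBase_mir {g : Pt} {c : ℝ} :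
    SeesBase (mirS P) (-b) (-a) (mir g) (-c) ↔ SeesBase P a b g c := by
  unfold SeesBase
  rw [show ((-c, 0) : Pt) = mir (c, 0) from rfl, mir_mem_svis]
  constructor
  · rintro ⟨h1, h2, h3⟩; exact ⟨by linarith, by linarith, h3⟩
  · rintro ⟨h1, h2, h3⟩; exact ⟨by linarith, by linarith, h3⟩

theorem isLeftEnd_mir {g : Pt} {c : ℝ} :
    IsLeftEnd (mirS P) (-b) (-a) (mir g) (-c) ↔ IsRightEnd P a b g c := by
  unfold IsLeftEnd IsRightEnd
  rw [seesBase_mir]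
  refine and_congr_right fun _ => ⟨fun h d hd => ?_, fun h d hd => ?_⟩
  · have := h (-d) (seesBase_mir.2 hd); linarith
  · have := h (-d) (by rw [← seesBase_mir, neg_neg]; exact hd); linarith

theorem isRightEnd_mir {g : Pt} {c : ℝ} :
    IsRightEnd (mirS P) (-b) (-a) (mir g) (-c) ↔ IsLeftEnd P a b g c := by
  unfold IsLeftEnd IsRightEnd
  rw [seesBase_mir]
  refine and_congr_right fun _ => ⟨fun h d hd => ?_, fun h d hd => ?_⟩
  · have := h (-d) (seesBase_mir.2 hd); linarith
  · have := h (-d) (by rw [← seesBase_mir, neg_neg]; exact hd); linarith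

/-- The reflection exchanges left and right but preserves being below, so each one-sided argument
serves for both sides. -/
theorem Dom.mirror (D : Dom P V a b) : Dom (mirS P) (mirS V) (-b) (-a) where
  compact := by rw [← image_mir]; exact D.compact.image continuous_mir
  finite := by rw [← image_mir]; exact D.finite.image _
  filled := by
    intro k hk
    obtain ⟨T, h1, h2, h3, h4⟩ := D.filled (mir k) hk
    refine ⟨mirS T, h1, ?_, ?_, ?_⟩
    · rw [← image_mir]; exact h2.image _ continuous_mir.continuousOn
    · intro hb
      apply h3
      obtain ⟨R, hR⟩ := hb.exists_norm_le
      refine (Metric.isBounded_closedBall (x := (0 : Pt)) (r := R)).subset fun w hw => ?_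
      rw [mem_closedBall_zero_iff]
      have := hR (mir w) (by simpa using hw)
      have e : ‖mir w‖ = ‖w‖ := by simp [Prod.norm_def]
      rwa [e] at this
    · rw [Set.disjoint_left] at h4 ⊢
      exact fun w hw hwP => h4 hw hwP
  upper := fun z hz => D.upper (mir z) hz
  lt := by linarith [D.lt]
  base := by
    intro c h1 h2
    exact D.base (-c) (by linarith) (by linarith)
  left_mem := by simpa [mir] using D.right_mem
  right_mem := by simpa [mir] using D.left_mem
  weak := by
    intro z hz
    obtain ⟨c, h1, h2, h3⟩ := D.weak (mir z) hz
    refine ⟨-c, by linarith, by linarith, ?_⟩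
    have := mir_mem_svis.2 h3
    rwa [mir_mir] at this
  cone := by
    intro q
    obtain ⟨ε, hε, h⟩ := D.cone (mir q)
    refine ⟨ε, hε, fun w hw t h0 h1 => ?_⟩
    have := h (mir w) (by rwa [dist_mir]) t h0 h1
    rw [← mir_pt] at this
    exact this
  line := by
    intro q hq
    obtain ⟨ε, hε, n, hn, h⟩ := D.line (mir q) hq
    refine ⟨ε, hε, mir n, ?_, ?_⟩
    · intro h0; apply hn; rw [← mir_mir n, h0]; ext <;> simp
    · intro w w' hw hw' hp
      refine h (mir w) (mir w') (by rwa [dist_mir]) (by rwa [dist_mir]) ?_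
      simp only [mir_fst, mir_snd] at hp ⊢
      convert hp using 1; ring

theorem SPocket.mirror {g : Pt} {C : Set Pt} (h : SPocket P g C) :
    SPocket (mirS P) (mir g) (mirS C) := by
  obtain ⟨z, hz, rfl⟩ := h
  have e : mirS P \ svis (mirS P) (mir g) = mir '' (P \ svis P g) := by
    rw [svis_mir, image_mir]; rfl
  refine ⟨mir z, ?_, ?_⟩
  · rw [e]; exact mem_image_of_mem _ hz
  · rw [e, ← image_mir]
    exact mirH.image_connectedComponentIn hz

theorem closure_mirS (S : Set Pt) : closure (mirS S) = mirS (closure S) :=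
  (mirH.preimage_closure S).symm

theorem SConstructed.mirror {g x y : Pt} {C : Set Pt} (h : SConstructed P g C x y) :
    SConstructed (mirS P) (mir g) (mirS C) (mir x) (mir y) where
  pocket := h.pocket.mirror
  ne := fun e => h.ne (mir_injective e)
  le := h.le
  eq_segment := by
    rw [closure_mirS, svis_mir, ← mirS_segment, ← h.eq_segment]; rfl

theorem isBelow_mir {x y z : Pt} : IsBelow (mir x) (mir y) (mir z) ↔ IsBelow x y z := by
  unfold IsBelow
  by_cases h : x = y
  · subst h
    simp only [mem_affineSpan_pair_iff_exists_lineMap_eq, lineMap_eq_pt, ← mir_pt]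
    refine exists_congr fun t => and_congr_right fun _ => exists_congr fun r => ?_
    rw [show ((mir z).1, (mir z).2 + t) = mir (z.1, z.2 + t) from rfl, mir_injective.eq_iff]
  · have h' : mir x ≠ mir y := fun e => h (mir_injective e)
    refine exists_congr fun t => and_congr_right fun _ => ?_
    rw [mem_line_iff h, mem_line_iff h', show ((mir z).1, (mir z).2 + t) = mir (z.1, z.2 + t) from
      rfl, cr_mir, neg_eq_zero]

theorem SLiesBelow.mirror {x y : Pt} {C : Set Pt} (h : SLiesBelow P C x y) :
    SLiesBelow (mirS P) (mirS C) (mir x) (mir y) := by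
  intro w hw q hq hb
  rw [← mir_mir w, mir_mem_openSegment] at hw
  rw [← mir_mir w, ← mir_mir q, mir_mem_svis] at hq
  rw [← mir_mir q, isBelow_mir] at hb
  exact h _ hw _ hq hb

end WVPolygon

/-! ### Prolonged sight lines from the base through an unseen point -/

namespace WVPolygon

open Filter Topology

variable {P V : Set Pt} {a b : ℝ}

theorem pt_mem_segment_pt {p q : Pt} {r s t : ℝ} (h1 : r ≤ s) (h2 : s ≤ t) :
    pt p q s ∈ segment ℝ (pt p q r) (pt p q t) := by
  rcases eq_or_lt_of_le (h1.trans h2) with h | h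
  · have : s = r := le_antisymm (by rw [h]; exact h2) h1
    rw [this]; exact left_mem_segment _ _ _
  · obtain ⟨d, hd⟩ : ∃ d, d = t - r := ⟨_, rfl⟩
    have hd0 : 0 < d := by linarith
    have ht : t = r + d := by linarith
    refine mem_segment_iff.2 ⟨(s - r) / d, div_nonneg (by linarith) hd0.le, ?_, ?_⟩
    · rw [div_le_one hd0]; linarith
    · rw [ht]; ext <;> simp <;> field_simp <;> ring

theorem IsArg.abs_lt {k : Pt} {θ : Pt → ℝ} (h : IsArg P k θ) {p q : Pt} (hpq : q ∈ svis P p) :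
    -Real.pi < θ q - θ p ∧ θ q - θ p < Real.pi := by
  have hpi := Real.pi_pos
  have s := h.segment hpq
  rcases lt_trichotomy (cr k p q) 0 with hc | hc | hc
  · have := s.2.1 hc; exact ⟨this.1, by linarith⟩
  · have := s.2.2 hc; rw [this]; constructor <;> linarith
  · have := s.1 hc; exact ⟨by linarith, this.2⟩

/-- A point that sees the end of a sight line from the base and a base point to the right of it, but
not the middle of the line, lies to the left of the line. -/
theorem Dom.left_of_sight_line (D : Dom P V a b) {g z e : Pt} {c x t : ℝ} (hg : g ∈ P)
    (hcx : c < x) (hX : ((x, 0) : Pt) ∈ svis P g) (ha : a ≤ c) (hb : x ≤ b)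
    (he : e ∈ svis P (c, 0)) (hge : e ∈ svis P g) (he0 : 0 < e.2) (hz : z = pt (c, 0) e t)
    (t0 : 0 < t) (t1 : t < 1) (hgz : z ∉ svis P g) : 0 < cr (c, 0) e g := by
  by_contra! hle
  have hz0 : 0 < z.2 := by rw [hz]; simp; positivity
  have hg0 := D.upper g hg
  rcases eq_or_lt_of_le hle with h0 | hneg
  · -- `g` lies on the line
    have eg : g = pt (c, 0) e (g.2 / e.2) := by
      unfold cr at h0
      ext
      · simp at h0 ⊢; field_simp; linarith
      · simp; field_simp
    have hs0 : 0 ≤ g.2 / e.2 := by positivity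
    rcases le_total (g.2 / e.2) 1 with h1 | h1
    · apply hgz
      refine ((convex_segment ((c, 0) : Pt) e).segment_subset ?_ ?_).trans he
      · rw [eg]; exact pt_mem_segment hs0 h1
      · rw [hz]; exact pt_mem_segment t0.le t1.le
    · apply hgz
      have hcg : ((c, 0) : Pt) ∈ svis P g := by
        intro w hw
        rw [segment_symm] at hw
        obtain ⟨r, r0, r1, rfl⟩ := mem_segment_iff.1 hw
        rcases le_total (r * (g.2 / e.2)) 1 with hr | hr
        · apply he
          refine mem_segment_iff.2 ⟨r * (g.2 / e.2), by positivity, hr, ?_⟩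
          rw [eg]; ext <;> simp <;> field_simp
        · apply hge
          rw [segment_symm]
          have hG : 0 < g.2 := by
            by_contra! h
            have : g.2 = 0 := le_antisymm h hg0
            rw [this] at h1; norm_num at h1
          rcases eq_or_lt_of_le h1 with h1' | h1'
          · have : g = e := by rw [eg, ← h1', pt_one]
            have hr1 : r = 1 := by rw [← h1'] at hr; linarith
            rw [this, hr1, pt_one]; exact left_mem_segment _ _ _
          · have hd : 0 < g.2 / e.2 - 1 := by linarith
            have hd' : 0 < g.2 - e.2 := by
              rw [lt_div_iff₀ he0] at h1'; linarith
            refine mem_segment_iff.2 ⟨(r * (g.2 / e.2) - 1) / (g.2 / e.2 - 1),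
              div_nonneg (by linarith) hd.le, ?_, ?_⟩
            · rw [div_le_one hd]; nlinarith
            · have e1 : g.1 = c + (g.2 / e.2) * (e.1 - c) := congrArg Prod.fst eg
              have hd2 := hd.ne'
              set m := g.2 / e.2 with hm
              have e2 : g.2 = m * e.2 := by rw [hm]; field_simp
              ext
              · simp only [pt_fst]; rw [e1]; field_simp; ring
              · simp only [pt_snd]; rw [e2]; field_simp; ring
      refine mem_svis_of_mem_segment hcg ?_
      rw [segment_symm, eg]
      refine mem_segment_iff.2 ⟨t / (g.2 / e.2), by positivity, ?_, ?_⟩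
      · rw [div_le_one (by linarith)]; linarith
      · have : g.2 / e.2 ≠ 0 := by linarith
        have hG : g.2 ≠ 0 := by intro h; rw [h] at this; simp at this
        rw [hz]; ext <;> simp <;> field_simp
  · -- `g` lies strictly to the right of the line
    obtain ⟨k, hk, hkP⟩ := Set.not_subset.1 hgz
    obtain ⟨s, s0, s1, ek⟩ := mem_segment_iff.1 hk
    obtain ⟨θ, hθ⟩ := D.exists_isArg hkP
    have hzP : z ∈ P := he (by rw [hz]; exact pt_mem_segment t0.le t1.le)
    have s0' : 0 < s := by
      rcases eq_or_lt_of_le s0 with h | h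
      · exact absurd (by rw [ek, ← h, pt_zero]; exact hg) hkP
      · exact h
    have s1' : s < 1 := by
      rcases eq_or_lt_of_le s1 with h | h
      · exact absurd (by rw [ek, h, pt_one]; exact hzP) hkP
      · exact h
    have hk0 : 0 < k.2 := by
      have : k.2 = (1 - s) * g.2 + s * z.2 := by rw [ek]; simp; ring
      rw [this]
      have := mul_pos s0' hz0
      have := mul_nonneg (show 0 ≤ 1 - s by linarith) hg0
      linarith
    have c1 : cr k (c, 0) (x, 0) = (x - c) * k.2 := by simp [cr]; ring
    have c2 : cr k g e = -(s * (1 - t) * cr (c, 0) e g) := by rw [ek, hz]; simp [cr]; ring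
    have c3 : cr k e (c, 0) = -((1 - s) * cr (c, 0) e g) := by rw [ek, hz]; simp [cr]; ring
    have c4 : cr k g (c, 0) = s * t * cr (c, 0) e g := by rw [ek, hz]; simp [cr]; ring
    have p1 := (hθ.segment (D.base_segment ha (by linarith) (by linarith) hb :
      ((x, 0) : Pt) ∈ svis P (c, 0))).1 (by rw [c1]; exact mul_pos (by linarith) hk0)
    have p2 := (hθ.segment hge).1 (by
      rw [c2]; have := mul_pos s0' (show 0 < 1 - t by linarith); nlinarith)
    have p3 := (hθ.segment (svis_comm.1 he)).1 (by
      rw [c3]; nlinarith [mul_pos (show 0 < 1 - s by linarith) (neg_pos.2 hneg)])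
    have p4 := (hθ.abs_lt hX)
    -- From g over e to (c, 0) the argument about k increases, and the orientation of k, g, (c, 0)
    -- makes the increase exceed π. But from g to (x, 0) it grows by less than π, and from there to
    -- (c, 0) it decreases.
    obtain ⟨r, hr, hsin⟩ := hθ.sin_sub hg (he (left_mem_segment ℝ _ _))
    rw [c4] at hsin
    have hneg' : Real.sin (θ (c, 0) - θ g) < 0 := by
      have h1 : s * t * cr (c, 0) e g < 0 := mul_neg_of_pos_of_neg (by positivity) hneg
      rw [hsin] at h1
      by_contra! h
      have := mul_nonneg hr.le h
      linarith
    have : Real.pi < θ (c, 0) - θ g := by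
      by_contra! h
      have := Real.sin_nonneg_of_nonneg_of_le_pi (by linarith) h
      linarith
    linarith

/-- The leftmost sight line of a point to the left of a sight line from the base. -/
theorem Dom.sight_line_crossing (D : Dom P V a b) {g z : Pt} {c x s : ℝ} (hg : g ∈ P)
    (ha : a ≤ c) (hcx : c < x) (hx : IsLeftEnd P a b g x) (hs : 1 ≤ s)
    (he : pt (c, 0) z s ∈ svis P (c, 0)) (hge : pt (c, 0) z s ∈ svis P g) (hz0 : 0 < z.2)
    (hgz : z ∉ svis P g) :
    0 < cr (c, 0) z g ∧ ∃ ρ, 1 < ρ ∧ pt (c, 0) z ρ ∈ segment ℝ ((x, 0) : Pt) g ∧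
      pt (c, 0) z ρ ∈ svis P (c, 0) := by
  set e := pt (c, 0) z s with hedef
  have s1 : 1 < s := by
    rcases eq_or_lt_of_le hs with h | h
    · exfalso; apply hgz; rw [hedef, ← h, pt_one] at hge; exact hge
    · exact h
  have he0 : 0 < e.2 := by rw [hedef]; simp; positivity
  have hz : z = pt (c, 0) e (1 / s) := by
    rw [hedef]
    ext <;> simp <;> field_simp
    ring
  have hb := hx.1.2.1
  have hX := hx.1.2.2
  have hnc : ((c, 0) : Pt) ∉ svis P g := by
    intro h
    have := hx.2 c ⟨ha, by linarith, h⟩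
    linarith
  have hleft := D.left_of_sight_line hg hcx hX ha hb he hge he0 hz (by positivity)
    (by rw [div_lt_one (by linarith)]; exact s1) hgz
  have hcz : cr (c, 0) e g = s * cr (c, 0) z g := by rw [hedef]; simp [cr]; ring
  refine ⟨?_, ?_⟩
  · rw [hcz] at hleft
    exact (pos_iff_pos_of_mul_pos hleft).1 (by linarith)
  have hg0' := D.upper g hg
  -- On the axis g would be to the left of c, and the segment to (x, 0) would pass through (c, 0).
  have hg0 : 0 < g.2 := by
    rcases eq_or_lt_of_le hg0' with h | h
    · exfalso; apply hnc
      have : cr (c, 0) e g = e.2 * (c - g.1) := by unfold cr; rw [← h]; simp; ring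
      rw [this] at hleft
      have hgc : 0 < c - g.1 := (pos_iff_pos_of_mul_pos hleft).1 he0
      refine mem_svis_of_mem_segment hX (mem_segment_iff.2
        ⟨(c - g.1) / (x - g.1), div_nonneg hgc.le (by linarith), ?_, ?_⟩)
      · rw [div_le_one (by linarith)]; linarith
      · have : x - g.1 ≠ 0 := by linarith
        ext
        · simp; field_simp; ring
        · simp [← h]
    · exact h
  have hxc : 0 < x - c := by linarith
  -- the end of the sight line is not below the leftmost sight line of `g`
  have hA : cr (x, 0) g e ≤ 0 := by
    by_contra! hpos
    have i1 : cr (c, 0) (x, 0) g = (x - c) * g.2 := by simp [cr]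
    set Δ := (x - c) * g.2 with hΔ
    have hΔ0 : 0 < Δ := by positivity
    -- `α`, `β` and 1 - `ν` are the barycentric coordinates of e with respect to (c, 0), (x, 0) and
    -- g. The line from g through e meets the base in (n, 0) with c < n < x.
    set α := cr (x, 0) g e / Δ with hα
    set β := cr (c, 0) e g / Δ with hβ
    have α0 : 0 < α := by positivity
    have β0 : 0 < β := by positivity
    have hsum : cr (x, 0) g e + cr (c, 0) e g + (x - c) * e.2 = Δ := by
      rw [hΔ]; simp [cr]; ring
    have hν : α + β = 1 - e.2 / g.2 := by
      rw [hα, hβ]; field_simp; rw [hΔ] at hsum ⊢; field_simp; nlinarith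
    set ν := α + β with hνd
    have ν0 : 0 < ν := by positivity
    have ν1 : ν < 1 := by rw [hν]; have : 0 < e.2 / g.2 := by positivity
                          linarith
    set n := (α * c + β * x) / ν with hn
    have hxn : x - n = α * (x - c) / ν := by rw [hn, hνd]; field_simp; ring
    have hnc' : n - c = β * (x - c) / ν := by rw [hn, hνd]; field_simp; ring
    have hnx : 0 < x - n := by rw [hxn]; positivity
    have hcn : 0 < n - c := by rw [hnc']; positivity
    have een : e = pt g (n, 0) ν := by
      have e1 : e.1 = α * c + β * x + (1 - ν) * g.1 := by
        have hα' : α * Δ = cr (x, 0) g e := by rw [hα]; field_simp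
        have hβ' : β * Δ = cr (c, 0) e g := by rw [hβ]; field_simp
        have : (e.1 - (α * c + β * x + (1 - ν) * g.1)) * Δ = 0 := by
          have hν' : (1 - ν) * Δ = (x - c) * e.2 := by
            rw [hνd]; linear_combination -hsum + -hα' + -hβ' 
          have hα2 := hα'
          have hβ2 := hβ'
          simp only [cr] at hα2 hβ2
          linear_combination (-c) * hα2 + (-x) * hβ2 + (-g.1) * hν' + e.1 * hΔ
        have := (mul_eq_zero.1 this).resolve_right hΔ0.ne'
        linarith
      have e2 : e.2 = (1 - ν) * g.2 := by rw [hν]; field_simp; ring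
      ext
      · simp; rw [e1, hn]; field_simp; ring
      · simp; rw [e2]; ring
    have hsee : SeesBase P a b g n := by
      refine ⟨by linarith, by linarith, fun k hk => ?_⟩
      by_contra hkP
      obtain ⟨μ, μ0, μ1, ek⟩ := mem_segment_iff.1 hk
      rcases le_or_gt μ ν with hμ | hμ
      · apply hkP; apply hge
        refine mem_segment_iff.2 ⟨μ / ν, by positivity, (div_le_one ν0).2 hμ, ?_⟩
        rw [ek, een]; ext <;> simp <;> field_simp
      · have μ1' : μ < 1 := by
          rcases eq_or_lt_of_le μ1 with h | h
          · exact absurd (by rw [ek, h, pt_one]; exact D.base n (by linarith) (by linarith)) hkP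
          · exact h
        -- A missing point k between e and (n, 0) would be encircled by (c, 0), (x, 0), g, e: the
        -- argument never decreases along this circuit and increases on three of its sides. So g
        -- sees n, to the left of its leftmost visible base point.
        obtain ⟨θ, hθ⟩ := D.exists_isArg hkP
        have hk2 : k.2 = (1 - μ) * g.2 := by rw [ek]; simp; ring
        have c1 : cr k (c, 0) (x, 0) = (x - c) * k.2 := by simp [cr]; ring
        have c2 : cr k (x, 0) g = μ * (g.2 * (x - n)) := by rw [ek]; simp [cr]; ring
        have c3 : cr k g e = 0 := by rw [ek, een]; simp [cr]; ring
        have c4 : cr k e (c, 0) = (μ - ν) * g.2 * (n - c) := by rw [ek, een]; simp [cr]; ring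
        have p1 := (hθ.segment (D.base_segment ha (by linarith) (by linarith) hb :
          ((x, 0) : Pt) ∈ svis P (c, 0))).1
            (by rw [c1, hk2]; exact mul_pos hxc (mul_pos (by linarith) hg0))
        have p2 := (hθ.segment (svis_comm.1 hX)).1
          (by rw [c2]; exact mul_pos (by linarith) (mul_pos hg0 hnx))
        have p3 := (hθ.segment hge).2.2 c3
        have p4 := (hθ.segment (svis_comm.1 he)).1
          (by rw [c4]; exact mul_pos (mul_pos (by linarith) hg0) hcn)
        linarith
    have := hx.2 n hsee
    linarith
  -- the crossing point
  have hcX : cr (c, 0) e (x, 0) = -(e.2 * (x - c)) := by simp [cr]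
  have hden : 0 < cr (c, 0) e g + e.2 * (x - c) := by positivity
  set κ := e.2 * (x - c) / (cr (c, 0) e g + e.2 * (x - c)) with hκ
  have κ0 : 0 < κ := by positivity
  have κ1 : κ ≤ 1 := by rw [hκ, div_le_one hden]; linarith
  set q := pt (x, 0) g κ with hq
  have hq0 : q.2 = κ * g.2 := by rw [hq]; simp
  have hcq : cr (c, 0) e q = 0 := by
    rw [hq, cr_pt, hcX, hκ]; field_simp; ring
  set τ := q.2 / e.2 with hτ
  have τ0 : 0 < τ := by rw [hτ, hq0]; positivity
  have eq' : q = pt (c, 0) e τ := by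
    unfold cr at hcq
    ext
    · simp at hcq ⊢; rw [hτ]; field_simp; linarith
    · simp; rw [hτ]; field_simp
  have hqX : cr (x, 0) g q = 0 := by rw [hq]; exact cr_pt_self _ _ _
  have hXC : cr (x, 0) g (c, 0) = g.2 * (x - c) := by simp [cr]; ring
  have τ1 : τ ≤ 1 := by
    by_contra! h
    rw [eq', cr_pt, hXC] at hqX
    have h1 : 0 < (τ - 1) * (g.2 * (x - c)) := by
      have := mul_pos hg0 hxc
      exact mul_pos (by linarith) this
    have h2 : τ * cr (x, 0) g e ≤ 0 := mul_nonpos_of_nonneg_of_nonpos τ0.le hA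
    linarith
  have hqC : q ∈ svis P (c, 0) := by
    refine mem_svis_of_mem_segment he ?_
    rw [eq']; exact pt_mem_segment τ0.le τ1
  have hqs : q ∈ segment ℝ ((x, 0) : Pt) g := pt_mem_segment κ0.le κ1
  have hqz : q = pt (c, 0) z (τ * s) := by
    rw [eq', hedef]; ext <;> simp <;> ring
  refine ⟨τ * s, ?_, by rw [← hqz]; exact hqs, by rw [← hqz]; exact hqC⟩
  -- If the crossing q were not beyond z, then z would lie on the segment from q to e, whose ends g
  -- sees.
  by_contra! hle
  apply hgz
  have hqg : q ∈ svis P g := mem_svis_of_mem_segment hX (by rwa [segment_symm])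
  have hqe : e ∈ svis P q := by
    refine ((convex_segment ((c, 0) : Pt) e).segment_subset ?_ (right_mem_segment _ _ _)).trans he
    rw [eq']; exact pt_mem_segment τ0.le τ1
  refine D.svis_of_mem_segment hqg hqe hge ?_
  rw [hqz, hedef]
  have := pt_mem_segment_pt (p := (c, 0)) (q := z) hle hs
  rwa [pt_one] at this

end WVPolygon

/-! ### Pairs of extreme sight lines around an unseen point -/

namespace WVPolygon

open Filter Topology

variable {P V : Set Pt} {a b : ℝ}

theorem Dom.sight_line_crossing' (D : Dom P V a b) {g z : Pt} {c x s : ℝ} (hg : g ∈ P)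
    (hb : c ≤ b) (hcx : x < c) (hx : IsRightEnd P a b g x) (hs : 1 ≤ s)
    (he : pt (c, 0) z s ∈ svis P (c, 0)) (hge : pt (c, 0) z s ∈ svis P g) (hz0 : 0 < z.2)
    (hgz : z ∉ svis P g) :
    cr (c, 0) z g < 0 ∧ ∃ ρ, 1 < ρ ∧ pt (c, 0) z ρ ∈ segment ℝ ((x, 0) : Pt) g ∧
      pt (c, 0) z ρ ∈ svis P (c, 0) := by
  have hpt : ∀ r, pt (-c, 0) (mir z) r = mir (pt (c, 0) z r) := by
    intro r; rw [mir_pt]; rfl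
  have h := D.mirror.sight_line_crossing (g := mir g) (z := mir z) (c := -c) (x := -x) (s := s)
    (by simpa using hg) (by linarith) (by linarith) (isLeftEnd_mir.2 hx) hs
    (by rw [hpt, ← mir_mk, mir_mem_svis]; exact he) (by rw [hpt, mir_mem_svis]; exact hge)
    hz0 (by rw [mir_mem_svis]; exact hgz)
  rw [← mir_mk, cr_mir] at h
  obtain ⟨h1, ρ, hρ, h2, h3⟩ := h
  refine ⟨by linarith, ρ, hρ, ?_, ?_⟩
  · rw [← mir_pt, ← mir_mk x, mir_mem_segment] at h2; exact h2
  · rw [← mir_pt, mir_mem_svis] at h3; exact h3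

/-- The leftmost sight line of `g₁` and the rightmost sight line of `g₂` meet in `p`, and form a
triangle with the base that contains `z`. -/
structure IsPair (P : Set Pt) (a b : ℝ) (z g₁ g₂ : Pt) (x₁ x₂ : ℝ) (p : Pt) : Prop where
  left : IsLeftEnd P a b g₁ x₁
  right : IsRightEnd P a b g₂ x₂
  lt : x₂ < x₁
  mem₁ : p ∈ segment ℝ ((x₁, 0) : Pt) g₁
  mem₂ : p ∈ segment ℝ ((x₂, 0) : Pt) g₂
  mem : z ∈ triangle (x₁, 0) p (x₂, 0)

theorem IsPair.mirror {z g₁ g₂ : Pt} {x₁ x₂ : ℝ} {p : Pt} (h : IsPair P a b z g₁ g₂ x₁ x₂ p) :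
    IsPair (mirS P) (-b) (-a) (mir z) (mir g₂) (mir g₁) (-x₂) (-x₁) (mir p) where
  left := isLeftEnd_mir.2 h.right
  right := isRightEnd_mir.2 h.left
  lt := by linarith [h.lt]
  mem₁ := by rw [← mir_mk, mir_mem_segment]; exact h.mem₂
  mem₂ := by rw [← mir_mk, mir_mem_segment]; exact h.mem₁
  mem := by rw [← mir_mk, ← mir_mk, mir_mem_triangle, triangle_reverse]; exact h.mem

/-- The point g₁ must be to the left of the sight line of g₂: otherwise it would lie in the triangle
(x₂, 0), (c, 0), q₂, a part of P, and would see c. As q₁ is not to the left, the segment from q₁ to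
g₁ meets the sight line of g₂, at or below q₂. -/
theorem Dom.isPair_of_le (D : Dom P V a b) {z g₁ g₂ : Pt} {c x₁ x₂ ρ₁ ρ₂ : ℝ}
    (hz0 : 0 < z.2) (hg₁ : g₁ ∈ P)
    (h₁ : IsLeftEnd P a b g₁ x₁) (hc₁ : c < x₁) (hcr₁ : 0 < cr (c, 0) z g₁) (hρ₁ : 1 < ρ₁)
    (hq₁ : pt (c, 0) z ρ₁ ∈ segment ℝ ((x₁, 0) : Pt) g₁)
    (h₂ : IsRightEnd P a b g₂ x₂) (hc₂ : x₂ < c)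
    (hq₂ : pt (c, 0) z ρ₂ ∈ segment ℝ ((x₂, 0) : Pt) g₂)
    (hv₂ : pt (c, 0) z ρ₂ ∈ svis P (c, 0)) (hle : ρ₁ ≤ ρ₂) :
    ∃ p, IsPair P a b z g₁ g₂ x₁ x₂ p := by
  have ha := h₂.1.1
  have hb := h₁.1.2.1
  set q₁ := pt (c, 0) z ρ₁ with hq1
  set q₂ := pt (c, 0) z ρ₂ with hq2
  have hρ₂ : 0 < ρ₂ := by linarith
  have hq₂0 : 0 < q₂.2 := by rw [hq2]; simp; positivity
  have hq₁0 : 0 < q₁.2 := by rw [hq1]; simp; positivity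
  have hg0 := D.upper g₁ hg₁
  have e1 : q₁ = pt (c, 0) q₂ (ρ₁ / ρ₂) := by
    rw [hq1, hq2]; ext <;> simp <;> field_simp
  have hT : triangle (x₂, 0) (c, 0) q₂ ⊆ P := D.triangle_subset
    (D.base_segment ha (by linarith) (by linarith) (by linarith)) hv₂
    ((segment_subset_left hq₂).trans (by rw [segment_symm]; exact h₂.1.2.2))
  have hD : cr (x₂, 0) (c, 0) q₂ = (c - x₂) * q₂.2 := by simp [cr]
  have hDpos : 0 < cr (x₂, 0) (c, 0) q₂ := by rw [hD]; exact mul_pos (by linarith) hq₂0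
  have hC : cr (c, 0) q₂ g₁ = ρ₂ * cr (c, 0) z g₁ := by rw [hq2]; simp [cr]; ring
  have hB : 0 < cr (x₂, 0) q₂ g₁ := by
    by_contra! hneg
    have hmem : g₁ ∈ triangle (x₂, 0) (c, 0) q₂ := by
      refine mem_triangle_of_cr hDpos ?_ ?_ ?_
      · have : cr (x₂, 0) (c, 0) g₁ = (c - x₂) * g₁.2 := by simp [cr]
        rw [this]; exact mul_nonneg (by linarith) hg0
      · rw [hC]; positivity
      · rw [cr_swap]; linarith
    have := h₁.2 c ⟨by linarith, by linarith,
      ((convex_triangle _ _ _).segment_subset hmem (mid_mem_triangle _ _ _)).trans hT⟩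
    linarith
  have hA : cr (x₂, 0) q₂ q₁ ≤ 0 := by
    have : cr (x₂, 0) q₂ q₁ = -((1 - ρ₁ / ρ₂) * ((c - x₂) * q₂.2)) := by
      rw [e1]; simp [cr]; ring
    rw [this]
    have h1 : ρ₁ / ρ₂ ≤ 1 := (div_le_one hρ₂).2 hle
    have : 0 ≤ (1 - ρ₁ / ρ₂) * ((c - x₂) * q₂.2) :=
      mul_nonneg (by linarith) (mul_nonneg (by linarith) hq₂0.le)
    linarith
  set A := cr (x₂, 0) q₂ q₁ with hAd
  set B := cr (x₂, 0) q₂ g₁ with hBd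
  have hBA : 0 < B - A := by linarith
  set lam := -A / (B - A) with hlam
  have l0 : 0 ≤ lam := div_nonneg (by linarith) hBA.le
  have l1 : lam < 1 := by rw [hlam, div_lt_one hBA]; linarith
  set p := pt q₁ g₁ lam with hp
  have hp0 : 0 < p.2 := by
    have : p.2 = (1 - lam) * q₁.2 + lam * g₁.2 := by rw [hp]; simp; ring
    rw [this]
    have := mul_pos (show 0 < 1 - lam by linarith) hq₁0
    have := mul_nonneg l0 hg0
    linarith
  have hpA : cr (x₂, 0) q₂ p = 0 := by
    rw [hp, cr_pt, ← hAd, ← hBd, hlam]; field_simp; ring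
  have hpC : 0 ≤ cr (c, 0) q₂ p := by
    have z1 : cr (c, 0) q₂ q₁ = 0 := by rw [e1]; exact cr_pt_self _ _ _
    rw [hp, cr_pt, z1, hC]
    have := mul_nonneg l0 (mul_pos hρ₂ hcr₁).le
    linarith
  set τ := p.2 / q₂.2 with hτ
  have epτ : p = pt (x₂, 0) q₂ τ := by
    unfold cr at hpA
    ext
    · simp at hpA ⊢; rw [hτ]; field_simp; linarith
    · simp; rw [hτ]; field_simp
  have τ1 : τ ≤ 1 := by
    by_contra! h
    rw [epτ, cr_pt] at hpC
    have z1 : cr (c, 0) q₂ q₂ = 0 := by unfold cr; ring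
    have z2 : cr (c, 0) q₂ (x₂, 0) = cr (x₂, 0) (c, 0) q₂ := by unfold cr; ring
    rw [z1, z2] at hpC
    nlinarith
  obtain ⟨κ, κ0, κ1, eκ⟩ := mem_segment_iff.1 hq₁
  have epκ : p = pt (x₁, 0) g₁ (κ + lam * (1 - κ)) := by
    rw [hp, eκ]; ext <;> simp <;> ring
  have hlk : 0 ≤ lam * (1 - κ) := mul_nonneg l0 (by linarith)
  refine ⟨p, h₁, h₂, by linarith, ?_, ?_, ?_⟩
  · rw [epκ]; exact pt_mem_segment (by linarith) (by nlinarith)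
  · refine (segment_subset_left hq₂) ?_
    rw [epτ]; exact pt_mem_segment (by positivity) τ1
  · have hTc := convex_triangle (x₁, 0) p (x₂, 0)
    have m1 : q₁ ∈ triangle (x₁, 0) p (x₂, 0) := by
      refine hTc.segment_subset (left_mem_triangle _ _ _) (mid_mem_triangle _ _ _) ?_
      have := pt_mem_segment_pt (p := (x₁, 0)) (q := g₁) κ0
        (show κ ≤ κ + lam * (1 - κ) by linarith)
      rwa [pt_zero, ← epκ, ← eκ] at this
    have m2 : ((c, 0) : Pt) ∈ triangle (x₁, 0) p (x₂, 0) := by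
      refine hTc.segment_subset (left_mem_triangle _ _ _) (right_mem_triangle _ _ _) ?_
      have hd : 0 < x₁ - x₂ := by linarith
      refine mem_segment_iff.2 ⟨(x₁ - c) / (x₁ - x₂), div_nonneg (by linarith) hd.le, ?_, ?_⟩
      · rw [div_le_one hd]; linarith
      · ext
        · simp; field_simp; ring
        · simp
    refine hTc.segment_subset m2 m1 ?_
    have := pt_mem_segment_pt (p := (c, 0)) (q := z) zero_le_one hρ₁.le
    rwa [pt_zero, pt_one] at this

/-- Otherwise g would see both ends of a segment of P that contains z. -/
theorem Dom.not_seesBase (D : Dom P V a b) {g z : Pt} {c s : ℝ} (hs : 1 ≤ s)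
    (he : pt (c, 0) z s ∈ svis P (c, 0)) (hge : pt (c, 0) z s ∈ svis P g) (hgz : z ∉ svis P g) :
    ¬ SeesBase P a b g c := by
  intro h
  apply hgz
  refine D.svis_of_mem_segment h.2.2 he hge ?_
  have := pt_mem_segment_pt (p := (c, 0)) (q := z) zero_le_one hs
  rwa [pt_zero, pt_one] at this

/-- Both extreme sight lines cross the prolonged line c z beyond z. The order of the two crossings
decides whether `Dom.isPair_of_le` is applied directly or to the mirror image. -/
theorem Dom.exists_isPair_of_sight_line (D : Dom P V a b) {z g₁ g₂ : Pt} {c x₁ x₂ s₁ s₂ : ℝ}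
    (hz0 : 0 < z.2) (hg₁ : g₁ ∈ P) (hg₂ : g₂ ∈ P) (ha : a ≤ c) (hb : c ≤ b)
    (hz₁ : z ∉ svis P g₁) (hz₂ : z ∉ svis P g₂)
    (h₁ : IsLeftEnd P a b g₁ x₁) (hc₁ : c < x₁) (h₂ : IsRightEnd P a b g₂ x₂) (hc₂ : x₂ < c)
    (hs₁ : 1 ≤ s₁) (he₁ : pt (c, 0) z s₁ ∈ svis P (c, 0)) (hge₁ : pt (c, 0) z s₁ ∈ svis P g₁)
    (hs₂ : 1 ≤ s₂) (he₂ : pt (c, 0) z s₂ ∈ svis P (c, 0)) (hge₂ : pt (c, 0) z s₂ ∈ svis P g₂) :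
    ∃ p, IsPair P a b z g₁ g₂ x₁ x₂ p := by
  obtain ⟨r1, ρ₁, r2, r3, r4⟩ := D.sight_line_crossing hg₁ ha hc₁ h₁ hs₁ he₁ hge₁ hz0 hz₁
  obtain ⟨l1, ρ₂, l2, l3, l4⟩ := D.sight_line_crossing' hg₂ hb hc₂ h₂ hs₂ he₂ hge₂ hz0 hz₂
  rcases le_total ρ₁ ρ₂ with h | h
  · exact D.isPair_of_le hz0 hg₁ h₁ hc₁ r1 r2 r3 h₂ hc₂ l3 l4 h
  · have hpt : ∀ r, pt (-c, 0) (mir z) r = mir (pt (c, 0) z r) := by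
      intro r; rw [mir_pt]; rfl
    obtain ⟨p, hp⟩ := D.mirror.isPair_of_le (z := mir z) (g₁ := mir g₂) (g₂ := mir g₁) (c := -c)
      (x₁ := -x₂) (x₂ := -x₁) (ρ₁ := ρ₂) (ρ₂ := ρ₁) hz0 (by simpa using hg₂) (isLeftEnd_mir.2 h₂)
      (by linarith) (by rw [← mir_mk, cr_mir]; linarith) l2
      (by rw [hpt, ← mir_mk, mir_mem_segment]; exact l3) (isRightEnd_mir.2 h₁) (by linarith)
      (by rw [hpt, ← mir_mk, mir_mem_segment]; exact r3)
      (by rw [hpt, ← mir_mk, mir_mem_svis]; exact r4) h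
    refine ⟨mir p, ?_⟩
    simpa using hp.mirror

/-- The prolongation of a sight line from the base up to the frontier. -/
theorem Dom.exists_exit (D : Dom P V a b) {z : Pt} {c : ℝ} (hz0 : 0 < z.2)
    (hc : z ∈ svis P (c, 0)) :
    ∃ s, 1 ≤ s ∧ pt (c, 0) z s ∈ svis P (c, 0) ∧ pt (c, 0) z s ∈ frontier P := by
  obtain ⟨R, hR⟩ := D.compact.isBounded.exists_norm_le
  have hbd : ∀ s, 0 ≤ s → pt (c, 0) z s ∈ P → s ≤ R / z.2 := by
    intro s hs hP
    have h1 := hR _ hP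
    have h2 := (Real.le_norm_self _).trans (norm_snd_le (pt (c, 0) z s))
    rw [le_div_iff₀ hz0]
    simp at h2
    linarith
  set S : Set ℝ := Icc 1 (R / z.2) ∩ (fun s => pt (c, 0) z s) ⁻¹' svis P (c, 0) with hS
  have hSc : IsCompact S := isCompact_Icc.inter_right
    ((isClosed_svis D.compact.isClosed _).preimage (continuous_pt _ _))
  have h1S : (1 : ℝ) ∈ S := by
    have h1 : pt (c, 0) z 1 ∈ svis P (c, 0) := by rw [pt_one]; exact hc
    exact ⟨⟨le_rfl, hbd 1 zero_le_one (svis_subset h1)⟩, h1⟩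
  obtain ⟨s, ⟨⟨s1, s2⟩, hs⟩, hmax⟩ := hSc.exists_isGreatest ⟨1, h1S⟩
  have hs' : pt (c, 0) z s ∈ svis P (c, 0) := hs
  refine ⟨s, s1, hs', subset_closure (svis_subset hs'), fun hint => ?_⟩
  obtain ⟨ε, hε, hball⟩ := Metric.isOpen_iff.1 isOpen_interior _ hint
  have hee : dist (pt (c, 0) z s) (pt (c, 0) z s) < ε := by simpa using hε
  obtain ⟨τ, hτ, hτ0⟩ := ((eventually_shift_dist (d := (z.1 - c, z.2 - 0)) hee).and
    self_mem_nhdsWithin).exists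
  have hτ0' : 0 < τ := hτ0
  have e : shift (pt (c, 0) z s) (z.1 - c, z.2 - 0) τ = pt (c, 0) z (s + τ) := by
    ext <;> simp [shift] <;> ring
  rw [e] at hτ
  have hv : pt (c, 0) z (s + τ) ∈ svis P (c, 0) := by
    intro w hw
    obtain ⟨r, r0, r1, rfl⟩ := mem_segment_iff.1 hw
    have er : pt (c, 0) (pt (c, 0) z (s + τ)) r = pt (c, 0) z (r * (s + τ)) := by
      ext <;> simp <;> ring
    rw [er]
    rcases le_total (r * (s + τ)) s with h | h
    · apply hs'
      have := pt_mem_segment_pt (p := (c, 0)) (q := z)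
        (show 0 ≤ r * (s + τ) by positivity) h
      rwa [pt_zero] at this
    · apply interior_subset
      apply hball
      refine (convex_ball _ _).segment_subset (Metric.mem_ball_self hε) hτ ?_
      exact pt_mem_segment_pt h (by nlinarith)
  have : s + τ ∈ S := ⟨⟨by linarith, hbd _ (by linarith) (svis_subset hv)⟩, hv⟩
  have := hmax this
  linarith

/-- A point not seen from `G`, where `G` guards the frontier, lies in a triangle formed by the base
and two extreme sight lines of points of `G`. -/
theorem Dom.exists_isPair (D : Dom P V a b) {G : Set Pt} (hG : G.Finite) (hGP : G ⊆ P)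
    (hguard : ∀ e ∈ frontier P, ∃ g ∈ G, e ∈ svis P g) {z : Pt} (hzP : z ∈ P) (hz0 : 0 < z.2)
    (hz : ∀ g ∈ G, z ∉ svis P g) :
    ∃ g₁ ∈ G, ∃ g₂ ∈ G, ∃ x₁ x₂ p, IsPair P a b z g₁ g₂ x₁ x₂ p := by
  obtain ⟨l, hl⟩ := D.exists_isLeftEnd hzP
  obtain ⟨r, hr⟩ := D.exists_isRightEnd hzP
  have hlr : l ≤ r := hl.2 r hr.1
  have hlg : ∀ g, ∃ x, g ∈ G → IsLeftEnd P a b g x := by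
    intro g
    by_cases h : g ∈ G
    · obtain ⟨x, hx⟩ := D.exists_isLeftEnd (hGP h); exact ⟨x, fun _ => hx⟩
    · exact ⟨0, fun h' => absurd h' h⟩
  have hrg : ∀ g, ∃ x, g ∈ G → IsRightEnd P a b g x := by
    intro g
    by_cases h : g ∈ G
    · obtain ⟨x, hx⟩ := D.exists_isRightEnd (hGP h); exact ⟨x, fun _ => hx⟩
    · exact ⟨0, fun h' => absurd h' h⟩
  choose L hL using hlg
  choose R hR using hrg
  obtain ⟨H, hH⟩ := D.compact.isBounded.exists_norm_le
  have hbd : ∀ c s, 0 ≤ s → pt (c, 0) z s ∈ P → s ≤ H / z.2 := by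
    intro c s hs hP
    have h1 := hH _ hP
    have h2 := (Real.le_norm_self _).trans (norm_snd_le (pt (c, 0) z s))
    rw [le_div_iff₀ hz0]
    simp at h2
    linarith
  -- the sight lines of `z` whose prolongation ends at a point seen by `g`
  let K : Pt → Set (ℝ × ℝ) := fun g => (Icc l r ×ˢ Icc 1 (H / z.2)) ∩
    {w | pt (w.1, 0) z w.2 ∈ svis P (w.1, 0) ∧ pt (w.1, 0) z w.2 ∈ svis P g}
  have hK : ∀ g, IsCompact (K g) := by
    intro g
    refine (isCompact_Icc.prod isCompact_Icc).inter_right (IsClosed.inter ?_ ?_)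
    · exact (isClosed_svis_pair D.compact.isClosed).preimage
        (show Continuous fun w : ℝ × ℝ => (((w.1, 0) : Pt), pt (w.1, 0) z w.2) by
          unfold pt; fun_prop)
    · exact (isClosed_svis D.compact.isClosed g).preimage
        (show Continuous fun w : ℝ × ℝ => pt (w.1, 0) z w.2 by unfold pt; fun_prop)
  -- As g does not see c, the condition c ≤ R g amounts to c < L g: all base points visible from g
  -- are to the right of c. The weak inequalities and the compactness of `K g` make `AR` and `AL`
  -- closed.
  let AR : Set ℝ := ⋃ g ∈ G, (Prod.fst '' K g) ∩ Iic (R g)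
  let AL : Set ℝ := ⋃ g ∈ G, (Prod.fst '' K g) ∩ Ici (L g)
  have hARc : IsClosed AR := hG.isClosed_biUnion fun g _ =>
    ((hK g).image continuous_fst).isClosed.inter isClosed_Iic
  have hALc : IsClosed AL := hG.isClosed_biUnion fun g _ =>
    ((hK g).image continuous_fst).isClosed.inter isClosed_Ici
  have hAR : ∀ c ∈ AR, ∃ g ∈ G, ∃ s, 1 ≤ s ∧ pt (c, 0) z s ∈ svis P (c, 0) ∧
      pt (c, 0) z s ∈ svis P g ∧ c < L g := by
    intro c hc
    simp only [AR, mem_iUnion] at hc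
    obtain ⟨g, hg, ⟨⟨c', s⟩, ⟨⟨hc1, hs1⟩, hv1, hv2⟩, rfl⟩, hcR⟩ := hc
    refine ⟨g, hg, s, hs1.1, hv1, hv2, ?_⟩
    by_contra! hle
    exact D.not_seesBase hs1.1 hv1 hv2 (hz g hg)
      (D.seesBase_of_between (hL g hg).1 (hR g hg).1 hle hcR)
  have hAL : ∀ c ∈ AL, ∃ g ∈ G, ∃ s, 1 ≤ s ∧ pt (c, 0) z s ∈ svis P (c, 0) ∧
      pt (c, 0) z s ∈ svis P g ∧ R g < c := by
    intro c hc
    simp only [AL, mem_iUnion] at hc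
    obtain ⟨g, hg, ⟨⟨c', s⟩, ⟨⟨hc1, hs1⟩, hv1, hv2⟩, rfl⟩, hcL⟩ := hc
    refine ⟨g, hg, s, hs1.1, hv1, hv2, ?_⟩
    by_contra! hle
    exact D.not_seesBase hs1.1 hv1 hv2 (hz g hg)
      (D.seesBase_of_between (hL g hg).1 (hR g hg).1 hcL hle)
  have hsee : ∀ c ∈ Icc l r, SeesBase P a b z c := fun c hc =>
    D.seesBase_of_between hl.1 hr.1 hc.1 hc.2
  have hcov : Icc l r ⊆ AR ∪ AL := by
    intro c hc
    obtain ⟨s, s1, hs, hf⟩ := D.exists_exit hz0 (svis_comm.1 (hsee c hc).2.2)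
    obtain ⟨g, hg, hgs⟩ := hguard _ hf
    have hmem : c ∈ Prod.fst '' K g :=
      ⟨(c, s), ⟨⟨hc, s1, hbd c s (by linarith) (svis_subset hs)⟩, hs, hgs⟩, rfl⟩
    rcases le_total c (R g) with h | h
    · left; exact mem_biUnion hg ⟨hmem, h⟩
    · right; exact mem_biUnion hg ⟨hmem, ((hL g hg).2 _ (hR g hg).1).trans h⟩
  -- Otherwise the leftmost sight line of g crosses the line r z beyond z, and its foot, which is to
  -- the right of r, would see z.
  have hr' : r ∉ AR := by
    intro h
    obtain ⟨g, hg, s, s1, hs, hgs, hlt⟩ := hAR r h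
    obtain ⟨-, ρ, h1, h2, h3⟩ := D.sight_line_crossing (hGP hg) hr.1.1 hlt (hL g hg) s1 hs hgs hz0
      (hz g hg)
    have hzX : z ∈ svis P (L g, 0) := by
      refine D.svis_of_mem_segment (D.base_segment (hL g hg).1.1 (hL g hg).1.2.1 hr.1.1 hr.1.2.1)
        h3 ?_ ?_
      · exact (segment_subset_left h2).trans (by rw [segment_symm]; exact (hL g hg).1.2.2)
      · have := pt_mem_segment_pt (p := (r, 0)) (q := z) zero_le_one h1.le
        rwa [pt_zero, pt_one] at this
    have := hr.2 (L g) ⟨(hL g hg).1.1, (hL g hg).1.2.1, svis_comm.1 hzX⟩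
    linarith
  have hl' : l ∉ AL := by
    intro h
    obtain ⟨g, hg, s, s1, hs, hgs, hlt⟩ := hAL l h
    obtain ⟨-, ρ, h1, h2, h3⟩ := D.sight_line_crossing' (hGP hg) hl.1.2.1 hlt (hR g hg) s1 hs hgs
      hz0 (hz g hg)
    have hzX : z ∈ svis P (R g, 0) := by
      refine D.svis_of_mem_segment (D.base_segment (hR g hg).1.1 (hR g hg).1.2.1 hl.1.1 hl.1.2.1)
        h3 ?_ ?_
      · exact (segment_subset_left h2).trans (by rw [segment_symm]; exact (hR g hg).1.2.2)
      · have := pt_mem_segment_pt (p := (l, 0)) (q := z) zero_le_one h1.le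
        rwa [pt_zero, pt_one] at this
    have := hl.2 (R g) ⟨(hR g hg).1.1, (hR g hg).1.2.1, svis_comm.1 hzX⟩
    linarith
  have hlI : l ∈ Icc l r := ⟨le_rfl, hlr⟩
  have hrI : r ∈ Icc l r := ⟨hlr, le_rfl⟩
  obtain ⟨c, hc, hcR, hcL⟩ := isPreconnected_closed_iff.1 (isPreconnected_Icc (a := l) (b := r))
    AR AL hARc hALc hcov ⟨l, hlI, (hcov hlI).resolve_right hl'⟩
    ⟨r, hrI, (hcov hrI).resolve_left hr'⟩
  obtain ⟨g₁, hg₁, s₁, i1, i2, i3, i4⟩ := hAR c hcR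
  obtain ⟨g₂, hg₂, s₂, j1, j2, j3, j4⟩ := hAL c hcL
  have hsc := hsee c hc
  obtain ⟨p, hp⟩ := D.exists_isPair_of_sight_line hz0 (hGP hg₁) (hGP hg₂) hsc.1 hsc.2.1
    (hz g₁ hg₁) (hz g₂ hg₂) (hL g₁ hg₁) i4 (hR g₂ hg₂) j4 i1 i2 i3 j1 j2 j3
  exact ⟨g₁, hg₁, g₂, hg₂, _, _, p, hp⟩

end WVPolygon

/-! ### Separation by a segment attached to the complement -/

namespace WVPolygon

open Filter Topology

variable {P V : Set Pt} {a b : ℝ}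

theorem exists_polar {d : Pt} (hd : d ≠ 0) : ∃ r φ : ℝ, 0 < r ∧ d.1 = r * Real.cos φ ∧
    d.2 = r * Real.sin φ := by
  have h0 : toC d ≠ 0 := by
    intro h
    apply hd
    apply toC_inj
    rw [h]; apply Complex.ext <;> simp [toC]
  exact ⟨‖toC d‖, (toC d).arg, norm_pos_iff.2 h0, (Complex.norm_mul_cos_arg (toC d)).symm,
    (Complex.norm_mul_sin_arg (toC d)).symm⟩

/-- A compact set of points on or above the axis that misses the segment from the axis to `y` also
misses the parallel rays from the points near `y` down to the axis. -/
theorem eventually_ray_notMem {F : Set Pt} (hF : IsCompact F) (hF0 : ∀ w ∈ F, 0 ≤ w.2) {x y : Pt}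
    (hx : x.2 = 0) (hy : 0 < y.2) (hdis : Disjoint F (segment ℝ x y)) :
    ∀ᶠ k in 𝓝 y, ∀ s, 0 < s → shift k (x.1 - y.1, x.2 - y.2) s ∉ F := by
  obtain ⟨η, hη, hsep⟩ := hdis.exists_thickenings hF (isCompact_segment x y).isClosed
  have hthick : ∀ w ∈ F, ∀ q ∈ segment ℝ x y, η ≤ dist w q := by
    intro w hw q hq
    by_contra! hlt
    exact Set.disjoint_left.1 hsep (Metric.self_subset_thickening hη _ hw)
      (Metric.mem_thickening_iff.2 ⟨q, hq, hlt⟩)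
  have hcont : Continuous fun k : Pt => dist k y * (1 + (|x.1 - y.1| + |x.2 - y.2|) / y.2) := by
    fun_prop
  have hev : ∀ᶠ k in 𝓝 y, dist k y * (1 + (|x.1 - y.1| + |x.2 - y.2|) / y.2) < η :=
    hcont.continuousAt.eventually_lt_const (by simpa using hη)
  filter_upwards [hev] with k hk s hs hmem
  have h0 := hF0 _ hmem
  simp only [shift] at h0
  have hs1 : min s 1 ≤ 1 := min_le_right _ _
  have hs0 : 0 < min s 1 := lt_min hs one_pos
  have hq : pt y x (min s 1) ∈ segment ℝ x y := by
    rw [segment_symm]; exact pt_mem_segment hs0.le hs1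
  refine absurd (hthick _ hmem _ hq) (not_le.2 (lt_of_le_of_lt ?_ hk))
  have hk1 : |k.1 - y.1| ≤ dist k y := by
    rw [Prod.dist_eq, ← Real.dist_eq]; exact le_max_left _ _
  have hk2 : |k.2 - y.2| ≤ dist k y := by
    rw [Prod.dist_eq, ← Real.dist_eq]; exact le_max_right _ _
  -- Up to s = 1 the ray runs parallel to the segment. After that, a point of F on it has height at
  -- least 0, so s exceeds 1 by at most dist k y / y.2.
  have hd : s - min s 1 ≤ dist k y / y.2 := by
    rw [le_div_iff₀ hy]
    rcases le_total s 1 with h | h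
    · rw [min_eq_left h]; simp
    · rw [min_eq_right h]
      have := le_abs_self (k.2 - y.2)
      rw [hx] at h0
      linarith
  have hd0 : 0 ≤ s - min s 1 := by linarith [min_le_left s 1]
  have hb : ∀ u v : ℝ, |u| ≤ dist k y → |v| ≤ |x.1 - y.1| + |x.2 - y.2| →
      |u + (s - min s 1) * v| ≤ dist k y * (1 + (|x.1 - y.1| + |x.2 - y.2|) / y.2) := by
    intro u v hu hv
    have h1 : |(s - min s 1) * v| ≤ dist k y / y.2 * (|x.1 - y.1| + |x.2 - y.2|) := by
      rw [abs_mul, abs_of_nonneg hd0]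
      exact mul_le_mul hd hv (abs_nonneg _) (by positivity)
    have h2 := abs_add_le u ((s - min s 1) * v)
    have h3 : dist k y * (1 + (|x.1 - y.1| + |x.2 - y.2|) / y.2) =
      dist k y + dist k y / y.2 * (|x.1 - y.1| + |x.2 - y.2|) := by ring
    linarith
  rw [Prod.dist_eq]
  refine max_le ?_ ?_
  · have e : (shift k (x.1 - y.1, x.2 - y.2) s).1 - (pt y x (min s 1)).1 =
      (k.1 - y.1) + (s - min s 1) * (x.1 - y.1) := by simp [shift]; ring
    rw [Real.dist_eq, e]
    exact hb _ _ hk1 (by linarith [abs_nonneg (x.2 - y.2)])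
  · have e : (shift k (x.1 - y.1, x.2 - y.2) s).2 - (pt y x (min s 1)).2 =
      (k.2 - y.2) + (s - min s 1) * (x.2 - y.2) := by simp [shift]; ring
    rw [Real.dist_eq, e]
    exact hb _ _ hk2 (by linarith [abs_nonneg (x.1 - y.1)])

/-- A segment from the base up to a point where the complement of `P` is attached on its left
separates its left side from its upper prolongation. -/
theorem Dom.not_connected_around (D : Dom P V a b) {g x y m w₀ : Pt} {F : Set Pt} (hx : x.2 = 0)
    (hy : 0 < y.2) (hyg : y ∈ openSegment ℝ x g) (hxg : segment ℝ x g ⊆ P)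
    (hcl : y ∈ closure (Pᶜ ∩ {k | 0 < cr x g k})) (hm : m ∈ openSegment ℝ x y)
    (hw₀ : 0 < cr x g w₀) (hmw : w₀ ∈ svis P m) (hF : IsCompact F) (hFc : IsPreconnected F)
    (hFP : F ⊆ P) (hdis : Disjoint F (segment ℝ x y)) (hwF : w₀ ∈ F) (hgF : g ∈ F) : False := by
  obtain ⟨t, t0, t1, ey⟩ := mem_openSegment_iff.1 hyg
  obtain ⟨s, s0, s1, em⟩ := mem_openSegment_iff.1 hm
  have y1 := congrArg Prod.fst ey
  have y2 := congrArg Prod.snd ey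
  have m1 := congrArg Prod.fst em
  have m2 := congrArg Prod.snd em
  simp only [pt_fst, pt_snd] at y1 y2 m1 m2
  have hsc : 0 < (1 - s) * t := mul_pos (by linarith) t0
  have ev1 : ∀ᶠ k in 𝓝 y, cr m w₀ k < 0 := by
    refine (continuous_cr m w₀).continuousAt.eventually_lt_const ?_
    have : cr m w₀ y = -((1 - s) * t * cr x g w₀) := by
      unfold cr; rw [m1, m2, y1, y2]; ring
    rw [this]
    have := mul_pos hsc hw₀
    linarith
  have ev2 : ∀ᶠ k in 𝓝 y,
      (x.1 - y.1) * (w₀.2 - k.2) - (x.2 - y.2) * (w₀.1 - k.1) < 0 := by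
    have hc : Continuous fun k : Pt =>
        (x.1 - y.1) * (w₀.2 - k.2) - (x.2 - y.2) * (w₀.1 - k.1) := by fun_prop
    refine hc.continuousAt.eventually_lt_const ?_
    have : (x.1 - y.1) * (w₀.2 - y.2) - (x.2 - y.2) * (w₀.1 - y.1) = -(t * cr x g w₀) := by
      unfold cr; rw [y1, y2]; ring
    have := mul_pos t0 hw₀
    simp only
    linarith
  have ev3 := eventually_ray_notMem hF (fun w hw => D.upper w (hFP hw)) hx hy hdis
  -- k is a missing point on the left, so close to y that `w₀` keeps its position relative to it and
  -- the ray from k in the direction x - y misses F.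
  obtain ⟨k, ⟨hkP, hk0⟩, k1, k2, k3⟩ :=
    ((mem_closure_iff_frequently.1 hcl).and_eventually (ev1.and (ev2.and ev3))).exists
  have hk0' : 0 < cr x g k := hk0
  obtain ⟨θ, hθ⟩ := D.exists_isArg hkP
  have hd : ((x.1 - y.1, x.2 - y.2) : Pt) ≠ 0 := by
    intro h
    have := congrArg Prod.snd h
    simp [hx] at this
    exact hy.ne' this
  obtain ⟨ρ, φ, hρ, d1, d2⟩ := exists_polar hd
  simp only at d1 d2
  have hcross : ∀ w ∈ P, ∃ r, 0 < r ∧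
      (x.1 - y.1) * (w.2 - k.2) - (x.2 - y.2) * (w.1 - k.1) = r * Real.sin (θ w - φ) := by
    intro w hw
    obtain ⟨r, hr, e1, e2⟩ := hθ.polar w hw
    refine ⟨ρ * r, by positivity, ?_⟩
    rw [d1, d2, e1, e2, Real.sin_sub]; ring
  have hmg : m ∈ segment ℝ x g :=
    segment_subset_left (openSegment_subset_segment ℝ x g hyg) (openSegment_subset_segment ℝ x y hm)
  have hgm : g ∈ svis P m := (segment_subset_right hmg).trans hxg
  have hmP : m ∈ P := hxg hmg
  have hsinm : 0 < Real.sin (θ m - φ) := by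
    obtain ⟨r, hr, e⟩ := hcross m hmP
    have : (x.1 - y.1) * (m.2 - k.2) - (x.2 - y.2) * (m.1 - k.1) = t * cr x g k := by
      unfold cr; rw [m1, m2, y1, y2]; ring
    rw [this] at e
    exact (pos_iff_pos_of_mul_pos (by rw [← e]; exact mul_pos t0 hk0')).1 hr
  have hsinw : Real.sin (θ w₀ - φ) < 0 := by
    obtain ⟨r, hr, e⟩ := hcross w₀ (hFP hwF)
    rw [e] at k2
    by_contra! hle
    have := mul_nonneg hr.le hle
    linarith
  have hg := (hθ.segment hgm).1 (by
    have : cr k m g = (1 - s * t) * cr x g k := by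
      unfold cr; rw [m1, m2, y1, y2]; ring
    rw [this]
    exact mul_pos (by nlinarith) hk0')
  have hw := (hθ.segment hmw).2.1 (by rw [cr_rotate]; exact k1)
  have hpi := Real.pi_pos
  -- A multiple of 2π is added to the direction angle φ of x - y to bring θ m - φ' into [0, 2π); its
  -- positive sine then confines it to (0, π).
  set N := ⌊(θ m - φ) / (2 * Real.pi)⌋ with hN
  have n1 := Int.floor_le ((θ m - φ) / (2 * Real.pi))
  have n2 := Int.lt_floor_add_one ((θ m - φ) / (2 * Real.pi))
  rw [← hN] at n1 n2
  rw [le_div_iff₀ (by positivity)] at n1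
  rw [div_lt_iff₀ (by positivity)] at n2
  have hper : ∀ u, Real.sin (u - (φ + N * (2 * Real.pi))) = Real.sin (u - φ) := by
    intro u
    rw [← sub_sub]; exact Real.sin_sub_int_mul_two_pi _ _
  set φ' := φ + N * (2 * Real.pi) with hφ'
  rw [← hper] at hsinm hsinw
  have a1 : θ m - φ' < Real.pi := by
    by_contra! hle
    have : Real.sin (θ m - φ' - 2 * Real.pi) ≤ 0 :=
      Real.sin_nonpos_of_nonpos_of_neg_pi_le (by linarith) (by linarith)
    rw [Real.sin_sub_two_pi] at this
    linarith
  have a2 : 0 < θ m - φ' := by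
    refine lt_of_le_of_ne (by linarith) fun h => ?_
    rw [← h, Real.sin_zero] at hsinm
    exact lt_irrefl _ hsinm
  have a3 : θ w₀ < φ' := by
    by_contra! hle
    have : 0 ≤ Real.sin (θ w₀ - φ') :=
      Real.sin_nonneg_of_nonneg_of_le_pi (by linarith) (by linarith)
    linarith
  -- The argument is below φ' at `w₀` and above φ' at g. So it equals φ' at some point of F, and
  -- this point is on the ray that misses F.
  obtain ⟨w, hwF', hwφ⟩ := hFc.intermediate_value hwF hgF (hθ.cont.mono hFP)
    ⟨a3.le, by linarith [hg.1]⟩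
  obtain ⟨r, hr, e1, e2⟩ := hθ.polar w (hFP hwF')
  rw [hwφ, hφ'] at e1 e2
  rw [Real.cos_add_int_mul_two_pi] at e1
  rw [Real.sin_add_int_mul_two_pi] at e2
  refine k3 (r / ρ) (by positivity) ?_
  convert hwF' using 1
  ext
  · simp only [shift]; rw [d1]; field_simp; linarith
  · simp only [shift]; rw [d2]; field_simp; linarith

end WVPolygon

/-! ### Extreme sight lines and the complement on their left -/

namespace WVPolygon

open Filter Topology

variable {P V : Set Pt} {a b : ℝ}

/-- The leftmost sight line of `g` to the base ends at `x₁`, and its point with parameter `κ` is also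
visible from the base point `x₂ < x₁`. -/
structure Fan (P : Set Pt) (a b : ℝ) (g : Pt) (x₁ x₂ κ : ℝ) : Prop where
  left : IsLeftEnd P a b g x₁
  le : a ≤ x₂
  lt : x₂ < x₁
  pos : 0 < κ
  le_one : κ ≤ 1
  mem : g ∈ P
  height : 0 < g.2
  vis : pt (x₁, 0) g κ ∈ svis P (x₂, 0)

/-- The triangle below a fan. -/
def fanTriangle (g : Pt) (x₁ x₂ κ : ℝ) : Set Pt := triangle (x₁, 0) (pt (x₁, 0) g κ) (x₂, 0)

theorem Fan.segment_subset {g : Pt} {x₁ x₂ κ : ℝ} (h : Fan P a b g x₁ x₂ κ) :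
    segment ℝ ((x₁, 0) : Pt) g ⊆ P := by
  rw [segment_symm]; exact h.left.1.2.2

theorem Fan.base_mem {g : Pt} {x₁ x₂ κ : ℝ} (h : Fan P a b g x₁ x₂ κ) : x₂ ≤ b :=
  h.lt.le.trans h.left.1.2.1

theorem Fan.triangle_subset (D : Dom P V a b) {g : Pt} {x₁ x₂ κ : ℝ} (h : Fan P a b g x₁ x₂ κ) :
    fanTriangle g x₁ x₂ κ ⊆ P :=
  D.triangle_subset
    ((segment_subset_left (pt_mem_segment h.pos.le h.le_one)).trans h.segment_subset)
    (svis_comm.1 h.vis) (D.base_segment h.left.1.1 h.left.1.2.1 h.le h.base_mem)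

/-- A sight line from g to w could be prolonged inside the fan triangle down to a base point to the
left of x₁. -/
theorem Fan.invisible (D : Dom P V a b) {g w : Pt} {x₁ x₂ κ : ℝ} (h : Fan P a b g x₁ x₂ κ)
    (hw : w ∈ fanTriangle g x₁ x₂ κ) (hw0 : 0 < cr (x₁, 0) g w) : w ∉ svis P g := by
  intro hv
  have hT := h.triangle_subset D
  have hlt := h.lt
  have hg := h.height
  have hw' := hw
  obtain ⟨α, β, γ, hα, hβ, hγ, hs, ew⟩ := mem_triangle_iff.1 hw
  have w1 := congrArg Prod.fst ew
  have w2 := congrArg Prod.snd ew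
  simp only [pt_fst, pt_snd] at w1 w2
  have hα' : α = 1 - β - γ := by linarith
  have hγ0 : 0 < γ := by
    have e : cr (x₁, 0) g w = γ * (g.2 * (x₁ - x₂)) := by
      simp only [cr]; rw [w1, w2, hα']; ring
    rw [e] at hw0
    exact (pos_iff_pos_of_mul_pos hw0).2 (mul_pos hg (by linarith))
  have hκβ : β * κ ≤ β := mul_le_of_le_one_right hβ h.le_one
  have hden : 0 < 1 - β * κ := by linarith
  -- `r` is the parameter at which the line from g through w reaches the axis.
  set r := 1 / (1 - β * κ) with hr
  have hrd : r * (1 - β * κ) = 1 := by rw [hr]; field_simp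
  have r0 : 0 < r := by positivity
  have r1 : 1 ≤ r := by
    rw [hr, le_div_iff₀ hden]; nlinarith [mul_nonneg hβ h.pos.le]
  have hrγ0 : 0 < r * γ := by positivity
  have hrγ : r * γ ≤ 1 := by rw [← hrd]; exact mul_le_mul_of_nonneg_left (by linarith) r0.le
  set c := x₁ - r * γ * (x₁ - x₂) with hc
  have hcx : c < x₁ := by
    have := mul_pos hrγ0 (show 0 < x₁ - x₂ by linarith); linarith
  have hxc : x₂ ≤ c := by nlinarith
  have hY : pt g w r = (c, 0) := by
    ext
    · simp only [pt_fst]; rw [w1, hα', hc]; linear_combination (x₁ - g.1) * hrd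
    · simp only [pt_snd]; rw [w2, hα']; linear_combination (-g.2) * hrd
  have hYT : ((c, 0) : Pt) ∈ fanTriangle g x₁ x₂ κ := by
    refine mem_triangle_iff.2 ⟨1 - r * γ, 0, r * γ, by linarith, le_rfl, hrγ0.le, by ring, ?_⟩
    ext
    · simp; ring
    · simp
  have hwY : segment ℝ w (c, 0) ⊆ P :=
    ((convex_triangle _ _ _).segment_subset hw' hYT).trans hT
  have hcv : ((c, 0) : Pt) ∈ svis P g := by
    intro q hq
    rw [← hY] at hq hwY
    obtain ⟨t, t0, t1, rfl⟩ := mem_segment_iff.1 hq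
    have et : pt g (pt g w r) t = pt g w (t * r) := by ext <;> simp <;> ring
    rw [et]
    rcases le_total (t * r) 1 with h1 | h1
    · exact hv (pt_mem_segment (by positivity) h1)
    · have := pt_mem_segment_pt (p := g) (q := w) h1 (mul_le_of_le_one_left r0.le t1)
      rw [pt_one] at this
      exact hwY this
  have := h.left.2 c ⟨h.le.trans hxc, hcx.le.trans h.left.1.2.1, hcv⟩
  linarith

/-- For κ = 1, g would see x₂, to the left of its leftmost visible base point. -/
theorem Fan.lt_one {g : Pt} {x₁ x₂ κ : ℝ} (h : Fan P a b g x₁ x₂ κ) : κ < 1 := by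
  refine lt_of_le_of_ne h.le_one fun e => ?_
  have hv := h.vis
  rw [e, pt_one] at hv
  have := h.left.2 x₂ ⟨h.le, h.base_mem, svis_comm.1 hv⟩
  linarith [h.lt]

theorem Fan.eventually_mem {g : Pt} {x₁ x₂ κ s : ℝ} (h : Fan P a b g x₁ x₂ κ) (s0 : 0 < s)
    (s1 : s < κ) : ∀ᶠ c in 𝓝 (pt (x₁, 0) g s), 0 ≤ cr (x₁, 0) g c → c ∈ fanTriangle g x₁ x₂ κ := by
  have hlt := h.lt
  have hpos : 0 < g.2 * (x₁ - x₂) := mul_pos h.height (by linarith)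
  have hκ := h.pos
  have e1 : ∀ᶠ c in 𝓝 (pt (x₁, 0) g s), 0 < cr (pt (x₁, 0) g κ) (x₂, 0) c := by
    refine (continuous_cr _ _).continuousAt.eventually_const_lt ?_
    have : cr (pt (x₁, 0) g κ) (x₂, 0) (pt (x₁, 0) g s) = (κ - s) * (g.2 * (x₁ - x₂)) := by
      simp [cr]; ring
    rw [this]; exact mul_pos (by linarith) hpos
  have e2 : ∀ᶠ c in 𝓝 (pt (x₁, 0) g s), 0 < cr (x₂, 0) (x₁, 0) c := by
    refine (continuous_cr _ _).continuousAt.eventually_const_lt ?_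
    have : cr (x₂, 0) (x₁, 0) (pt (x₁, 0) g s) = s * (g.2 * (x₁ - x₂)) := by
      simp [cr]; ring
    rw [this]; exact mul_pos s0 hpos
  filter_upwards [e1, e2] with c h1 h2 h3
  refine mem_triangle_of_cr ?_ ?_ h1.le h2.le
  · have : cr (x₁, 0) (pt (x₁, 0) g κ) (x₂, 0) = κ * (g.2 * (x₁ - x₂)) := by
      simp [cr]; ring
    rw [this]; exact mul_pos hκ hpos
  · have : cr (x₁, 0) (pt (x₁, 0) g κ) c = κ * cr (x₁, 0) g c := by
      simp [cr]; ring
    rw [this]; exact mul_nonneg hκ.le h3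

theorem Fan.notMem_closure (D : Dom P V a b) {g : Pt} {x₁ x₂ κ s : ℝ} (h : Fan P a b g x₁ x₂ κ)
    (s0 : 0 < s) (s1 : s < κ) : pt (x₁, 0) g s ∉ closure (Pᶜ ∩ {k | 0 < cr (x₁, 0) g k}) := by
  intro hcl
  obtain ⟨c, ⟨hc, hc0⟩, hT⟩ := ((mem_closure_iff_frequently.1 hcl).and_eventually
    (h.eventually_mem s0 s1)).exists
  exact hc (h.triangle_subset D (hT (le_of_lt hc0)))

/-- The complement of `P` touches the extreme sight line from the left. -/
theorem Fan.exists_touch (D : Dom P V a b) {g : Pt} {x₁ x₂ κ : ℝ} (h : Fan P a b g x₁ x₂ κ) :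
    ∃ s, κ ≤ s ∧ s < 1 ∧ pt (x₁, 0) g s ∈ closure (Pᶜ ∩ {k | 0 < cr (x₁, 0) g k}) := by
  by_contra! hcon
  have hlt := h.lt
  have hκ := h.pos
  have hκ1 := h.lt_one
  have hg0 := h.height
  set E := closure (Pᶜ ∩ {k | 0 < cr (x₁, 0) g k}) with hE
  obtain ⟨ε, hε, hcone⟩ := D.cone g
  have ev : ∀ᶠ s in 𝓝[<] (1 : ℝ), dist (pt (x₁, 0) g s) g < ε / 2 := by
    have hc : Continuous fun s => dist (pt (x₁, 0) g s) g :=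
      (continuous_pt _ _).dist continuous_const
    refine (hc.tendsto 1).mono_left nhdsWithin_le_nhds |>.eventually_lt_const ?_
    rw [pt_one, dist_self]; positivity
  obtain ⟨σ, hσε, hσκ, hσ1⟩ := (ev.and (Ioo_mem_nhdsLT hκ1)).exists
  have hKdis : Disjoint (pt (x₁, 0) g '' Icc (κ / 2) σ) E := by
    rw [Set.disjoint_left]
    rintro _ ⟨s, hs, rfl⟩ hsE
    rcases lt_or_ge s κ with h' | h'
    · exact h.notMem_closure D (by linarith [hs.1]) h' hsE
    · exact hcon s h' (by linarith [hs.2]) hsE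
  obtain ⟨η, hη, hsep⟩ := hKdis.exists_thickenings
    (isCompact_Icc.image (continuous_pt _ _)) isClosed_closure
  -- If the complement stayed away, the foot of the sight line could be moved left by δ: the lowest
  -- part of the new segment is in the fan triangle, the middle part is within η of the old sight
  -- line, and the top part is in P by the cone structure at g.
  obtain ⟨δ, hδ0, hδη, hδε, hδx⟩ : ∃ δ, 0 < δ ∧ δ < η ∧ δ < ε / 2 ∧ δ ≤ (x₁ - x₂) / 2 := by
    refine ⟨min (min (η / 2) (ε / 4)) ((x₁ - x₂) / 2), ?_, ?_, ?_, min_le_right _ _⟩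
    · exact lt_min (lt_min (by linarith) (by linarith)) (by linarith)
    · have h1 := min_le_left (min (η / 2) (ε / 4)) ((x₁ - x₂) / 2)
      have h2 := min_le_left (η / 2) (ε / 4)
      linarith
    · have h1 := min_le_left (min (η / 2) (ε / 4)) ((x₁ - x₂) / 2)
      have h2 := min_le_right (η / 2) (ε / 4)
      linarith
  have hd : ∀ s, 0 ≤ s → s ≤ 1 → dist (pt (x₁ - δ, 0) g s) (pt (x₁, 0) g s) ≤ δ := by
    intro s s0 s1
    have e : (pt (x₁ - δ, 0) g s).1 - (pt (x₁, 0) g s).1 = -((1 - s) * δ) := by simp; ring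
    have h2 : 0 ≤ (1 - s) * δ := mul_nonneg (by linarith) hδ0.le
    rw [Prod.dist_eq]
    refine max_le ?_ (by simp [hδ0.le])
    rw [Real.dist_eq, e, abs_neg, abs_of_nonneg h2]
    nlinarith
  have hmid : ∀ s, κ / 2 ≤ s → s ≤ σ → pt (x₁ - δ, 0) g s ∈ P := by
    intro s s0 s1
    by_contra hP
    have hL : 0 < cr (x₁, 0) g (pt (x₁ - δ, 0) g s) := by
      have : cr (x₁, 0) g (pt (x₁ - δ, 0) g s) = (1 - s) * (g.2 * δ) := by simp [cr]; ring
      rw [this]; exact mul_pos (by linarith) (mul_pos hg0 hδ0)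
    have h1 : pt (x₁ - δ, 0) g s ∈ E := subset_closure ⟨hP, hL⟩
    refine Set.disjoint_left.1 hsep (Metric.mem_thickening_iff.2
      ⟨pt (x₁, 0) g s, mem_image_of_mem _ ⟨s0, s1⟩, ?_⟩) (Metric.self_subset_thickening hη _ h1)
    exact (hd s (by linarith) (by linarith)).trans_lt hδη
  have hvis : ((x₁ - δ, 0) : Pt) ∈ svis P g := by
    intro q hq
    rw [segment_symm] at hq
    obtain ⟨s, s0, s1, rfl⟩ := mem_segment_iff.1 hq
    rcases le_total s (κ / 2) with h1 | h1
    · apply h.triangle_subset D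
      have hx : 0 < x₁ - x₂ := by linarith
      set μ := δ / (x₁ - x₂) with hμ
      have hμ0 : 0 < μ := by positivity
      have hμ1 : μ ≤ 1 / 2 := by rw [hμ, div_le_iff₀ hx]; linarith
      have hμx : δ = μ * (x₁ - x₂) := by rw [hμ]; field_simp
      have hsκ : s / κ ≤ 1 / 2 := by rw [div_le_iff₀ hκ]; linarith
      have hsκ' : s / κ * κ = s := by field_simp
      have hmul : (1 - s) * μ ≤ μ := mul_le_of_le_one_left hμ0.le (by linarith)
      refine mem_triangle_iff.2 ⟨1 - (1 - s) * μ - s / κ, s / κ, (1 - s) * μ, by linarith,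
        by positivity, mul_nonneg (by linarith) hμ0.le, by ring, ?_⟩
      ext
      · simp only [pt_fst]; rw [hμx]; linear_combination (x₁ - g.1) * hsκ'
      · simp only [pt_snd]; linear_combination (-g.2) * hsκ'
    rcases le_total s σ with h2 | h2
    · exact hmid s h1 h2
    · rcases eq_or_lt_of_le s1 with h3 | h3
      · rw [h3, pt_one]; exact h.mem
      · have hσP := hmid σ (by linarith) le_rfl
        have hdσ : dist (pt (x₁ - δ, 0) g σ) g < ε := by
          have := dist_triangle (pt (x₁ - δ, 0) g σ) (pt (x₁, 0) g σ) g
          have := hd σ (by linarith) (by linarith)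
          linarith
        have h4 : 0 < 1 - σ := by linarith
        have := (hcone _ hdσ ((1 - s) / (1 - σ)) (div_pos (by linarith) h4)
          (by rw [div_le_one h4]; linarith)).1 hσP
        convert this using 1
        ext <;> simp <;> field_simp <;> ring
  have := h.left.2 (x₁ - δ) ⟨by linarith [h.le], by linarith [h.left.1.2.1], hvis⟩
  linarith

end WVPolygon

/-! ### First touching points and the constructed edges they end -/

namespace WVPolygon

open Filter Topology

variable {P V : Set Pt} {a b : ℝ}

/-- The complement of `P` touches the extreme sight line from the left for the first time at its
point with parameter `s`. -/
structure IsTouch (P : Set Pt) (g : Pt) (x₁ κ s : ℝ) : Prop where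
  le : κ ≤ s
  lt : s < 1
  mem : pt (x₁, 0) g s ∈ closure (Pᶜ ∩ {k | 0 < cr (x₁, 0) g k})
  first : ∀ r, 0 < r → r < s → pt (x₁, 0) g r ∉ closure (Pᶜ ∩ {k | 0 < cr (x₁, 0) g k})

theorem Fan.exists_isTouch (D : Dom P V a b) {g : Pt} {x₁ x₂ κ : ℝ} (h : Fan P a b g x₁ x₂ κ) :
    ∃ s, IsTouch P g x₁ κ s := by
  obtain ⟨s, s0, s1, hs⟩ := h.exists_touch D
  set S := Icc κ s ∩ pt (x₁, 0) g ⁻¹' closure (Pᶜ ∩ {k | 0 < cr (x₁, 0) g k}) with hS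
  have hSc : IsCompact S :=
    isCompact_Icc.inter_right (isClosed_closure.preimage (continuous_pt _ _))
  obtain ⟨l, ⟨⟨l0, l1⟩, hl⟩, hmin⟩ := hSc.exists_isLeast ⟨s, ⟨s0, le_rfl⟩, hs⟩
  refine ⟨l, l0, by linarith, hl, fun r r0 r1 hr => ?_⟩
  rcases lt_or_ge r κ with h' | h'
  · exact h.notMem_closure D r0 h' hr
  · have : l ≤ r := hmin ⟨⟨h', by linarith⟩, hr⟩
    linarith

theorem Fan.mem_closure_left {g : Pt} {x₁ x₂ κ : ℝ} (h : Fan P a b g x₁ x₂ κ) (s : ℝ) :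
    pt (x₁, 0) g s ∈ closure {k | 0 < cr (x₁, 0) g k} := by
  refine mem_closure_of_shift (d := (x₂ - x₁, 0)) ?_
  filter_upwards [self_mem_nhdsWithin] with r hr
  have hr' : 0 < r := hr
  show 0 < cr (x₁, 0) g _
  rw [cr_shift, cr_pt_self]
  have : 0 < r * (g.2 * (x₁ - x₂)) := mul_pos hr' (mul_pos h.height (by linarith [h.lt]))
  simp only; linarith

theorem Fan.mem_openSegment {g : Pt} {x₁ x₂ κ s : ℝ} (_h : Fan P a b g x₁ x₂ κ) (s0 : 0 < s)
    (s1 : s < 1) : pt (x₁, 0) g s ∈ openSegment ℝ ((x₁, 0) : Pt) g :=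
  mem_openSegment_iff.2 ⟨s, s0, s1, rfl⟩

theorem Fan.pt_mem_svis {g : Pt} {x₁ x₂ κ s : ℝ} (h : Fan P a b g x₁ x₂ κ) (s0 : 0 ≤ s)
    (s1 : s ≤ 1) : pt (x₁, 0) g s ∈ svis P g :=
  mem_svis_of_mem_segment h.left.1.2.2 (by rw [segment_symm]; exact pt_mem_segment s0 s1)

/-- Below the first touching point, the left side of the extreme sight line belongs to a single
pocket. -/
theorem IsTouch.eventually_mem_pocket (D : Dom P V a b) {g z : Pt} {x₁ x₂ κ l : ℝ} {C : Set Pt}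
    (h : Fan P a b g x₁ x₂ κ) (hl : IsTouch P g x₁ κ l) (hC : SPocket P g C) (hzC : z ∈ C)
    (hz : z ∈ fanTriangle g x₁ x₂ κ) (hz0 : 0 < cr (x₁, 0) g z) {s : ℝ} (s0 : 0 < s)
    (s1 : s < l) : ∀ᶠ c in 𝓝 (pt (x₁, 0) g s), 0 < cr (x₁, 0) g c → c ∈ C := by
  have hκ := h.pos
  have hκ1 := h.lt_one
  set L : Set Pt := {k | 0 < cr (x₁, 0) g k} with hL
  have hLconv : Convex ℝ L := by simpa [hL] using convex_side 1 ((x₁, 0) : Pt) g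
  have hTL : fanTriangle g x₁ x₂ κ ∩ L ⊆ C :=
    hC.subset_of_preconnected ((convex_triangle _ _ _).inter hLconv).isPreconnected
      (fun w hw => ⟨h.triangle_subset D hw.1, h.invisible D hw.1 hw.2⟩) ⟨hz, hz0⟩ hzC
  -- Before the first touching point P contains a left half ball at each point of the sight line.
  -- Either g sees a point of it, hence all its points near the centre, or it is unseen and so
  -- inside C or disjoint from C. Thus `U` and `W` cover the connected interval, and the fan
  -- triangle puts κ / 2 into `U`.
  set U : Set ℝ := {s | ∀ᶠ c in 𝓝 (pt (x₁, 0) g s), c ∈ L → c ∈ C} with hU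
  set W : Set ℝ := {s | ∀ᶠ c in 𝓝 (pt (x₁, 0) g s), c ∈ L → c ∉ C} with hW
  have hUo : IsOpen U := isOpen_setOfPred_eventually_nhds.preimage (continuous_pt (x₁, 0) g)
  have hWo : IsOpen W := isOpen_setOfPred_eventually_nhds.preimage (continuous_pt (x₁, 0) g)
  have hdis : Disjoint U W := by
    rw [Set.disjoint_left]
    intro s hsU hsW
    have hsU' : ∀ᶠ c in 𝓝 (pt (x₁, 0) g s), c ∈ L → c ∈ C := hsU
    have hsW' : ∀ᶠ c in 𝓝 (pt (x₁, 0) g s), c ∈ L → c ∉ C := hsW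
    obtain ⟨c, hc, h1, h2⟩ := ((mem_closure_iff_frequently.1 (h.mem_closure_left s)).and_eventually
      (hsU'.and hsW')).exists
    exact h2 hc (h1 hc)
  have hcov : Ioo 0 l ⊆ U ∪ W := by
    rintro s ⟨s0, s1⟩
    have hev : ∀ᶠ c in 𝓝 (pt (x₁, 0) g s), c ∉ Pᶜ ∩ L := by
      have := hl.first s s0 s1
      rw [mem_closure_iff_frequently, not_frequently] at this
      exact this
    obtain ⟨δ, hδ, hball⟩ := Metric.eventually_nhds_iff_ball.1 hev
    have hb : Metric.ball (pt (x₁, 0) g s) δ ∩ L ⊆ P := by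
      rintro w ⟨hw1, hw2⟩
      by_contra hwP
      exact hball w hw1 ⟨hwP, hw2⟩
    have hs1 : s < 1 := s1.trans hl.lt
    have hnear : ∀ᶠ c in 𝓝 (pt (x₁, 0) g s), c ∈ Metric.ball (pt (x₁, 0) g s) δ :=
      Metric.ball_mem_nhds _ hδ
    by_cases hv : ∃ w ∈ Metric.ball (pt (x₁, 0) g s) δ ∩ L, w ∈ svis P g
    · obtain ⟨w, ⟨hw1, hw2⟩, hwv⟩ := hv
      have hw2' : 0 < cr (x₁, 0) g w := hw2
      right
      have := D.eventually_visible (σ := 1) (Or.inl rfl) hδ (h.mem_openSegment s0 hs1)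
        (h.pt_mem_svis s0.le hs1.le) (by simpa [hL] using hb)
        (svis_subset (h.pt_mem_svis s0.le hs1.le)) hw1 (by rw [one_mul]; exact hw2) hwv
      filter_upwards [this] with c hc hcL hcC
      exact (hC.subset hcC).2 (hc (by rw [one_mul]; exact hcL))
    · push Not at hv
      have hpre : IsPreconnected (Metric.ball (pt (x₁, 0) g s) δ ∩ L) :=
        ((convex_ball _ _).inter hLconv).isPreconnected
      by_cases hne : ∃ w ∈ Metric.ball (pt (x₁, 0) g s) δ ∩ L, w ∈ C
      · obtain ⟨w, hw, hwC⟩ := hne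
        left
        filter_upwards [hnear] with c hc hcL
        exact hC.subset_of_preconnected hpre (fun w hw => ⟨hb hw, hv w hw⟩) hw hwC ⟨hc, hcL⟩
      · push Not at hne
        right
        filter_upwards [hnear] with c hc hcL
        exact hne c ⟨hc, hcL⟩
  have hU0 : (Ioo 0 l ∩ U).Nonempty := by
    refine ⟨κ / 2, ⟨by linarith, by linarith [hl.le]⟩, ?_⟩
    show ∀ᶠ c in 𝓝 (pt (x₁, 0) g (κ / 2)), c ∈ L → c ∈ C
    filter_upwards [h.eventually_mem (s := κ / 2) (by linarith) (by linarith)] with c hc hcL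
    exact hTL ⟨hc (le_of_lt hcL), hcL⟩
  exact isPreconnected_Ioo.subset_left_of_subset_union hUo hWo hdis hcov hU0 ⟨s0, s1⟩

/-- Two points of a connected subset of `P` that is disjoint from a closed set are joined by a
compact connected set disjoint from it. -/
theorem Dom.exists_compact_preconnected (D : Dom P V a b) {S E : Set Pt} (hS : IsPreconnected S)
    (hSP : S ⊆ P) (hE : IsClosed E) (hdis : Disjoint S E) {p q : Pt} (hp : p ∈ S) (hq : q ∈ S) :
    ∃ F, IsCompact F ∧ IsPreconnected F ∧ F ⊆ P ∧ Disjoint F E ∧ p ∈ F ∧ q ∈ F := by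
  refine hS.induction₂ (fun p q => ∃ F, IsCompact F ∧ IsPreconnected F ∧ F ⊆ P ∧ Disjoint F E ∧
    p ∈ F ∧ q ∈ F) ?_ ?_ ?_ hp hq
  · intro x hx
    obtain ⟨ε, hε, hcone⟩ := D.exists_cone (hSP hx)
    obtain ⟨δ, hδ, hball⟩ := Metric.isOpen_iff.1 hE.isOpen_compl x
      (Set.disjoint_left.1 hdis hx)
    rw [eventually_nhdsWithin_iff]
    have e1 : ∀ᶠ c in 𝓝 x, c ∈ Metric.ball x ε := Metric.ball_mem_nhds x hε
    have e2 : ∀ᶠ c in 𝓝 x, c ∈ Metric.ball x δ := Metric.ball_mem_nhds x hδ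
    filter_upwards [e1, e2] with y h1 h2 hy
    refine ⟨segment ℝ x y, isCompact_segment _ _, (convex_segment x y).isPreconnected,
      hcone y (hSP hy) h1, ?_, left_mem_segment ℝ x y, right_mem_segment ℝ x y⟩
    rw [Set.disjoint_left]
    intro w hw
    exact hball ((convex_ball x δ).segment_subset (Metric.mem_ball_self hδ) h2 hw)
  · rintro x y z _ _ _ ⟨F, h1, h2, h3, h4, h5, h6⟩ ⟨F', i1, i2, i3, i4, i5, i6⟩
    exact ⟨F ∪ F', h1.union i1, h2.union y h6 i5 i2, union_subset h3 i3,
      Set.disjoint_union_left.2 ⟨h4, i4⟩, Or.inl h5, Or.inr i6⟩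
  · rintro x y _ _ ⟨F, h1, h2, h3, h4, h5, h6⟩
    exact ⟨F, h1, h2, h3, h4, h6, h5⟩

/-- A common point would lie between q and g, so q would be on the same line, not higher, and not
below the axis: on the lower segment. -/
theorem IsTouch.disjoint_sight_line (D : Dom P V a b) {g q : Pt} {x₁ x₂ κ l : ℝ}
    (h : Fan P a b g x₁ x₂ κ) (hl : IsTouch P g x₁ κ l) (hq : q ∈ P)
    (hqs : q ∉ segment ℝ ((x₁, 0) : Pt) (pt (x₁, 0) g l)) :
    Disjoint (segment ℝ q g) (segment ℝ ((x₁, 0) : Pt) (pt (x₁, 0) g l)) := by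
  have hκ := h.pos
  have hl0 : 0 < l := by linarith [hl.le]
  rw [Set.disjoint_left]
  intro w hw1 hw2
  obtain ⟨τ, t0, t1, e1⟩ := mem_segment_iff.1 hw1
  obtain ⟨r, r0, r1, e2⟩ := mem_segment_iff.1 hw2
  have hr : pt (x₁, 0) (pt (x₁, 0) g l) r = pt (x₁, 0) g (r * l) := by ext <;> simp <;> ring
  rw [hr] at e2
  have hrl : r * l ≤ l := mul_le_of_le_one_left hl0.le r1
  have hl1 := hl.lt
  have ht1 : τ < 1 := by
    refine lt_of_le_of_ne t1 fun e => ?_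
    rw [e, pt_one] at e1
    rw [e1] at e2
    have := congrArg Prod.snd e2
    simp only [pt_snd] at this
    nlinarith [h.height]
  have ht1' : 0 < 1 - τ := by linarith
  have eq : q = pt (x₁, 0) g ((r * l - τ) / (1 - τ)) := by
    have h1 := congrArg Prod.fst (e1.symm.trans e2)
    have h2 := congrArg Prod.snd (e1.symm.trans e2)
    simp only [pt_fst, pt_snd] at h1 h2
    ext
    · simp only [pt_fst]; field_simp; linear_combination h1
    · simp only [pt_snd]; field_simp; linear_combination h2
  have hq0 := D.upper q hq
  have hpos : 0 ≤ (r * l - τ) / (1 - τ) := by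
    by_contra! hneg
    rw [eq] at hq0
    simp only [pt_snd] at hq0
    nlinarith [h.height]
  have hle : (r * l - τ) / (1 - τ) ≤ l := by
    rw [div_le_iff₀ ht1']; nlinarith
  apply hqs
  rw [eq]
  have := pt_mem_segment_pt (p := ((x₁, 0) : Pt)) (q := g) hpos hle
  rwa [pt_zero] at this

/-- Up to the touching point the pocket lies along the left of the sight line, so its closure
contains that segment. If it had another visible point q in its closure, one could pass inside the
pocket from the left of the segment to near q, then to q and along the sight line to g, which
`Dom.not_connected_around` excludes. -/
theorem IsTouch.constructed (D : Dom P V a b) {g z : Pt} {x₁ x₂ κ l : ℝ} {C : Set Pt}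
    (h : Fan P a b g x₁ x₂ κ) (hl : IsTouch P g x₁ κ l) (hC : SPocket P g C) (hzC : z ∈ C)
    (hz : z ∈ fanTriangle g x₁ x₂ κ) (hz0 : 0 < cr (x₁, 0) g z) :
    SConstructed P g C (x₁, 0) (pt (x₁, 0) g l) := by
  have hκ := h.pos
  have hl0 : 0 < l := by linarith [hl.le]
  have hl1 := hl.lt
  have hg := h.height
  have hy0 : 0 < (pt (x₁, 0) g l).2 := by simp; positivity
  have hseg : segment ℝ ((x₁, 0) : Pt) (pt (x₁, 0) g l) ⊆ svis P g := fun w hw =>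
    mem_svis_of_mem_segment h.left.1.2.2
      (by rw [segment_symm]; exact segment_subset_left (pt_mem_segment hl0.le hl1.le) hw)
  have hsegC : IsClosed (segment ℝ ((x₁, 0) : Pt) (pt (x₁, 0) g l)) :=
    (isCompact_segment _ _).isClosed
  refine ⟨hC, ?_, hy0.le, Subset.antisymm ?_ ?_⟩
  · intro e; rw [← e] at hy0; exact lt_irrefl _ hy0
  · rintro q ⟨hqC, hqv⟩
    by_contra hqs
    have hqP := svis_subset hqv
    have hm : 0 < l / 2 ∧ l / 2 < l := ⟨by linarith, by linarith⟩
    -- a point of the pocket next to the sight line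
    have hev : ∀ᶠ c in 𝓝 (pt (x₁, 0) g (l / 2)), c ∉ Pᶜ ∩ {k | 0 < cr (x₁, 0) g k} := by
      have := hl.first _ hm.1 hm.2
      rw [mem_closure_iff_frequently, not_frequently] at this
      exact this
    obtain ⟨δ, hδ, hball⟩ := Metric.eventually_nhds_iff_ball.1
      (hev.and (hl.eventually_mem_pocket D h hC hzC hz hz0 hm.1 hm.2))
    have hne : ∀ᶠ c in 𝓝 (pt (x₁, 0) g (l / 2)),
        c ∈ Metric.ball (pt (x₁, 0) g (l / 2)) δ := Metric.ball_mem_nhds _ hδ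
    obtain ⟨w₀, hw₀, hw₀b⟩ := ((mem_closure_iff_frequently.1
      (h.mem_closure_left (l / 2))).and_eventually hne).exists
    have hw₀' : 0 < cr (x₁, 0) g w₀ := hw₀
    have hmP : pt (x₁, 0) g (l / 2) ∈ P := svis_subset (h.pt_mem_svis hm.1.le (by linarith))
    have hmw : w₀ ∈ svis P (pt (x₁, 0) g (l / 2)) := by
      intro w hw
      obtain ⟨τ, t0, t1, rfl⟩ := mem_segment_iff.1 hw
      rcases eq_or_lt_of_le t0 with e | e
      · rw [← e, pt_zero]; exact hmP
      · by_contra hwP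
        refine (hball _ ((convex_ball _ δ).segment_subset (Metric.mem_ball_self hδ) hw₀b hw)).1
          ⟨hwP, ?_⟩
        show 0 < cr (x₁, 0) g _
        rw [cr_pt, cr_pt_self, mul_zero, zero_add]
        exact mul_pos e hw₀'
    have hw₀C : w₀ ∈ C := (hball w₀ hw₀b).2 hw₀'
    obtain ⟨ε, hε, hcone⟩ := D.exists_cone hqP
    obtain ⟨ρ, hρ, hballq⟩ := Metric.isOpen_iff.1 hsegC.isOpen_compl q hqs
    have eε : ∀ᶠ c in 𝓝 q, c ∈ Metric.ball q ε := Metric.ball_mem_nhds q hε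
    have eρ : ∀ᶠ c in 𝓝 q, c ∈ Metric.ball q ρ := Metric.ball_mem_nhds q hρ
    obtain ⟨w, hwC, hwε, hwρ⟩ := ((mem_closure_iff_frequently.1 hqC).and_eventually
      (eε.and eρ)).exists
    have hCdis : Disjoint C (segment ℝ ((x₁, 0) : Pt) (pt (x₁, 0) g l)) :=
      Set.disjoint_left.2 fun c hc hc' => (hC.subset hc).2 (hseg hc')
    obtain ⟨F, f1, f2, f3, f4, f5, f6⟩ := D.exists_compact_preconnected hC.isPreconnected
      (fun c hc => (hC.subset hc).1) hsegC hCdis hw₀C hwC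
    refine D.not_connected_around (F := F ∪ (segment ℝ q w ∪ segment ℝ q g)) (m := pt (x₁, 0) g (l / 2))
      (w₀ := w₀) rfl hy0 (h.mem_openSegment hl0 hl1)
      h.segment_subset hl.mem ?_ hw₀ hmw ?_ ?_ ?_ ?_ (Or.inl f5)
      (Or.inr (Or.inr (right_mem_segment ℝ q g)))
    · refine mem_openSegment_iff.2 ⟨1 / 2, by norm_num, by norm_num, ?_⟩
      ext <;> simp <;> ring
    · exact f1.union ((isCompact_segment _ _).union (isCompact_segment _ _))
    · exact f2.union w f6 (Or.inl (right_mem_segment ℝ q w))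
        ((convex_segment q w).isPreconnected.union q (left_mem_segment ℝ q w)
          (left_mem_segment ℝ q g) (convex_segment q g).isPreconnected)
    · refine union_subset f3 (union_subset (hcone w (hC.subset hwC).1 hwε) ?_)
      rw [segment_symm]; exact hqv
    · refine Set.disjoint_union_left.2 ⟨f4, Set.disjoint_union_left.2 ⟨?_, ?_⟩⟩
      · rw [Set.disjoint_left]
        intro c hc
        exact hballq ((convex_ball q ρ).segment_subset (Metric.mem_ball_self hρ) hwρ hc)
      · exact hl.disjoint_sight_line D h hqP hqs
  · intro w hw
    refine ⟨?_, hseg hw⟩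
    have hcl : openSegment ℝ ((x₁, 0) : Pt) (pt (x₁, 0) g l) ⊆ closure C := by
      intro w hw
      obtain ⟨r, r0, r1, rfl⟩ := mem_openSegment_iff.1 hw
      have e : pt (x₁, 0) (pt (x₁, 0) g l) r = pt (x₁, 0) g (r * l) := by ext <;> simp <;> ring
      rw [e]
      refine mem_closure_iff_frequently.2 ?_
      exact ((mem_closure_iff_frequently.1 (h.mem_closure_left (r * l))).and_eventually
        (hl.eventually_mem_pocket D h hC hzC hz hz0 (s := r * l) (by positivity)
          (mul_lt_of_lt_one_left hl0 r1))).mono fun c hc => hc.2 hc.1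
    exact closure_minimal hcl isClosed_closure (segment_subset_closure_openSegment hw)

/-- For g to the left of the foot, below the edge means to its left. A segment seen from w on that
side enters the pocket at once. It cannot leave it, since a point of it visible from g would make
all of it back to w visible. -/
theorem IsTouch.liesBelow (D : Dom P V a b) {g z : Pt} {x₁ x₂ κ l : ℝ} {C : Set Pt}
    (h : Fan P a b g x₁ x₂ κ) (hl : IsTouch P g x₁ κ l) (hC : SPocket P g C) (hzC : z ∈ C)
    (hz : z ∈ fanTriangle g x₁ x₂ κ) (hz0 : 0 < cr (x₁, 0) g z) (hgx : g.1 < x₁) :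
    SLiesBelow P C (x₁, 0) (pt (x₁, 0) g l) := by
  have hκ := h.pos
  have hl0 : 0 < l := by linarith [hl.le]
  have hl1 := hl.lt
  intro w hw q hqw hb
  obtain ⟨r, r0, r1, ew⟩ := mem_openSegment_iff.1 hw
  have e : pt (x₁, 0) (pt (x₁, 0) g l) r = pt (x₁, 0) g (r * l) := by ext <;> simp <;> ring
  rw [e] at ew
  have hrl0 : 0 < r * l := by positivity
  have hrl : r * l < l := mul_lt_of_lt_one_left hl0 r1
  have hlx : 0 < l * (x₁ - g.1) := mul_pos hl0 (by linarith)
  have hx : ((x₁, 0) : Pt).1 - (pt (x₁, 0) g l).1 = l * (x₁ - g.1) := by simp; ring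
  rw [isBelow_iff (by intro e; linarith), hx] at hb
  have hq0 : 0 < cr (x₁, 0) g q := by
    have : cr (x₁, 0) (pt (x₁, 0) g l) q = l * cr (x₁, 0) g q := by simp [cr]; ring
    rw [this] at hb
    exact (pos_iff_pos_of_mul_pos ((pos_iff_pos_of_mul_pos hb).1 hlx)).1 hl0
  have hwv : w ∈ svis P g := by rw [ew]; exact h.pt_mem_svis hrl0.le (by linarith)
  have hside : ∀ τ, 0 < τ → 0 < cr (x₁, 0) g (pt w q τ) := by
    intro τ hτ
    rw [cr_pt, ew, cr_pt_self, mul_zero, zero_add]; positivity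
  have hev : ∀ᶠ τ in 𝓝[>] (0 : ℝ), pt w q τ ∈ C := by
    have h1 := hl.eventually_mem_pocket D h hC hzC hz hz0 hrl0 hrl
    rw [← ew] at h1
    have h2 : Tendsto (pt w q) (𝓝[>] 0) (𝓝 w) := tendsto_shift w (q.1 - w.1, q.2 - w.2)
    filter_upwards [h2.eventually h1, self_mem_nhdsWithin] with τ h3 h4
    exact h3 (hside τ h4)
  have hinv : ∀ τ, 0 < τ → τ ≤ 1 → pt w q τ ∉ svis P g := by
    intro τ hτ hτ1 hv
    obtain ⟨σ, hσC, hσ0, hστ⟩ := (hev.and (Ioo_mem_nhdsGT hτ)).exists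
    refine (hC.subset hσC).2 (D.svis_of_mem_segment hwv ?_ hv ?_)
    · exact (segment_subset_left (pt_mem_segment hτ.le hτ1)).trans hqw
    · have := pt_mem_segment_pt (p := w) (q := q) hσ0.le hστ.le
      rwa [pt_zero] at this
  obtain ⟨σ, hσC, hσ0, hσ1⟩ := (hev.and (Ioo_mem_nhdsGT one_pos)).exists
  have hpre : IsPreconnected (pt w q '' Ioc 0 1) :=
    isPreconnected_Ioc.image _ (continuous_pt w q).continuousOn
  refine hC.subset_of_preconnected hpre ?_ (mem_image_of_mem _ ⟨hσ0, hσ1.le⟩) hσC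
    ⟨1, ⟨one_pos, le_rfl⟩, pt_one w q⟩
  rintro _ ⟨τ, ⟨t0, t1⟩, rfl⟩
  exact ⟨hqw (pt_mem_segment t0.le t1), hinv τ t0 t1⟩

theorem IsPair.height_pos {z g₁ g₂ p : Pt} {x₁ x₂ : ℝ} (D : Dom P V a b)
    (h : IsPair P a b z g₁ g₂ x₁ x₂ p) (hz0 : 0 < z.2) : 0 < p.2 := by
  obtain ⟨α, β, γ, hα, hβ, hγ, -, e, -⟩ := exists_weights h.mem
  have hp := D.upper p (by
    have := h.mem₁
    exact (show segment ℝ ((x₁, 0) : Pt) g₁ ⊆ P by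
      rw [segment_symm]; exact h.left.1.2.2) this)
  simp only at e
  refine lt_of_le_of_ne hp fun e' => ?_
  rw [← e'] at e
  linarith

theorem IsPair.exists_fan {z g₁ g₂ p : Pt} {x₁ x₂ : ℝ} (D : Dom P V a b) (hg₁ : g₁ ∈ P)
    (h : IsPair P a b z g₁ g₂ x₁ x₂ p) (hz0 : 0 < z.2) :
    ∃ κ, p = pt (x₁, 0) g₁ κ ∧ Fan P a b g₁ x₁ x₂ κ := by
  have hp0 := h.height_pos D hz0
  obtain ⟨κ, κ0, κ1, e⟩ := mem_segment_iff.1 h.mem₁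
  have e2 := congrArg Prod.snd e
  simp only [pt_snd] at e2
  have hg0 : 0 < g₁.2 := by
    by_contra! hle
    nlinarith
  have hκ : 0 < κ := by
    by_contra! hle
    nlinarith
  refine ⟨κ, e, h.left, h.right.1.1, h.lt, hκ, κ1, hg₁, hg0, ?_⟩
  rw [← e]
  exact (segment_subset_left h.mem₂).trans (by rw [segment_symm]; exact h.right.1.2.2)

/-- The first edge of a pair is a constructed edge; it is an upper edge if it leans to the left. -/
theorem IsPair.exists_constructed {z g₁ g₂ p : Pt} {x₁ x₂ : ℝ} (D : Dom P V a b) (hg₁ : g₁ ∈ P)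
    (h : IsPair P a b z g₁ g₂ x₁ x₂ p) (hz0 : 0 < z.2) (hz : z ∉ svis P g₁) :
    ∃ C y, SConstructed P g₁ C (x₁, 0) y ∧ p ∈ segment ℝ ((x₁, 0) : Pt) y ∧
      y ∈ openSegment ℝ ((x₁, 0) : Pt) g₁ ∧ (g₁.1 < x₁ → SLiesBelow P C (x₁, 0) y) := by
  obtain ⟨κ, rfl, hf⟩ := h.exists_fan D hg₁ hz0
  have hzT : z ∈ fanTriangle g₁ x₁ x₂ κ := h.mem
  have hzP := hf.triangle_subset D hzT
  have hκ := hf.pos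
  have hzcr : 0 < cr (x₁, 0) g₁ z := by
    obtain ⟨α, β, γ, hα, hβ, hγ, hs, -, hcr⟩ := exists_weights h.mem
    have e := hcr (x₁, 0) g₁
    rw [cr_pt_self, show cr ((x₁, 0) : Pt) g₁ (x₁, 0) = 0 by unfold cr; ring] at e
    have hX : cr ((x₁, 0) : Pt) g₁ (x₂, 0) = g₁.2 * (x₁ - x₂) := by simp [cr]; ring
    have hXpos : 0 < g₁.2 * (x₁ - x₂) := mul_pos hf.height (by linarith [h.lt])
    rw [hX] at e
    -- If z were on the sight line of `g₁`, it would be visible from `g₁`.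
    refine lt_of_le_of_ne (by rw [e]; simpa using mul_nonneg hγ hXpos.le) fun h0 => ?_
    apply hz
    have hg0 := hf.height
    have ez : z = pt (x₁, 0) g₁ (z.2 / g₁.2) := by
      have h0' := h0
      unfold cr at h0'
      simp at h0'
      ext
      · simp; field_simp; linarith
      · simp; field_simp
    rw [ez]
    refine hf.pt_mem_svis (by positivity) ?_
    rw [div_le_one hg0]
    obtain ⟨α, β, γ, hα, hβ, hγ, hs, e2, -⟩ := exists_weights h.mem
    simp at e2
    rw [e2]
    have h1 : β * κ ≤ 1 := mul_le_one₀ (by linarith) hκ.le hf.le_one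
    nlinarith
  obtain ⟨l, hl⟩ := hf.exists_isTouch D
  have hl0 : 0 < l := by linarith [hl.le]
  set C := connectedComponentIn (P \ svis P g₁) z with hCdef
  have hC : SPocket P g₁ C := ⟨z, ⟨hzP, hz⟩, rfl⟩
  have hzC : z ∈ C := mem_connectedComponentIn ⟨hzP, hz⟩
  refine ⟨C, pt (x₁, 0) g₁ l, hl.constructed D hf hC hzC hzT hzcr, ?_, hf.mem_openSegment hl0 hl.lt,
    hl.liesBelow D hf hC hzC hzT hzcr⟩
  have := pt_mem_segment_pt (p := ((x₁, 0) : Pt)) (q := g₁) hκ.le hl.le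
  rwa [pt_zero] at this

end WVPolygon

/-! ### Pairs with a shortest base and topmost crossings -/

namespace WVPolygon

open Filter Topology

variable {P V G : Set Pt} {a b : ℝ}

/-- `x y` is a constructed edge of a point of `G` that starts on the base. -/
def SBase (P : Set Pt) (a b : ℝ) (G : Set Pt) (x y : Pt) : Prop :=
  x ∈ segment ℝ ((a, 0) : Pt) (b, 0) ∧ ∃ g ∈ G, ∃ C, SConstructed P g C x y

/-- `x y` is an upper edge of a point of `G` that starts on the base. -/
def SUpper (P : Set Pt) (a b : ℝ) (G : Set Pt) (x y : Pt) : Prop :=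
  x ∈ segment ℝ ((a, 0) : Pt) (b, 0) ∧ ∃ g ∈ G, ∃ C, SConstructed P g C x y ∧ SLiesBelow P C x y

/-- An edge with lower endpoint `x'` below `x y` crosses `x y` in `p`. -/
def SCross (P : Set Pt) (a b : ℝ) (G : Set Pt) (x y p x' : Pt) : Prop :=
  p ∈ segment ℝ x y ∧ ∃ y', SBase P a b G x' y' ∧ p ∈ segment ℝ x' y' ∧ IsBelow x y x'

/-- The crossing is topmost. -/
def STop (P : Set Pt) (a b : ℝ) (G : Set Pt) (x y p x' : Pt) : Prop :=
  SCross P a b G x y p x' ∧ ∀ q x'', SCross P a b G x y q x'' → q.2 ≤ p.2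

theorem mir_mem_base {x : Pt} :
    mir x ∈ segment ℝ ((-b, 0) : Pt) (-a, 0) ↔ x ∈ segment ℝ ((a, 0) : Pt) (b, 0) := by
  rw [segment_symm]
  exact mir_mem_segment (p := (a, 0)) (q := (b, 0))

theorem SBase.mirror {x y : Pt} (h : SBase P a b G x y) :
    SBase (mirS P) (-b) (-a) (mirS G) (mir x) (mir y) := by
  obtain ⟨h1, g, hg, C, hC⟩ := h
  exact ⟨mir_mem_base.2 h1, mir g, by simpa using hg, mirS C, hC.mirror⟩

theorem SUpper.mirror {x y : Pt} (h : SUpper P a b G x y) :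
    SUpper (mirS P) (-b) (-a) (mirS G) (mir x) (mir y) := by
  obtain ⟨h1, g, hg, C, hC, hb⟩ := h
  exact ⟨mir_mem_base.2 h1, mir g, by simpa using hg, mirS C, hC.mirror, hb.mirror⟩

theorem SCross.mirror {x y p x' : Pt} (h : SCross P a b G x y p x') :
    SCross (mirS P) (-b) (-a) (mirS G) (mir x) (mir y) (mir p) (mir x') := by
  obtain ⟨h1, y', h2, h3, h4⟩ := h
  exact ⟨mir_mem_segment.2 h1, mir y', h2.mirror, mir_mem_segment.2 h3, isBelow_mir.2 h4⟩

theorem STop.mirror {x y p x' : Pt} (h : STop P a b G x y p x') :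
    STop (mirS P) (-b) (-a) (mirS G) (mir x) (mir y) (mir p) (mir x') := by
  refine ⟨h.1.mirror, fun q x'' hq => ?_⟩
  have := hq.mirror
  simp only [mirS_mirS, mir_mir, neg_neg] at this
  simpa using h.2 _ _ this

theorem mem_base {c : ℝ} (h1 : a ≤ c) (h2 : c ≤ b) :
    ((c, 0) : Pt) ∈ segment ℝ ((a, 0) : Pt) (b, 0) := by
  rcases eq_or_lt_of_le (h1.trans h2) with h | h
  · have : c = a := le_antisymm (by rw [h]; exact h2) h1
    rw [this]; exact left_mem_segment _ _ _
  · have h' : 0 < b - a := by linarith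
    refine mem_segment_iff.2 ⟨(c - a) / (b - a), div_nonneg (by linarith) h'.le, ?_, ?_⟩
    · rw [div_le_one h']; linarith
    · ext <;> simp; field_simp; ring

theorem of_mem_base (hab : a < b) {x : Pt} (h : x ∈ segment ℝ ((a, 0) : Pt) (b, 0)) :
    ∃ c, a ≤ c ∧ c ≤ b ∧ x = (c, 0) := by
  obtain ⟨t, t0, t1, rfl⟩ := mem_segment_iff.1 h
  refine ⟨a + t * (b - a), by nlinarith, by nlinarith, ?_⟩
  ext <;> simp

/-- The second edge of a pair is a constructed edge. -/
theorem IsPair.exists_constructed_right {z g₁ g₂ p : Pt} {x₁ x₂ : ℝ} (D : Dom P V a b)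
    (hg₂ : g₂ ∈ P) (h : IsPair P a b z g₁ g₂ x₁ x₂ p) (hz0 : 0 < z.2) (hz : z ∉ svis P g₂) :
    ∃ C y, SConstructed P g₂ C (x₂, 0) y ∧ p ∈ segment ℝ ((x₂, 0) : Pt) y := by
  obtain ⟨C, y, h1, h2, -⟩ := h.mirror.exists_constructed D.mirror (by simpa using hg₂) hz0
    (by rw [mir_mem_svis]; exact hz)
  have h1' := h1.mirror
  simp only [mirS_mirS, mir_mir, mir_mk, neg_neg] at h1'
  refine ⟨mirS C, mir y, h1', ?_⟩
  rw [← mir_mem_segment, mir_mir]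
  exact h2

/-- Two chords from the base cross. -/
theorem exists_crossing {x₂ c : ℝ} {W B : Pt} (hc : x₂ < c) (hW : 0 < W.2) (hB : 0 < B.2)
    (h1 : 0 ≤ cr (x₂, 0) W B) (h2 : cr (c, 0) B W ≤ 0) :
    ∃ τ σ, 0 < τ ∧ τ ≤ 1 ∧ 0 < σ ∧ σ ≤ 1 ∧ pt (c, 0) B τ = pt (x₂, 0) W σ := by
  have hk : 0 < (c - x₂) * W.2 := mul_pos (by linarith) hW
  set κ := cr (x₂, 0) W B + (c - x₂) * W.2 with hκ
  have hκ0 : 0 < κ := by linarith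
  set τ := (c - x₂) * W.2 / κ with hτ
  have hτ0 : 0 < τ := by positivity
  have hτκ : τ * κ = (c - x₂) * W.2 := by rw [hτ]; field_simp
  have hτ1 : τ ≤ 1 := by rw [hτ, div_le_one hκ0]; linarith
  set σ := τ * B.2 / W.2 with hσ
  have hσ0 : 0 < σ := by positivity
  have hσW : σ * W.2 = τ * B.2 := by rw [hσ]; field_simp
  have e : pt (c, 0) B τ = pt (x₂, 0) W σ := by
    ext
    · have : W.2 * (c + τ * (B.1 - c)) = W.2 * (x₂ + σ * (W.1 - x₂)) := by
        rw [hκ] at hτκ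
        simp only [cr] at hτκ
        linear_combination -hτκ - (W.1 - x₂) * hσW
      simpa using mul_left_cancel₀ hW.ne' this
    · simp; linarith
  refine ⟨τ, σ, hτ0, hτ1, hσ0, ?_, e⟩
  have e0 : cr (c, 0) B (pt (c, 0) B τ) = 0 := cr_pt_self _ _ _
  rw [e, cr_pt] at e0
  have e1 : cr (c, 0) B (x₂, 0) = B.2 * (c - x₂) := by simp [cr]; ring
  rw [e1] at e0
  have hpos : 0 < B.2 * (c - x₂) := mul_pos hB (by linarith)
  by_contra! hlt
  have h3 : σ * cr (c, 0) B W ≤ 0 := mul_nonpos_of_nonneg_of_nonpos hσ0.le h2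
  nlinarith

theorem cr_base (c d : ℝ) (p : Pt) : cr (c, 0) p (d, 0) = (c - d) * p.2 := by simp [cr]; ring

theorem cr_base' (c d : ℝ) (p : Pt) : cr (c, 0) (d, 0) p = (d - c) * p.2 := by simp [cr]

theorem cr_scale (c : ℝ) (p q : Pt) (t : ℝ) : cr (c, 0) (pt (c, 0) p t) q = t * cr (c, 0) p q := by
  simp [cr]; ring

theorem mem_triangle_base {c d : ℝ} {p z : Pt} (hdc : d < c) (hp : 0 < p.2) (hz : 0 ≤ z.2)
    (h1 : 0 ≤ cr (c, 0) p z) (h2 : cr (d, 0) p z ≤ 0) : z ∈ triangle (c, 0) p (d, 0) := by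
  refine mem_triangle_of_cr ?_ h1 ?_ ?_
  · rw [cr_base]; exact mul_pos (by linarith) hp
  · rw [cr_swap]; linarith
  · rw [cr_base']; exact mul_nonneg (by linarith) hz

theorem of_mem_triangle_base {c d : ℝ} {p z : Pt} (hdc : d < c) (hp : 0 < p.2)
    (hz : z ∈ triangle (c, 0) p (d, 0)) : 0 ≤ cr (c, 0) p z ∧ cr (d, 0) p z ≤ 0 := by
  have h0 : 0 ≤ cr (c, 0) p (d, 0) := by
    rw [cr_base]; exact mul_nonneg (by linarith) hp.le
  obtain ⟨h1, h2, -⟩ := cr_nonneg_of_mem_triangle h0 hz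
  refine ⟨h1, ?_⟩
  rw [cr_swap] at h2; linarith

/-- If `z` is on the left of an edge that crosses the first edge of a pair at or above the apex, and
starts inside the base of the pair, then there is a pair with a shorter base. -/
theorem IsPair.exists_shorter {z g₁ g₂ g p q y : Pt} {x₁ x₂ c : ℝ} (D : Dom P V a b)
    (h : IsPair P a b z g₁ g₂ x₁ x₂ p) (hz0 : 0 < z.2)
    (hg : g ∈ P) (hzg : z ∉ svis P g) (hq : p ∈ segment ℝ ((x₁, 0) : Pt) q)
    (hy : y ∈ openSegment ℝ ((c, 0) : Pt) g) (hyq : q ∈ segment ℝ ((c, 0) : Pt) y)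
    (hcg : ((c, 0) : Pt) ∈ svis P g) (hxc : x₂ < c) (hcx : c < x₁) (hleft : 0 < cr (c, 0) q z) :
    ∃ x p', x < x₁ ∧ IsPair P a b z g g₂ x x₂ p' := by
  have hp0 := h.height_pos D hz0
  have hac : a ≤ c := h.right.1.1.trans hxc.le
  have hcb : c ≤ b := hcx.le.trans h.left.1.2.1
  obtain ⟨ρ, ρ0, ρ1, ep⟩ := mem_segment_iff.1 hq
  have hp2 := congrArg Prod.snd ep
  simp only [pt_snd] at hp2
  have hq0 : 0 < q.2 := by
    by_contra! hle
    nlinarith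
  have hρ : 0 < ρ := by
    by_contra! hle
    nlinarith
  have hqg : q ∈ segment ℝ ((c, 0) : Pt) g :=
    segment_subset_left (openSegment_subset_segment ℝ _ _ hy) hyq
  obtain ⟨ν, ν0, ν1, eq⟩ := mem_segment_iff.1 hqg
  have hq2 := congrArg Prod.snd eq
  simp only [pt_snd] at hq2
  have hg0 : 0 < g.2 := by
    by_contra! hle
    nlinarith
  have hν : 0 < ν := by
    by_contra! hle
    nlinarith
  obtain ⟨zl, zr⟩ := of_mem_triangle_base h.lt hp0 h.mem
  -- the crossing of the edge of `g` with the second edge of the pair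
  obtain ⟨τ, σ, τ0, τ1, σ0, σ1, e⟩ := exists_crossing (x₂ := x₂) (c := c) (W := p) (B := q) hxc hp0 hq0
    (by
      have e1 : ρ * cr (x₂, 0) p q = (1 - ρ) * ((x₁ - x₂) * p.2) := by
        have := cr_pt (x₂, 0) p (x₁, 0) q ρ
        rw [← ep, cr_base, show cr (x₂, 0) p p = 0 by unfold cr; ring] at this
        linarith
      have e2 : 0 ≤ (1 - ρ) * ((x₁ - x₂) * p.2) :=
        mul_nonneg (by linarith) (mul_nonneg (by linarith [h.lt]) hp0.le)
      rw [← e1] at e2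
      exact nonneg_of_mul_nonneg_right e2 hρ)
    (by
      rw [ep, cr_pt, cr_base, show cr (c, 0) q q = 0 by unfold cr; ring]
      have : 0 ≤ (1 - ρ) * ((x₁ - c) * q.2) :=
        mul_nonneg (by linarith) (mul_nonneg (by linarith) hq0.le)
      linarith)
  set w := pt (c, 0) q τ with hw
  have hw0 : 0 < w.2 := by rw [hw]; simp; positivity
  have hwg : w = pt (c, 0) g (τ * ν) := by rw [hw, eq]; ext <;> simp <;> ring
  have hτν : τ * ν ≤ 1 := mul_le_one₀ τ1 ν0 ν1
  have hτν0 : 0 < τ * ν := mul_pos τ0 hν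
  have hzw : cr (x₂, 0) w z ≤ 0 := by
    rw [e, cr_scale]; exact mul_nonpos_of_nonneg_of_nonpos σ0.le zr
  have hzcg : 0 < cr (c, 0) g z := by
    have : cr (c, 0) q z = ν * cr (c, 0) g z := by rw [eq, cr_scale]
    rw [this] at hleft
    exact (pos_iff_pos_of_mul_pos hleft).1 hν
  have hzcw : 0 ≤ cr (c, 0) w z := by rw [hwg, cr_scale]; positivity
  have hzT : z ∈ triangle (c, 0) w (x₂, 0) := mem_triangle_base hxc hw0 hz0.le hzcw hzw
  obtain ⟨x, hx⟩ := D.exists_isLeftEnd hg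
  have hxc' : x ≤ c := hx.2 c ⟨hac, hcb, hcg⟩
  -- If g saw a base point not to the right of x₂, it would see x₂ and so the triangle g, (c, 0),
  -- (x₂, 0), which contains z.
  have hxx₂ : x₂ < x := by
    by_contra! hle
    have hX' := D.seesBase_of_between hx.1 ⟨hac, hcb, hcg⟩ hle hxc.le
    have hT := D.triangle_subset_svis hcg (D.base_segment hac hcb hX'.1 hX'.2.1) hX'.2.2
    apply hzg
    apply hT
    refine triangle_subset_of_convex (convex_triangle g (c, 0) (x₂, 0)) (mid_mem_triangle _ _ _) ?_
      (right_mem_triangle _ _ _) hzT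
    refine (convex_triangle _ _ _).segment_subset (mid_mem_triangle _ _ _) (left_mem_triangle _ _ _)
      ?_
    rw [hwg]
    exact pt_mem_segment hτν0.le hτν
  -- the crossing of the leftmost sight line of `g` with the second edge of the pair
  obtain ⟨τ', σ', τ0', τ1', σ0', σ1', e'⟩ := exists_crossing (x₂ := x₂) (c := x) (W := w) (B := g)
    hxx₂ hw0 hg0
    (by
      have e1 : (τ * ν) * cr (x₂, 0) w g = (1 - τ * ν) * ((c - x₂) * w.2) := by
        have := cr_pt (x₂, 0) w (c, 0) g (τ * ν)
        rw [← hwg, cr_base, show cr (x₂, 0) w w = 0 by unfold cr; ring] at this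
        linarith
      have e2 : 0 ≤ (1 - τ * ν) * ((c - x₂) * w.2) :=
        mul_nonneg (by linarith) (mul_nonneg (by linarith) hw0.le)
      rw [← e1] at e2
      exact nonneg_of_mul_nonneg_right e2 hτν0)
    (by
      rw [hwg, cr_pt, cr_base, show cr (x, 0) g g = 0 by unfold cr; ring]
      have : 0 ≤ (1 - τ * ν) * ((c - x) * g.2) :=
        mul_nonneg (by linarith) (mul_nonneg (by linarith) hg0.le)
      linarith)
  -- To the right of the leftmost sight line of g, z would be in the triangle (c, 0), g, (x, 0),
  -- which g sees.
  have hzx : 0 ≤ cr (x, 0) g z := by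
    by_contra! hneg
    have hxlt : x < c := by
      refine lt_of_le_of_ne hxc' fun e => ?_
      rw [e] at hneg; linarith
    apply hzg
    refine D.triangle_subset_svis hcg (D.base_segment hac hcb hx.1.1 hx.1.2.1) hx.1.2.2 ?_
    rw [triangle_reverse, triangle_rotate]
    refine mem_triangle_base hxlt hg0 hz0.le hzcg.le hneg.le
  refine ⟨x, pt (x, 0) g τ', by linarith, hx, h.right, hxx₂, pt_mem_segment τ0'.le τ1', ?_, ?_⟩
  · refine segment_subset_left h.mem₂ ?_
    rw [e', e]
    have : pt (x₂, 0) (pt (x₂, 0) p σ) σ' = pt (x₂, 0) p (σ' * σ) := by ext <;> simp <;> ring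
    rw [this]
    exact pt_mem_segment (by positivity) (mul_le_one₀ σ1' σ0.le σ1)
  · refine mem_triangle_base hxx₂ (by simp; positivity) hz0.le ?_ ?_
    · rw [cr_scale]; positivity
    · rw [e', cr_scale]; exact mul_nonpos_of_nonneg_of_nonpos σ0'.le hzw

/-- For a pair with a shortest base whose first edge leans to the left, that edge is an upper edge,
and every topmost crossing on it forms a triangle that contains `z`. -/
theorem IsPair.mem_triangle_of_isTop {z g₁ g₂ p : Pt} {x₁ x₂ : ℝ} (D : Dom P V a b) (hG : G ⊆ P)
    (h : IsPair P a b z g₁ g₂ x₁ x₂ p) (hg₁ : g₁ ∈ G) (hg₂ : g₂ ∈ G) (hz0 : 0 < z.2)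
    (hz : ∀ g ∈ G, z ∉ svis P g)
    (hmin : ∀ g₁' ∈ G, ∀ g₂' ∈ G, ∀ x₁' x₂' p', IsPair P a b z g₁' g₂' x₁' x₂' p' →
      x₁ - x₂ ≤ x₁' - x₂') (hgx : g₁.1 < x₁) :
    ∃ x y, SUpper P a b G x y ∧ (∃ p x', SCross P a b G x y p x') ∧
      ∀ p x', STop P a b G x y p x' → z ∈ triangle x p x' := by
  have hp0 := h.height_pos D hz0
  obtain ⟨C, y, hC, hpy, hy, hb⟩ := h.exists_constructed D (hG hg₁) hz0 (hz g₁ hg₁)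
  obtain ⟨C', y', hC', hpy'⟩ := h.exists_constructed_right D (hG hg₂) hz0 (hz g₂ hg₂)
  have hb := hb hgx
  have hx₁ := mem_base h.left.1.1 h.left.1.2.1
  have hx₂ := mem_base h.right.1.1 h.right.1.2.1
  obtain ⟨l, l0, l1, ey⟩ := mem_openSegment_iff.1 hy
  have ey1 := congrArg Prod.fst ey
  have ey2 := congrArg Prod.snd ey
  simp only [pt_fst, pt_snd] at ey1 ey2
  have hyx : 0 < x₁ - y.1 := by
    have := mul_pos l0 (show 0 < x₁ - g₁.1 by linarith); linarith
  obtain ⟨ρ, ρ0, ρ1, ep⟩ := mem_segment_iff.1 hpy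
  have ep2 := congrArg Prod.snd ep
  simp only [pt_snd] at ep2
  have hy0 : 0 < y.2 := by
    by_contra! hle
    nlinarith
  have hbelow : ∀ c : ℝ, IsBelow (x₁, 0) y (c, 0) ↔ c < x₁ := by
    intro c
    rw [isBelow_iff (by simp only; linarith), cr_base]
    simp only
    constructor
    · intro h
      have h1 := (pos_iff_pos_of_mul_pos h).1 hyx
      have := (pos_iff_pos_of_mul_pos h1).2 hy0
      linarith
    · intro h
      exact mul_pos hyx (mul_pos (by linarith) hy0)
  have hcross : SCross P a b G (x₁, 0) y p (x₂, 0) :=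
    ⟨hpy, y', ⟨hx₂, g₂, hg₂, C', hC'⟩, hpy', (hbelow x₂).2 h.lt⟩
  refine ⟨(x₁, 0), y, ⟨hx₁, g₁, hg₁, C, hC, hb⟩, ⟨p, (x₂, 0), hcross⟩, ?_⟩
  rintro q x' ⟨⟨hqy, y'', ⟨hx', g, hg, C'', hC''⟩, hqy'', hbel⟩, htop⟩
  obtain ⟨c, hac, hcb, rfl⟩ := of_mem_base D.lt hx'
  have hcx := (hbelow c).1 hbel
  -- The apex p of the pair is itself a crossing on this edge, so the topmost crossing q is not
  -- lower.
  have hpq := htop _ _ hcross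
  have hq0 : 0 < q.2 := by linarith
  obtain ⟨ν, ν0, ν1, eq⟩ := mem_segment_iff.1 hqy
  have eq2 := congrArg Prod.snd eq
  simp only [pt_snd] at eq2
  have hρν : ρ ≤ ν := by nlinarith
  have hpq : p ∈ segment ℝ ((x₁, 0) : Pt) q := by
    have := pt_mem_segment_pt (p := ((x₁, 0) : Pt)) (q := y) ρ0 hρν
    rwa [pt_zero, ← ep, ← eq] at this
  -- If c ≤ x₂, the triangle contains that of the pair. Otherwise z can be outside only on the left
  -- of the edge from c, and then `IsPair.exists_shorter` contradicts minimality.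
  rcases le_or_gt c x₂ with hle | hlt
  · refine triangle_subset_of_convex (convex_triangle (x₁, 0) q (c, 0)) (left_mem_triangle _ _ _)
      ?_ ?_ h.mem
    · exact (convex_triangle _ _ _).segment_subset (left_mem_triangle _ _ _)
        (mid_mem_triangle _ _ _) hpq
    · exact (convex_triangle _ _ _).segment_subset (right_mem_triangle _ _ _)
        (left_mem_triangle _ _ _) (mem_base hle h.lt.le)
  · rcases le_or_gt (cr (c, 0) q z) 0 with hr | hl
    · refine mem_triangle_base hcx hq0 hz0.le ?_ hr
      have hρ : 0 < ρ := by
        by_contra! hle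
        nlinarith
      have h1 := (of_mem_triangle_base h.lt hp0 h.mem).1
      rw [ep, cr_scale] at h1
      have h2 := nonneg_of_mul_nonneg_right h1 hρ
      rw [eq, cr_scale]
      positivity
    · exfalso
      have hy'' : 0 < y''.2 := by
        obtain ⟨r, r0, r1, er⟩ := mem_segment_iff.1 hqy''
        have er2 := congrArg Prod.snd er
        simp only [pt_snd] at er2
        by_contra! hle
        nlinarith
      have ho := D.constructed_openSegment (hG hg) hC'' rfl hy''
      obtain ⟨x, p', hx, hpair⟩ := h.exists_shorter D hz0 (hG hg) (hz g hg) hpq ho hqy''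
        (hC''.mem_svis (left_mem_segment ℝ _ _)) hlt hcx hl
      have := hmin g hg g₂ hg₂ _ _ _ hpair
      linarith

theorem IsLeftEnd.unique {g : Pt} {x x' : ℝ} (h : IsLeftEnd P a b g x) (h' : IsLeftEnd P a b g x') :
    x = x' := le_antisymm (h.2 _ h'.1) (h'.2 _ h.1)

theorem IsRightEnd.unique {g : Pt} {x x' : ℝ} (h : IsRightEnd P a b g x)
    (h' : IsRightEnd P a b g x') : x = x' := le_antisymm (h'.2 _ h.1) (h.2 _ h'.1)

/-- A pair with a shortest base. -/
theorem Dom.exists_shortest_isPair (D : Dom P V a b) (hG : G.Finite) (hGP : G ⊆ P)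
    (hguard : ∀ e ∈ frontier P, ∃ g ∈ G, e ∈ svis P g) {z : Pt} (hzP : z ∈ P) (hz0 : 0 < z.2)
    (hz : ∀ g ∈ G, z ∉ svis P g) :
    ∃ g₁ ∈ G, ∃ g₂ ∈ G, ∃ x₁ x₂ p, IsPair P a b z g₁ g₂ x₁ x₂ p ∧
      ∀ g₁' ∈ G, ∀ g₂' ∈ G, ∀ x₁' x₂' p', IsPair P a b z g₁' g₂' x₁' x₂' p' →
        x₁ - x₂ ≤ x₁' - x₂' := by
  set S : Set (Pt × Pt) := {w | w.1 ∈ G ∧ w.2 ∈ G ∧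
    ∃ x₁ x₂ p, IsPair P a b z w.1 w.2 x₁ x₂ p} with hS
  have hfin : S.Finite := (hG.prod hG).subset fun w hw => ⟨hw.1, hw.2.1⟩
  -- The feet are determined by the two points of G, so the base length is a function on a finite
  -- set.
  have hlen : ∀ w : Pt × Pt, ∃ d : ℝ, ∀ x₁ x₂ p, IsPair P a b z w.1 w.2 x₁ x₂ p → d = x₁ - x₂ := by
    intro w
    by_cases h : ∃ x₁ x₂ p, IsPair P a b z w.1 w.2 x₁ x₂ p
    · obtain ⟨x₁, x₂, p, hp⟩ := h
      refine ⟨x₁ - x₂, fun x₁' x₂' p' hp' => ?_⟩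
      rw [hp.left.unique hp'.left, hp.right.unique hp'.right]
    · exact ⟨0, fun x₁ x₂ p hp => absurd ⟨x₁, x₂, p, hp⟩ h⟩
  choose d hd using hlen
  obtain ⟨g₁, hg₁, g₂, hg₂, x₁, x₂, p, hp⟩ := D.exists_isPair hG hGP hguard hzP hz0 hz
  obtain ⟨w, ⟨h1, h2, y₁, y₂, q, hq⟩, hmin⟩ :=
    S.exists_min_image d hfin ⟨(g₁, g₂), hg₁, hg₂, x₁, x₂, p, hp⟩
  refine ⟨w.1, h1, w.2, h2, y₁, y₂, q, hq, fun g₁' hg₁' g₂' hg₂' x₁' x₂' p' hp' => ?_⟩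
  have := hmin (g₁', g₂') ⟨hg₁', hg₂', x₁', x₂', p', hp'⟩
  rwa [hd w _ _ _ hq, hd (g₁', g₂') _ _ _ hp'] at this

/-- Every point not seen from `G` lies in the triangle of some upper edge. -/
theorem Dom.exists_upper_edge (D : Dom P V a b) (hG : G.Finite) (hGP : G ⊆ P)
    (hguard : ∀ e ∈ frontier P, ∃ g ∈ G, e ∈ svis P g) {z : Pt} (hzP : z ∈ P) (hz0 : 0 < z.2)
    (hz : ∀ g ∈ G, z ∉ svis P g) :
    ∃ x y, SUpper P a b G x y ∧ (∃ p x', SCross P a b G x y p x') ∧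
      ∀ p x', STop P a b G x y p x' → z ∈ triangle x p x' := by
  obtain ⟨g₁, hg₁, g₂, hg₂, x₁, x₂, p, hp, hmin⟩ :=
    D.exists_shortest_isPair hG hGP hguard hzP hz0 hz
  by_cases h1 : g₁.1 < x₁
  · exact hp.mem_triangle_of_isTop D hGP hg₁ hg₂ hz0 hz hmin h1
  -- If neither edge leaned inwards, p would be at or right of x₁ and at or left of x₂.
  · have h2 : x₂ < g₂.1 := by
      by_contra! h2
      obtain ⟨r, r0, r1, e⟩ := mem_segment_iff.1 hp.mem₁
      obtain ⟨s, s0, s1, e'⟩ := mem_segment_iff.1 hp.mem₂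
      have i1 := congrArg Prod.fst e
      have i2 := congrArg Prod.fst e'
      simp only [pt_fst] at i1 i2
      have := mul_nonneg r0 (show 0 ≤ g₁.1 - x₁ by linarith)
      have := mul_nonneg s0 (show 0 ≤ x₂ - g₂.1 by linarith)
      linarith [hp.lt]
    have hz' : ∀ g ∈ mirS G, mir z ∉ svis (mirS P) g := by
      intro g hg
      rw [← mir_mir g, mir_mem_svis]
      exact hz _ hg
    obtain ⟨x, y, hu, ⟨q, x', hq⟩, hT⟩ := hp.mirror.mem_triangle_of_isTop D.mirror
      (G := mirS G) (fun g hg => hGP hg) (by simpa using hg₂) (by simpa using hg₁) hz0 hz'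
      (fun g₁' hg₁' g₂' hg₂' x₁' x₂' p' hp' => by
        have := hmin _ hg₂' _ hg₁' _ _ _ (by simpa using hp'.mirror)
        linarith) (by simp; linarith)
    have hu' := hu.mirror
    have hq' := hq.mirror
    simp only [mirS_mirS, neg_neg] at hu' hq'
    refine ⟨mir x, mir y, hu', ⟨mir q, mir x', hq'⟩, fun p x' ht => ?_⟩
    have := hT _ _ (by simpa using ht.mirror)
    rw [← mir_mem_triangle, mir_mir]
    exact this

end WVPolygon

/-! ### Existence of topmost crossings, and location of holes -/

namespace WVPolygon

open Filter Topology

variable {P V G : Set Pt} {a b : ℝ}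

theorem Dom.mem_frontier_of_height (D : Dom P V a b) {z : Pt} (hz : z ∈ P) (h : z.2 = 0) :
    z ∈ frontier P := by
  refine ⟨subset_closure hz, fun hint => ?_⟩
  obtain ⟨s, hs, hs0⟩ := (((tendsto_shift z (0, -1)).eventually
    (mem_interior_iff_mem_nhds.1 hint)).and self_mem_nhdsWithin).exists
  have hs0' : 0 < s := hs0
  have := D.upper _ hs
  simp [shift, h] at this
  linarith

theorem Dom.base_mem_frontier (D : Dom P V a b) {x : Pt}
    (hx : x ∈ segment ℝ ((a, 0) : Pt) (b, 0)) : x ∈ frontier P := by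
  obtain ⟨c, h1, h2, rfl⟩ := of_mem_base D.lt hx
  exact D.mem_frontier_of_height (D.base c h1 h2) rfl

theorem mem_segment_of_mem_triangle {A B C w : Pt} (h : cr A B C ≠ 0) (hw : w ∈ triangle A B C)
    (h0 : cr A B w = 0) : w ∈ segment ℝ A B := by
  obtain ⟨α, β, γ, hα, hβ, hγ, hs, ew⟩ := mem_triangle_iff.1 hw
  have hα' : α = 1 - β - γ := by linarith
  have e : cr A B w = γ * cr A B C := by rw [ew, hα']; unfold cr; ring
  rw [e] at h0
  have hγ0 := (mul_eq_zero.1 h0).resolve_right h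
  refine mem_segment_iff.2 ⟨β, hβ, by linarith, ?_⟩
  rw [ew, hα', hγ0]
  ext <;> simp <;> ring

/-- A connected set that misses the sides of a triangle but contains one of its points lies in the
triangle. -/
theorem IsPreconnected.subset_triangle {A B C z : Pt} {H : Set Pt} (hH : IsPreconnected H)
    (h : cr A B C ≠ 0) (h1 : Disjoint H (segment ℝ A B)) (h2 : Disjoint H (segment ℝ B C))
    (h3 : Disjoint H (segment ℝ C A)) (hzH : z ∈ H) (hz : z ∈ triangle A B C) :
    H ⊆ triangle A B C := by
  wlog hpos : 0 < cr A B C generalizing A B C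
  · have e : cr C B A = - cr A B C := by unfold cr; ring
    rw [triangle_reverse] at hz ⊢
    rw [segment_symm] at h1 h2 h3
    exact this (by rw [e]; exact neg_ne_zero.2 h) h2 h1 h3 hz
      (by rw [e]; exact neg_pos.2 (lt_of_le_of_ne (not_lt.1 hpos) h))
  have hclosed : IsClosed (triangle A B C) := by
    have : triangle A B C = {w | 0 ≤ cr A B w} ∩ {w | 0 ≤ cr B C w} ∩ {w | 0 ≤ cr C A w} := by
      ext w
      constructor
      · intro hw
        obtain ⟨i1, i2, i3⟩ := cr_nonneg_of_mem_triangle hpos.le hw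
        exact ⟨⟨i1, i2⟩, i3⟩
      · rintro ⟨⟨i1, i2⟩, i3⟩
        exact mem_triangle_of_cr hpos i1 i2 i3
    rw [this]
    exact ((isClosed_le continuous_const (continuous_cr A B)).inter
      (isClosed_le continuous_const (continuous_cr B C))).inter
      (isClosed_le continuous_const (continuous_cr C A))
  set U : Set Pt := {w | 0 < cr A B w} ∩ {w | 0 < cr B C w} ∩ {w | 0 < cr C A w} with hU
  have hUo : IsOpen U := ((isOpen_lt continuous_const (continuous_cr A B)).inter
      (isOpen_lt continuous_const (continuous_cr B C))).inter
      (isOpen_lt continuous_const (continuous_cr C A))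
  have hUT : U ⊆ triangle A B C := by
    rintro w ⟨⟨i1, i2⟩, i3⟩
    exact mem_triangle_of_cr hpos (le_of_lt i1) (le_of_lt i2) (le_of_lt i3)
  have hin : ∀ w ∈ H, w ∈ triangle A B C → w ∈ U := by
    intro w hwH hw
    obtain ⟨i1, i2, i3⟩ := cr_nonneg_of_mem_triangle hpos.le hw
    refine ⟨⟨lt_of_le_of_ne i1 fun e => ?_, lt_of_le_of_ne i2 fun e => ?_⟩,
      lt_of_le_of_ne i3 fun e => ?_⟩
    · exact Set.disjoint_left.1 h1 hwH (mem_segment_of_mem_triangle h hw e.symm)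
    · rw [triangle_rotate] at hw
      rw [cr_rotate] at h
      exact Set.disjoint_left.1 h2 hwH (mem_segment_of_mem_triangle h hw e.symm)
    · rw [triangle_rotate, triangle_rotate] at hw
      rw [cr_rotate, cr_rotate] at h
      exact Set.disjoint_left.1 h3 hwH (mem_segment_of_mem_triangle h hw e.symm)
  have := hH.subset_left_of_subset_union hUo hclosed.isOpen_compl
    (Set.disjoint_left.2 fun w hw hw' => hw' (hUT hw))
    (fun w hw => by
      by_cases hwT : w ∈ triangle A B C
      · exact Or.inl (hin w hw hwT)
      · exact Or.inr hwT) ⟨z, hzH, hin z hzH hz⟩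
  exact this.trans hUT

theorem SCross.facts (D : Dom P V a b) {x y p x' : Pt} (hu : SUpper P a b G x y)
    (h : SCross P a b G x y p x') : ∃ c c', a ≤ c ∧ c ≤ b ∧ a ≤ c' ∧ c' ≤ b ∧ x = (c, 0) ∧
      x' = (c', 0) ∧ c ≠ c' ∧ 0 < y.2 := by
  obtain ⟨hx, g, hg, C, hC, hb⟩ := hu
  obtain ⟨-, y', ⟨hx', -⟩, -, hbel⟩ := h
  obtain ⟨c, h1, h2, rfl⟩ := of_mem_base D.lt hx
  obtain ⟨c', h1', h2', rfl⟩ := of_mem_base D.lt hx'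
  rw [isBelow_iff (hC.not_vertical hb), cr_base] at hbel
  refine ⟨c, c', h1, h2, h1', h2', rfl, rfl, ?_, lt_of_le_of_ne hC.le ?_⟩
  · rintro rfl; simp at hbel
  · intro e
    have e' : y.2 = 0 := e.symm
    rw [e'] at hbel; simp at hbel

/-- The triangle of a crossing is guarded by a vertex. -/
theorem SCross.exists_vertex_guard (D : Dom P V a b) (hG : G ⊆ P) {x y p x' : Pt}
    (hu : SUpper P a b G x y) (h : SCross P a b G x y p x') :
    ∃ w ∈ V, triangle x p x' ⊆ svis P w := by
  obtain ⟨c, c', -, -, -, -, rfl, rfl, hne, hy0⟩ := h.facts D hu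
  obtain ⟨hx, g, hg, C, hC, hb⟩ := hu
  obtain ⟨hp, y', ⟨hx', g', hg', C', hC'⟩, hp', hbel⟩ := h
  refine D.exists_vertex_guard hx hx' hC.segment_subset hp
    ((segment_subset_left hp').trans hC'.segment_subset) ?_ hy0 ?_
  · exact D.constructed_vertex hC (D.constructed_openSegment (hG hg) hC rfl hy0)
  · intro e; exact hne (congrArg Prod.fst e)

/-- This bounds the number of crossings above the base. The line through g' and y' meets the axis
once, so g' and y' determine the foot x'; the line x' y' meets the segment x y at most once, as x is
not on it. -/
theorem Dom.subsingleton_crossing (D : Dom P V a b) (hG : G ⊆ P) {x y g' y' : Pt}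
    (hg' : g' ∈ G) (hu : SUpper P a b G x y) :
    {p | 0 < p.2 ∧ p ∈ segment ℝ x y ∧ ∃ x' C', x' ∈ segment ℝ ((a, 0) : Pt) (b, 0) ∧
      SConstructed P g' C' x' y' ∧ p ∈ segment ℝ x' y' ∧ IsBelow x y x'}.Subsingleton := by
  have key : ∀ c p C', 0 < p.2 → a ≤ c → c ≤ b → SConstructed P g' C' (c, 0) y' →
      p ∈ segment ℝ ((c, 0) : Pt) y' →
      0 < y'.2 ∧ y'.2 < g'.2 ∧ (c - y'.1) * g'.2 = (c - g'.1) * y'.2 := by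
    intro c p C' hp0 h1 h2 hC hp
    obtain ⟨r, r0, r1, e⟩ := mem_segment_iff.1 hp
    have e2 := congrArg Prod.snd e
    simp only [pt_snd] at e2
    have hy : 0 < y'.2 := by
      by_contra! hle
      nlinarith
    obtain ⟨t, t0, t1, ey⟩ := mem_openSegment_iff.1
      (D.constructed_openSegment (hG hg') hC rfl hy)
    have y1 := congrArg Prod.fst ey
    have y2 := congrArg Prod.snd ey
    simp only [pt_fst, pt_snd] at y1 y2
    refine ⟨hy, ?_, ?_⟩
    · have : 0 < g'.2 := by
        by_contra! hle
        nlinarith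
      nlinarith
    · rw [y1, y2]; ring
  obtain ⟨hx, g, hg, C, hC, hb⟩ := hu
  rintro p ⟨hp0, hpxy, x₁, C₁, hx₁, hC₁, hp₁, hb₁⟩ q ⟨hq0, hqxy, x₂, C₂, hx₂, hC₂, hq₂, -⟩
  obtain ⟨c, h1, h2, rfl⟩ := of_mem_base D.lt hx
  obtain ⟨c₁, i1, i2, rfl⟩ := of_mem_base D.lt hx₁
  obtain ⟨c₂, j1, j2, rfl⟩ := of_mem_base D.lt hx₂
  obtain ⟨k1, k2, k3⟩ := key c₁ p C₁ hp0 i1 i2 hC₁ hp₁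
  obtain ⟨-, -, l3⟩ := key c₂ q C₂ hq0 j1 j2 hC₂ hq₂
  have hcc : c₁ = c₂ := by
    have : (c₁ - c₂) * (g'.2 - y'.2) = 0 := by linear_combination k3 - l3
    have := (mul_eq_zero.1 this).resolve_right (by linarith)
    linarith
  subst hcc
  have hne : c ≠ c₁ := by
    rintro rfl
    rw [isBelow_iff (hC.not_vertical hb), cr_base] at hb₁
    simp at hb₁
  have hline : ∀ w ∈ segment ℝ ((c₁, 0) : Pt) y', cr (c₁, 0) y' w = 0 := by
    intro w hw
    obtain ⟨r, -, -, rfl⟩ := mem_segment_iff.1 hw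
    exact cr_pt_self _ _ _
  have e1 := hline p hp₁
  have e2 := hline q hq₂
  obtain ⟨s, s0, s1, rfl⟩ := mem_segment_iff.1 hpxy
  obtain ⟨r, r0, r1, rfl⟩ := mem_segment_iff.1 hqxy
  rw [cr_pt] at e1 e2
  set A := cr (c₁, 0) y' (c, 0) with hA
  set B := cr (c₁, 0) y' y with hB
  have hA0 : A ≠ 0 := by
    rw [hA, cr_base]
    exact mul_ne_zero (sub_ne_zero.2 hne.symm) k1.ne'
  have : (s - r) * A = 0 := by linear_combination s * e2 - r * e1
  have := (mul_eq_zero.1 this).resolve_right hA0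
  have hsr : s = r := by linarith
  rw [hsr]

/-- If there is a crossing, then there is a topmost one. -/
theorem Dom.exists_isTop (D : Dom P V a b) (hfin : G.Finite) (hG : G ⊆ P) {x y p x' : Pt}
    (hu : SUpper P a b G x y) (h : SCross P a b G x y p x') :
    ∃ p x', STop P a b G x y p x' := by
  set S : Set Pt := {p | 0 < p.2 ∧ ∃ x', SCross P a b G x y p x'} with hS
  have hSfin : S.Finite := by
    refine (hfin.biUnion fun g' hg' => D.finite.biUnion fun y' _ =>
      (D.subsingleton_crossing hG (y' := y') hg' hu).finite).subset ?_
    rintro p ⟨hp0, x', hp, y', ⟨hx', g', hg', C', hC'⟩, hp', hbel⟩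
    refine mem_biUnion hg' (mem_biUnion (x := y') ?_ ⟨hp0, hp, x', C', hx', hC', hp', hbel⟩)
    obtain ⟨c, h1, h2, rfl⟩ := of_mem_base D.lt hx'
    have hy : 0 < y'.2 := by
      obtain ⟨r, r0, r1, e⟩ := mem_segment_iff.1 hp'
      have e2 := congrArg Prod.snd e
      simp only [pt_snd] at e2
      by_contra! hle
      nlinarith
    exact D.constructed_vertex hC' (D.constructed_openSegment (hG hg') hC' rfl hy)
  -- If there is no crossing above the axis, all crossings have height 0 and any of them is topmost.
  rcases S.eq_empty_or_nonempty with he | hne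
  · refine ⟨p, x', h, fun q x'' hq => ?_⟩
    have h1 : q.2 ≤ 0 := by
      by_contra! hlt
      have : q ∈ S := ⟨hlt, x'', hq⟩
      rw [he] at this; exact this
    obtain ⟨-, g, hg, C, hC, -⟩ := hu
    have := D.upper p (hC.segment_subset h.1)
    linarith
  · obtain ⟨q, ⟨hq0, x'', hq⟩, hmax⟩ := S.exists_max_image Prod.snd hSfin hne
    refine ⟨q, x'', hq, fun r x₃ hr => ?_⟩
    rcases le_or_gt r.2 0 with h0 | h0
    · linarith
    · exact hmax r ⟨h0, x₃, hr⟩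

/-- Every connected set of points not seen from `G` lies in the triangle of some upper edge. -/
theorem Dom.exists_upper_edge_of_preconnected (D : Dom P V a b) (hfin : G.Finite) (hG : G ⊆ P)
    (hguard : ∀ e ∈ frontier P, ∃ g ∈ G, e ∈ svis P g) {H : Set Pt} (hH : IsPreconnected H)
    (hne : H.Nonempty) (hHP : H ⊆ P) (hz : ∀ z ∈ H, ∀ g ∈ G, z ∉ svis P g) :
    ∃ x y, SUpper P a b G x y ∧ (∃ p x', SCross P a b G x y p x') ∧
      ∀ p x', STop P a b G x y p x' → H ⊆ triangle x p x' := by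
  have hbase : Disjoint H (segment ℝ ((a, 0) : Pt) (b, 0)) := by
    rw [Set.disjoint_left]
    intro w hw hw'
    obtain ⟨g, hg, hv⟩ := hguard w (D.base_mem_frontier hw')
    exact hz w hw g hg hv
  obtain ⟨z, hzH⟩ := hne
  have hz0 : 0 < z.2 := by
    refine lt_of_le_of_ne (D.upper z (hHP hzH)) fun e => ?_
    obtain ⟨g, hg, hv⟩ := hguard z (D.mem_frontier_of_height (hHP hzH) e.symm)
    exact hz z hzH g hg hv
  obtain ⟨x, y, hu, hcross, hT⟩ := D.exists_upper_edge hfin hG hguard (hHP hzH) hz0 (hz z hzH)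
  refine ⟨x, y, hu, hcross, fun p x' ht => ?_⟩
  have hzT := hT p x' ht
  obtain ⟨c, c', h1, h2, h1', h2', rfl, rfl, hcc, hy0⟩ := ht.1.facts D hu
  obtain ⟨-, g, hg, C, hC, -⟩ := hu
  obtain ⟨⟨hp, y', ⟨-, g', hg', C', hC'⟩, hp', -⟩, -⟩ := ht
  have hp0 : p.2 ≠ 0 := by
    intro e
    obtain ⟨α, β, γ, -, -, -, -, e2, -⟩ := exists_weights hzT
    rw [e] at e2
    simp at e2
    linarith
  -- All three sides are seen from G: two lie on constructed edges, the third on the base, which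
  -- belongs to the frontier.
  refine IsPreconnected.subset_triangle hH ?_ ?_ ?_ ?_ hzH hzT
  · rw [cr_base]; exact mul_ne_zero (sub_ne_zero.2 hcc) hp0
  · rw [Set.disjoint_left]
    intro w hw hw'
    exact hz w hw g hg (hC.mem_svis (segment_subset_left hp hw'))
  · rw [Set.disjoint_left, segment_symm]
    intro w hw hw'
    exact hz w hw g' hg' (hC'.mem_svis (segment_subset_left hp' hw'))
  · exact hbase.mono_right ((convex_segment _ _).segment_subset (mem_base h1' h2')
      (mem_base h1 h2))

end WVPolygon

namespace WVPolygon

open Filter Topology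

/-! ### The region enclosed by a compact set -/

/-- A compact set together with the bounded components of its complement. -/
def fill (E : Set Pt) : Set Pt :=
  E ∪ {z | z ∉ E ∧ Bornology.IsBounded (connectedComponentIn Eᶜ z)}

theorem subset_fill (E : Set Pt) : E ⊆ fill E := subset_union_left

theorem mem_fill_iff_of_notMem {E : Set Pt} {z : Pt} (h : z ∉ E) :
    z ∈ fill E ↔ Bornology.IsBounded (connectedComponentIn Eᶜ z) := by
  unfold fill
  constructor
  · rintro (h' | h')
    · exact absurd h' h
    · exact h'.2
  · intro h'; exact Or.inr ⟨h, h'⟩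

theorem mem_fill_iff_of_mem_component {E : Set Pt} {z w : Pt} (hw : w ∈ connectedComponentIn Eᶜ z) :
    z ∈ fill E ↔ w ∈ fill E := by
  have hz : z ∉ E := by
    have : (connectedComponentIn Eᶜ z).Nonempty := ⟨w, hw⟩
    exact connectedComponentIn_nonempty_iff.1 this
  have hwE : w ∉ E := connectedComponentIn_subset _ _ hw
  rw [mem_fill_iff_of_notMem hz, mem_fill_iff_of_notMem hwE, connectedComponentIn_eq hw]

theorem mem_fill_iff_of_segment {E : Set Pt} {z w : Pt} (h : Disjoint (segment ℝ z w) E) :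
    z ∈ fill E ↔ w ∈ fill E := by
  apply mem_fill_iff_of_mem_component
  refine (convex_segment z w).isPreconnected.subset_connectedComponentIn (left_mem_segment ℝ z w) ?_
    (right_mem_segment ℝ z w)
  exact fun q hq => Set.disjoint_left.1 h hq

theorem isOpen_component {E : Set Pt} (hE : IsClosed E) (z : Pt) :
    IsOpen (connectedComponentIn Eᶜ z) := hE.isOpen_compl.connectedComponentIn

theorem isClosed_fill {E : Set Pt} (hE : IsClosed E) : IsClosed (fill E) := by
  rw [← isOpen_compl_iff, isOpen_iff_mem_nhds]
  intro z hz
  have hzE : z ∉ E := fun h => hz (subset_fill E h)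
  filter_upwards [(isOpen_component hE z).mem_nhds (mem_connectedComponentIn hzE)] with w hw h
  exact hz ((mem_fill_iff_of_mem_component hw).2 h)

/-- Off E, membership in the filled set is constant on open components. -/
theorem frontier_fill_subset {E : Set Pt} (hE : IsClosed E) : frontier (fill E) ⊆ E := by
  rintro z ⟨h1, h2⟩
  rw [(isClosed_fill hE).closure_eq] at h1
  by_contra hzE
  apply h2
  rw [mem_interior_iff_mem_nhds]
  filter_upwards [(isOpen_component hE z).mem_nhds (mem_connectedComponentIn hzE)] with w hw
  exact (mem_fill_iff_of_mem_component hw).1 h1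

/-- From a point farther from the origin than E, the radial ray to infinity avoids E, so its
component is unbounded. -/
theorem isCompact_fill {E : Set Pt} (hE : IsCompact E) : IsCompact (fill E) := by
  obtain ⟨R, hR⟩ := hE.isBounded.exists_norm_le
  refine Metric.isCompact_of_isClosed_isBounded (isClosed_fill hE.isClosed)
    ((Metric.isBounded_closedBall (x := (0 : Pt)) (r := max R 0)).subset fun z hz => ?_)
  rw [mem_closedBall_zero_iff]
  by_contra! hlt
  have hRz : R < ‖z‖ := (le_max_left _ _).trans_lt hlt
  have hz0 : 0 < ‖z‖ := (le_max_right _ _).trans_lt hlt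
  have hzE : z ∉ E := fun h => absurd (hR z h) (not_le.2 hRz)
  have hb := (mem_fill_iff_of_notMem hzE).1 hz
  have hpre : IsPreconnected ((fun t : ℝ => t • z) '' Ici 1) :=
    isPreconnected_Ici.image _ (by fun_prop)
  have hsub : (fun t : ℝ => t • z) '' Ici 1 ⊆ connectedComponentIn Eᶜ z := by
    refine hpre.subset_connectedComponentIn ⟨1, self_mem_Ici, one_smul ℝ z⟩ ?_
    rintro _ ⟨t, ht, rfl⟩ hE'
    have ht' : (1 : ℝ) ≤ t := ht
    have := hR _ hE'
    simp only [norm_smul, Real.norm_eq_abs] at this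
    rw [abs_of_nonneg (by linarith)] at this
    nlinarith
  obtain ⟨M, hM⟩ := (hb.subset hsub).exists_norm_le
  have h1 : (1 : ℝ) ≤ max 1 ((M + 1) / ‖z‖) := le_max_left _ _
  have := hM _ (mem_image_of_mem _ h1)
  rw [norm_smul, Real.norm_eq_abs, abs_of_nonneg (by linarith)] at this
  have h2 := mul_le_mul_of_nonneg_right (le_max_right 1 ((M + 1) / ‖z‖)) hz0.le
  rw [div_mul_cancel₀ _ hz0.ne'] at h2
  linarith

theorem fill_filled {E : Set Pt} {k : Pt} (hk : k ∉ fill E) : ∃ T : Set Pt, k ∈ T ∧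
    IsPreconnected T ∧ ¬ Bornology.IsBounded T ∧ Disjoint T (fill E) := by
  have hkE : k ∉ E := fun h => hk (subset_fill E h)
  refine ⟨connectedComponentIn Eᶜ k, mem_connectedComponentIn hkE,
    isPreconnected_connectedComponentIn, fun h => hk ((mem_fill_iff_of_notMem hkE).2 h), ?_⟩
  rw [Set.disjoint_left]
  intro w hw hw'
  exact hk ((mem_fill_iff_of_mem_component hw).2 hw')

/-! ### Conical neighborhoods -/

/-- Near `q`, the set is a cone with apex `q`. -/
def ConeAt (S : Set Pt) (q : Pt) : Prop :=
  ∀ᶠ w in 𝓝 q, ∀ t, 0 < t → t ≤ 1 → (w ∈ S ↔ pt q w t ∈ S)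

theorem ConeAt.inter {S T : Set Pt} {q : Pt} (hS : ConeAt S q) (hT : ConeAt T q) :
    ConeAt (S ∩ T) q := by
  filter_upwards [hS, hT] with w h1 h2 t t0 t1
  exact and_congr (h1 t t0 t1) (h2 t t0 t1)

theorem coneAt_iUnion {ι : Type*} [Finite ι] {S : ι → Set Pt} {q : Pt} (h : ∀ i, ConeAt (S i) q) :
    ConeAt (⋃ i, S i) q := by
  have := eventually_all.2 h
  filter_upwards [this] with w hw t t0 t1
  rw [mem_iUnion, mem_iUnion]
  exact exists_congr fun i => hw i t t0 t1

/-- An affine function keeps its sign near q if it is nonzero at q, and along each ray from q if it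
vanishes there. -/
theorem coneAt_halfplane {f : Pt → ℝ} (hf : Continuous f)
    (hpt : ∀ p q t, f (pt p q t) = (1 - t) * f p + t * f q) (q : Pt) :
    ConeAt {w | 0 ≤ f w} q := by
  rcases lt_trichotomy (f q) 0 with h | h | h
  · filter_upwards [hf.continuousAt.eventually_lt_const h] with w hw t t0 t1
    show 0 ≤ f w ↔ 0 ≤ f (pt q w t)
    rw [hpt]
    have h1 : (1 - t) * f q ≤ 0 := mul_nonpos_of_nonneg_of_nonpos (by linarith) h.le
    have h2 : t * f w < 0 := mul_neg_of_pos_of_neg t0 hw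
    constructor <;> intro <;> linarith
  · refine Eventually.of_forall fun w t t0 t1 => ?_
    show 0 ≤ f w ↔ 0 ≤ f (pt q w t)
    rw [hpt, h, mul_zero, zero_add]
    exact (mul_nonneg_iff_of_pos_left t0).symm
  · filter_upwards [hf.continuousAt.eventually_const_lt h] with w hw t t0 t1
    show 0 ≤ f w ↔ 0 ≤ f (pt q w t)
    rw [hpt]
    have h1 : 0 ≤ (1 - t) * f q := mul_nonneg (by linarith) h.le
    have h2 : 0 < t * f w := mul_pos t0 hw
    constructor <;> intro <;> linarith

/-- A segment is an intersection of four half-planes. -/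
theorem coneAt_segment {A B : Pt} (hAB : A ≠ B) (q : Pt) : ConeAt (segment ℝ A B) q := by
  set n : ℝ := (B.1 - A.1) ^ 2 + (B.2 - A.2) ^ 2 with hn
  have hn0 : 0 < n := by
    by_contra! hle
    apply hAB
    ext
    · nlinarith [sq_nonneg (B.1 - A.1), sq_nonneg (B.2 - A.2)]
    · nlinarith [sq_nonneg (B.1 - A.1), sq_nonneg (B.2 - A.2)]
  set f : Pt → ℝ := fun w => (w.1 - A.1) * (B.1 - A.1) + (w.2 - A.2) * (B.2 - A.2) with hf
  have hfp : ∀ p q t, f (pt p q t) = (1 - t) * f p + t * f q := by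
    intro p q t; simp only [hf, pt_fst, pt_snd]; ring
  have hfc : Continuous f := by rw [hf]; fun_prop
  have e : segment ℝ A B = (({w | 0 ≤ cr A B w} ∩ {w | 0 ≤ -cr A B w}) ∩ {w | 0 ≤ f w}) ∩
      {w | 0 ≤ n - f w} := by
    ext w
    constructor
    · intro hw
      obtain ⟨t, t0, t1, rfl⟩ := mem_segment_iff.1 hw
      have e1 : f (pt A B t) = t * n := by simp only [hf, pt_fst, pt_snd, hn]; ring
      have e0 : cr A B (pt A B t) = 0 := cr_pt_self _ _ _
      refine ⟨⟨⟨?_, ?_⟩, ?_⟩, ?_⟩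
      · exact e0.ge
      · show 0 ≤ -cr A B _
        rw [e0, neg_zero]
      · show 0 ≤ f _
        rw [e1]; positivity
      · show 0 ≤ n - f _
        rw [e1]; nlinarith
    · rintro ⟨⟨⟨h1, h2⟩, h3⟩, h4⟩
      have h1' : 0 ≤ cr A B w := h1
      have h2' : 0 ≤ -cr A B w := h2
      have h3' : 0 ≤ f w := h3
      have h4' : 0 ≤ n - f w := h4
      have h0 : cr A B w = 0 := by linarith
      refine mem_segment_iff.2 ⟨f w / n, div_nonneg h3' hn0.le, ?_, ?_⟩
      · rw [div_le_one hn0]; linarith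
      · unfold cr at h0
        ext
        · simp only [pt_fst, hf]; field_simp; rw [hn]
          linear_combination (-(B.2 - A.2)) * h0
        · simp only [pt_snd, hf]; field_simp; rw [hn]
          linear_combination (B.1 - A.1) * h0
  rw [e]
  refine (((coneAt_halfplane (continuous_cr A B) (cr_pt A B) q).inter
    (coneAt_halfplane (f := fun w => -cr A B w) (continuous_cr A B).neg (fun p q t => ?_) q)).inter
    (coneAt_halfplane hfc hfp q)).inter
    (coneAt_halfplane (f := fun w => n - f w) (continuous_const.sub hfc) (fun p q t => ?_) q)
  · simp only [cr_pt]; ring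
  · simp only [hfp]; ring

/-- As E is conical at q, the segment from a nearby point off E to its contraction towards q avoids
E and stays in one component. -/
theorem ConeAt.fill {E : Set Pt} {q : Pt} (h : ConeAt E q) : ConeAt (fill E) q := by
  filter_upwards [h] with w hw t t0 t1
  by_cases hwE : w ∈ E
  · exact ⟨fun _ => subset_fill E ((hw t t0 t1).1 hwE), fun _ => subset_fill E hwE⟩
  · apply mem_fill_iff_of_segment
    rw [Set.disjoint_left]
    intro z hz hzE
    obtain ⟨s, s0, s1, rfl⟩ := mem_segment_iff.1 hz
    have e : pt w (pt q w t) s = pt q w (1 - s * (1 - t)) := by ext <;> simp <;> ring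
    rw [e] at hzE
    have h1 : s * (1 - t) ≤ 1 - t := mul_le_of_le_one_left (by linarith) s1
    have h2 : 0 ≤ s * (1 - t) := mul_nonneg s0 (by linarith)
    exact hwE ((hw _ (by linarith) (by linarith)).2 hzE)

end WVPolygon

/-! ### From polygons to the abstract setting -/

namespace WVPolygon

open Filter Topology

section Region

variable {m : ℕ} {poly : Polygon Pt (m + 3)}

theorem edgeSet_eq (i : Fin (m + 3)) :
    poly.edgeSet ℝ i = segment ℝ (poly i) (poly (i + 1)) := by
  unfold Polygon.edgeSet
  rw [affineSegment_eq_segment, finRotate_apply]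

theorem isCompact_boundary : IsCompact (poly.boundary ℝ) := by
  unfold Polygon.boundary
  refine isCompact_iUnion fun i => ?_
  rw [edgeSet_eq]; exact isCompact_segment _ _

theorem IsSimple.coneAt (h : IsSimple poly) (q : Pt) : ConeAt (poly.boundary ℝ) q := by
  unfold Polygon.boundary
  refine coneAt_iUnion fun i => ?_
  rw [edgeSet_eq]
  exact coneAt_segment (fun e => by simpa using h.injective e) q

theorem IsSimple.eq_of_mem (h : IsSimple poly) {q : Pt} (hq : q ∉ range poly.vertices)
    {i j : Fin (m + 3)} (hi : q ∈ poly.edgeSet ℝ i) (hj : q ∈ poly.edgeSet ℝ j) : i = j := by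
  have hc : ∀ k, q ∈ poly.edgeSet ℝ k → q ∉ poly.edgeSet ℝ (k + 1) := by
    intro k h1 h2
    have : q ∈ poly.edgeSet ℝ k ∩ poly.edgeSet ℝ (k + 1) := ⟨h1, h2⟩
    rw [h.consecutive k] at this
    exact hq ⟨k + 1, this.symm⟩
  by_contra hij
  by_cases h1 : j = i + 1
  · exact hc i hi (h1 ▸ hj)
  by_cases h2 : i = j + 1
  · exact hc j hj (h2 ▸ hi)
  exact Set.disjoint_left.1 (h.disjoint i j hij h1 h2) hi hj

/-- A point that is not a vertex is on at most one edge, so a small ball meets the boundary at most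
along one line, and segments strictly on one side of it avoid the boundary. -/
theorem IsSimple.line (h : IsSimple poly) {q : Pt} (hq : q ∉ range poly.vertices) :
    ∃ ε > 0, ∃ n : Pt, n ≠ 0 ∧ ∀ w w', dist w q < ε → dist w' q < ε →
      0 < (n.1 * (w.1 - q.1) + n.2 * (w.2 - q.2)) * (n.1 * (w'.1 - q.1) + n.2 * (w'.2 - q.2)) →
      (w ∈ region poly ↔ w' ∈ region poly) := by
  by_cases hqE : q ∈ poly.boundary ℝ
  · obtain ⟨i, hi⟩ := mem_iUnion.1 hqE
    set E' := ⋃ j ∈ ({i}ᶜ : Set (Fin (m + 3))), poly.edgeSet ℝ j with hE'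
    have hE'c : IsClosed E' := (Set.toFinite _).isClosed_biUnion fun j _ => by
      rw [edgeSet_eq]; exact (isCompact_segment _ _).isClosed
    have hqE' : q ∉ E' := by
      intro h'
      simp only [hE', mem_iUnion] at h'
      obtain ⟨j, hj, hqj⟩ := h'
      exact hj (h.eq_of_mem hq hqj hi)
    obtain ⟨ε, hε, hball⟩ := Metric.isOpen_iff.1 hE'c.isOpen_compl q hqE'
    set A := poly i with hA
    set B := poly (i + 1) with hB
    have hAB : A ≠ B := fun e => by simpa using h.injective e
    rw [edgeSet_eq] at hi
    have hline : ∀ z ∈ segment ℝ A B, cr A B z = 0 := by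
      intro z hz
      obtain ⟨t, -, -, rfl⟩ := mem_segment_iff.1 hz
      exact cr_pt_self _ _ _
    have hq0 := hline q hi
    refine ⟨ε, hε, (-(B.2 - A.2), B.1 - A.1), ?_, fun w w' hw hw' hpos => ?_⟩
    · intro e
      apply hAB
      have h1 := congrArg Prod.fst e
      have h2 := congrArg Prod.snd e
      simp at h1 h2
      ext <;> linarith
    · have key : ∀ z : Pt, -(B.2 - A.2) * (z.1 - q.1) + (B.1 - A.1) * (z.2 - q.2) = cr A B z := by
        intro z
        unfold cr at hq0 ⊢
        linear_combination -hq0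
      simp only [key] at hpos
      apply mem_fill_iff_of_segment
      rw [Set.disjoint_left]
      intro z hz hzE
      obtain ⟨j, hj⟩ := mem_iUnion.1 hzE
      by_cases hji : j = i
      · rw [hji, edgeSet_eq] at hj
        have hz0 := hline z hj
        obtain ⟨t, t0, t1, rfl⟩ := mem_segment_iff.1 hz
        rw [cr_pt] at hz0
        have h1 : 0 ≤ t * (cr A B w * cr A B w') := mul_nonneg t0 hpos.le
        have h2 : (1 - t) * cr A B w ^ 2 + t * (cr A B w * cr A B w') = 0 := by
          linear_combination cr A B w * hz0
        have h3 : 0 ≤ (1 - t) * cr A B w ^ 2 := mul_nonneg (by linarith) (sq_nonneg _)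
        have hw0 : 0 < cr A B w ^ 2 := by
          have : cr A B w ≠ 0 := fun e => by rw [e] at hpos; simp at hpos
          positivity
        have h4 : t = 0 := by
          have : t * (cr A B w * cr A B w') = 0 := by linarith
          exact (mul_eq_zero.1 this).resolve_right hpos.ne'
        rw [h4] at h2
        linarith
      · exact hball ((convex_ball q ε).segment_subset hw hw' hz) (mem_biUnion hji hj)
  · obtain ⟨ε, hε, hball⟩ := Metric.isOpen_iff.1 isCompact_boundary.isClosed.isOpen_compl q hqE
    refine ⟨ε, hε, (1, 0), by simp, fun w w' hw hw' _ => ?_⟩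
    apply mem_fill_iff_of_segment
    rw [Set.disjoint_left]
    intro z hz
    exact hball ((convex_ball q ε).segment_subset hw hw' hz)

theorem IsWV.baseEdge_eq (h : IsWV poly) :
    baseEdge poly = segment ℝ (((u poly).1, 0) : Pt) ((v poly).1, 0) := by
  have e1 : u poly = ((u poly).1, 0) := Prod.ext rfl h.u_axis
  have e2 : v poly = ((v poly).1, 0) := Prod.ext rfl h.v_axis
  rw [← e1, ← e2]; rfl

theorem baseEdge_subset_region : baseEdge poly ⊆ region poly := by
  refine Subset.trans ?_ (subset_fill _)
  intro z hz
  -- The base is the closing edge of the chain, from the last vertex back to the first.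
  refine mem_iUnion.2 ⟨Fin.last (m + 2), ?_⟩
  rw [edgeSet_eq, Fin.last_add_one, segment_symm]
  exact hz

theorem IsWV.dom (h : IsWV poly) :
    Dom (region poly) (range poly.vertices) (u poly).1 (v poly).1 where
  compact := isCompact_fill isCompact_boundary
  finite := finite_range _
  filled := fun k hk => fill_filled hk
  upper := h.upper_halfplane
  lt := h.u_left
  base := fun c h1 h2 => baseEdge_subset_region (by rw [h.baseEdge_eq]; exact mem_base h1 h2)
  left_mem := ⟨0, Prod.ext rfl h.u_axis⟩
  right_mem := ⟨Fin.last (m + 2), Prod.ext rfl h.v_axis⟩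
  weak := by
    intro z hz
    obtain ⟨c, hc, hv⟩ := h.weakly_visible z hz
    rw [h.baseEdge_eq] at hc
    obtain ⟨c, h1, h2, rfl⟩ := of_mem_base h.u_left hc
    exact ⟨c, h1, h2, svis_comm.1 hv⟩
  cone := fun q => by
    obtain ⟨ε, hε, hball⟩ := Metric.eventually_nhds_iff.1 (h.simple.coneAt q).fill
    exact ⟨ε, hε, fun w hw => hball hw⟩
  line := fun q hq => h.simple.line hq

theorem isConstructedEdge_iff {g x y : Pt} {C : Set Pt} :
    IsConstructedEdge poly g C x y ↔ SConstructed (region poly) g C x y :=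
  ⟨fun h => ⟨h.pocket, h.ne, h.le, h.eq_segment⟩, fun h => ⟨h.pocket, h.ne, h.le, h.eq_segment⟩⟩

theorem IsWV.mem_upperBaseEdges_iff (h : IsWV poly) {G : Set Pt} {e : Pt × Pt} :
    e ∈ upperBaseEdges poly G ↔ SUpper (region poly) (u poly).1 (v poly).1 G e.1 e.2 := by
  unfold upperBaseEdges SUpper
  rw [← h.baseEdge_eq]
  simp only [isConstructedEdge_iff]
  rfl

theorem IsWV.isCrossing_iff (h : IsWV poly) {G : Set Pt} {e : Pt × Pt} {p x' : Pt} :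
    IsCrossing poly G e p x' ↔
      SCross (region poly) (u poly).1 (v poly).1 G e.1 e.2 p x' := by
  unfold IsCrossing SCross baseConstructedEdges SBase
  rw [← h.baseEdge_eq]
  simp only [isConstructedEdge_iff]
  rfl

theorem IsWV.isTopmostCrossing_iff (h : IsWV poly) {G : Set Pt} {e : Pt × Pt} {p x' : Pt} :
    IsTopmostCrossing poly G e p x' ↔
      STop (region poly) (u poly).1 (v poly).1 G e.1 e.2 p x' := by
  unfold IsTopmostCrossing STop
  simp only [h.isCrossing_iff]

theorem IsWV.exists_guard (h : IsWV poly) {G : Set Pt} (hG : G ⊆ region poly) {e : Pt × Pt}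
    (he : e ∈ upperBaseEdges poly G) {p x' : Pt} (hp : IsCrossing poly G e p x') :
    ∃ i, triangle e.1 p x' ⊆ vis poly (poly i) := by
  obtain ⟨_, ⟨i, rfl⟩, hT⟩ := (h.isCrossing_iff.1 hp).exists_vertex_guard h.dom hG
    (h.mem_upperBaseEdges_iff.1 he)
  exact ⟨i, hT⟩

theorem IsWV.nonempty_run (h : IsWV poly) {G : Set Pt} (hfin : G.Finite) (hG : G ⊆ region poly) :
    Nonempty (Run poly G) := by
  have key : ∀ e : Pt × Pt, ∃ w : Pt × Pt × Fin (m + 3), e ∈ activeEdges poly G →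
      IsTopmostCrossing poly G e w.1 w.2.1 ∧
        triangle e.1 w.1 w.2.1 ⊆ vis poly (poly w.2.2) := by
    intro e
    by_cases he : e ∈ activeEdges poly G
    · obtain ⟨hu, p, x', hp⟩ := he
      obtain ⟨q, x'', hq⟩ := h.dom.exists_isTop hfin hG (h.mem_upperBaseEdges_iff.1 hu)
        (h.isCrossing_iff.1 hp)
      have hq' := h.isTopmostCrossing_iff.2 hq
      obtain ⟨i, hi⟩ := h.exists_guard hG hu hq'.1
      exact ⟨(q, x'', i), fun _ => ⟨hq', hi⟩⟩
    -- A run is not constrained at inactive edges, so any value serves there.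
    · exact ⟨(0, 0, 0), fun h' => absurd h' he⟩
  choose f hf using key
  exact ⟨⟨fun e => (f e).1, fun e => (f e).2.1, fun e => (f e).2.2, fun e he => (hf e he).1,
    fun e he => (hf e he).2⟩⟩

/-- Stated for connected unseen sets, so that it applies to holes and also to single points when
guarding is proved. -/
theorem IsWV.exists_triangle (h : IsWV poly) {G : Set Pt} (hfin : G.Finite)
    (hG : G ⊆ region poly) (hguard : Guards poly G (poly.boundary ℝ)) (R : Run poly G) {H : Set Pt}
    (hH : IsConnected H) (hHP : H ⊆ region poly) (hz : ∀ z ∈ H, ∀ g ∈ G, z ∉ vis poly g) :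
    ∃ e ∈ activeEdges poly G, H ⊆ triangle e.1 (R.apex e) (R.foot e) := by
  obtain ⟨x, y, hu, ⟨p, x', hp⟩, hT⟩ := h.dom.exists_upper_edge_of_preconnected hfin hG
    (fun q hq => hguard q (frontier_fill_subset isCompact_boundary.isClosed hq))
    hH.isPreconnected hH.nonempty hHP hz
  have he : (x, y) ∈ activeEdges poly G :=
    ⟨h.mem_upperBaseEdges_iff.2 hu, p, x', h.isCrossing_iff.2 hp⟩
  exact ⟨(x, y), he, hT _ _ (h.isTopmostCrossing_iff.1 (R.topmost _ he))⟩

/-- Each active edge is charged to a point of G to which it belongs; `Dom.upper_edge_unique` gives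
injectivity. -/
theorem IsWV.exists_injOn (h : IsWV poly) {G : Set Pt} (hG : G ⊆ region poly) :
    ∃ f : Pt × Pt → Pt, MapsTo f (activeEdges poly G) G ∧ InjOn f (activeEdges poly G) := by
  have key : ∀ e : Pt × Pt, ∃ g, e ∈ activeEdges poly G → g ∈ G ∧
      ∃ C, SConstructed (region poly) g C e.1 e.2 ∧ SLiesBelow (region poly) C e.1 e.2 := by
    intro e
    by_cases he : e ∈ activeEdges poly G
    · obtain ⟨-, g, hg, hC⟩ := h.mem_upperBaseEdges_iff.1 he.1
      exact ⟨g, fun _ => ⟨hg, hC⟩⟩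
    · exact ⟨0, fun h' => absurd h' he⟩
  choose f hf using key
  refine ⟨f, fun e he => (hf e he).1, fun e he e' he' hee => ?_⟩
  obtain ⟨hg, C, hC, hb⟩ := hf e he
  obtain ⟨hg', C', hC', hb'⟩ := hf e' he'
  rw [← hee] at hC'
  obtain ⟨hu, p, x', hp⟩ := he
  obtain ⟨hu', p', x'', hp'⟩ := he'
  have hu := h.mem_upperBaseEdges_iff.1 hu
  have hu' := h.mem_upperBaseEdges_iff.1 hu'
  obtain ⟨c, -, -, -, -, -, ex, -, -, hy⟩ := (h.isCrossing_iff.1 hp).facts h.dom hu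
  obtain ⟨c', -, -, -, -, -, ex', -, -, hy'⟩ := (h.isCrossing_iff.1 hp').facts h.dom hu'
  obtain ⟨h1, h2⟩ := h.dom.upper_edge_unique (hG hg) hC hb hC' hb' hu.1 hu'.1 (by rw [ex])
    (by rw [ex']) hy hy'
  exact Prod.ext h1 h2

theorem Run.output_eq {G : Set Pt} (R : Run poly G) :
    R.output = (fun e => poly (R.guard e)) '' activeEdges poly G := by
  ext w
  constructor
  · rintro ⟨e, he, rfl⟩; exact ⟨e, he, rfl⟩
  · rintro ⟨e, he, rfl⟩; exact ⟨e, he, rfl⟩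

theorem IsWV.output_bound (h : IsWV poly) {G : Finset Pt} (hG : (G : Set Pt) ⊆ region poly)
    (R : Run poly (G : Set Pt)) : R.output.Finite ∧ R.output.ncard ≤ G.card := by
  obtain ⟨f, hf, hinj⟩ := h.exists_injOn hG
  have hfin : (activeEdges poly (G : Set Pt)).Finite := Set.Finite.of_injOn hf hinj G.finite_toSet
  rw [R.output_eq]
  refine ⟨hfin.image _, (Set.ncard_image_le hfin).trans ?_⟩
  rw [← Set.ncard_coe_finset]
  exact Set.ncard_le_ncard_of_injOn f hf hinj G.finite_toSet

theorem IsWV.guards (h : IsWV poly) {G : Set Pt} (hfin : G.Finite)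
    (hG : G ⊆ region poly) (hguard : Guards poly G (poly.boundary ℝ)) (R : Run poly G) :
    Guards poly (G ∪ R.output) (region poly) := by
  intro z hz
  by_cases hs : ∃ g ∈ G, z ∈ vis poly g
  · obtain ⟨g, hg, hv⟩ := hs
    exact ⟨g, Or.inl hg, hv⟩
  · push Not at hs
    obtain ⟨e, he, hT⟩ := h.exists_triangle hfin hG hguard R (isConnected_singleton (x := z))
      (by simpa using hz) (by simpa using hs)
    exact ⟨_, Or.inr ⟨e, he, rfl⟩, R.guarded e he (hT rfl)⟩

end Region

end WVPolygon

/-! ### The main theorem -/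

theorem mainTheorem4 {m : ℕ} (poly : Polygon WVPolygon.Pt (m + 3)) (hP : WVPolygon.IsWV poly)
    (G : Finset WVPolygon.Pt) (hG : (G : Set WVPolygon.Pt) ⊆ WVPolygon.region poly)
    (hguard : WVPolygon.Guards poly (G : Set WVPolygon.Pt) (poly.boundary ℝ)) :
    -- every triangle that the algorithm may consider lies in `P` and is guarded by one vertex
    (∀ e ∈ WVPolygon.upperBaseEdges poly (G : Set WVPolygon.Pt), ∀ p x',
      WVPolygon.IsTopmostCrossing poly (G : Set WVPolygon.Pt) e p x' →
        WVPolygon.triangle e.1 p x' ⊆ WVPolygon.region poly ∧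
        ∃ i, WVPolygon.triangle e.1 p x' ⊆ WVPolygon.vis poly (poly i)) ∧
    -- the algorithm can be carried out
    Nonempty (WVPolygon.Run poly (G : Set WVPolygon.Pt)) ∧
    -- every run of it is correct
    (∀ R : WVPolygon.Run poly (G : Set WVPolygon.Pt),
      (∀ H, WVPolygon.IsHole poly (G : Set WVPolygon.Pt) H → ∃ T ∈ R.triangles, H ⊆ T) ∧
      R.output.Finite ∧ R.output.ncard ≤ G.card ∧
      WVPolygon.Guards poly ((G : Set WVPolygon.Pt) ∪ R.output) (WVPolygon.region poly)) ∧
    -- in particular, at most `|G|` further vertices suffice to guard `P`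
    (∃ G' : Finset WVPolygon.Pt, (G' : Set WVPolygon.Pt) ⊆ Set.range poly.vertices ∧
      G'.card ≤ G.card ∧
      WVPolygon.Guards poly ((G : Set WVPolygon.Pt) ∪ (G' : Set WVPolygon.Pt))
        (WVPolygon.region poly)) := by
  have hrun := hP.nonempty_run G.finite_toSet hG
  refine ⟨fun e he p x' hp => ?_, hrun, fun R => ⟨fun H hH => ?_, ?_⟩, ?_⟩
  · obtain ⟨i, hi⟩ := hP.exists_guard hG he hp.1
    exact ⟨hi.trans WVPolygon.svis_subset, i, hi⟩
  · obtain ⟨e, he, hT⟩ := hP.exists_triangle G.finite_toSet hG hguard R hH.connected hH.subset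
      hH.unseen
    exact ⟨_, ⟨e, he, rfl⟩, hT⟩
  · obtain ⟨h1, h2⟩ := hP.output_bound hG R
    exact ⟨h1, h2, hP.guards G.finite_toSet hG hguard R⟩
  · obtain ⟨R⟩ := hrun
    obtain ⟨h1, h2⟩ := hP.output_bound hG R
    refine ⟨h1.toFinset, ?_, ?_, ?_⟩
    · rw [h1.coe_toFinset]
      rintro _ ⟨e, -, rfl⟩
      exact ⟨_, rfl⟩
    · rwa [← Set.ncard_eq_toFinset_card _ h1]
    · rw [h1.coe_toFinset]
      exact hP.guards G.finite_toSet hG hguard R
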